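/- **Notation.** Let $K(x)=\frac{1}{2\pi}\frac{x^\perp}{|x|^2}$, $x^\perp=(-x_2,x_1)$, be the Biot–Savart kernel on $\mathbb{R}^2$, let $\mathcal M$ be the space of finite signed Borel measures on $\mathbb{R}^2$, and for $\omega\in\mathcal M$, $r>0$ let $M_r(\omega)=\sup_{x\in\mathbb{R}^2}|\omega|(\overline B_r(x))$. Let $\phi\in C^2(\mathbb{R}^2)$ be a radial function with $\phi\ge 0$, $\int_{\mathbb{R}^2}\phi\,dx=\int_{|x|<1}\phi\,dx=1$, $\int_{|x|\le 1/2}\phi\,dx\ge\frac12$, and put $\phi_\epsilon(x)=\epsilon^{-2}\phi(x/\epsilon)$, $K_\epsilon=\phi_\epsilon*K$. For $\omega\in\mathcal M$ and $\epsilon>0$ let $$H^\epsilon(\omega)=-\frac1{4\pi}\iint\log(|x-y|^2+\epsilon^2)\,d\omega(x)\,d\omega(y),\qquad H(\omega)=\int_{\mathbb{R}^2}\frac{|\hat\omega(\zeta)|^2}{4\pi^2|\zeta|^2}\,d\zeta,\quad \hat\omega(\zeta)=\int e^{-2\pi i x\cdot\zeta}\,d\omega(x),$$ so that $H(\omega)$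 is the square of the homogeneous $H^{-1}$ norm of $\omega$. Let $T>0$. A *good vortex-blob approximation* of $\omega_0\in\mathcal M\cap H^{-1}$ along a positive sequence $\epsilon\to0$ consists of integers $N=N(\epsilon)\to\infty$, weights $\xi_1,\dots,\xi_N\in\mathbb{R}$ and positions $X_1(t),\dots,X_N(t)\in\mathbb{R}^2$, $t\in[0,T]$ (all depending on $\epsilon$), such that $$\frac{d}{dt}X_j(t)=\sum_{k=1}^N\xi_kK_\epsilon(X_j(t)-X_k(t))\quad\text{on }[0,T],$$ and such that $\omega_\epsilon(t)=\sum_j\xi_j\delta_{X_j(t)}$ satisfies: $\omega_\epsilon(0)\to\omega_0$ weak-$*$ in $\mathcal M$ (in duality with $C_0(\mathbb{R}^2)$), $\sum_j|\xi_j|\le\|\omega_0\|_{\mathcal M}$ for all $\epsilon$, and $H^\epsilon(\omega_\epsilon(0))\to H(\omega_0)$. Put $$u^\epsilon(x,t)=\sum_j\xi_jK_\epsilon(x-X_j(t)),\qquad \omega^\epsilon(x,t)=\sum_j\xi_j\phi_\epsilon(x-X_j(t)).$$ **Theorem 3.1.** Let $\omega_0\in\mathcal M\cap H^{-1}$ be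 compactly supported with $\int d\omega_0=0$, and let a good vortex-blob approximation of $\omega_0$ be given, with $\sum_j\xi_j=0$ for every $\epsilon$. Suppose that there are constants $C,\alpha>0$ and $R>0$, independent of $\epsilon$, such that for all $\epsilon$ of the sequence and all $t\in[0,T]$ $$M_r(\omega^\epsilon(t))\le Cr^\alpha\quad\text{for all }r>0,\qquad \operatorname{supp}\omega^\epsilon(t)\subset B_R(0).$$ Then: 1. There are $u\in L^2([0,T]\times\mathbb{R}^2;\mathbb{R}^2)$ and a subsequence $\epsilon_k\to0$ such that $u^{\epsilon_k}\to u$ strongly in $L^2([0,T]\times\mathbb{R}^2)$. 2. There is a constant $C'>0$ such that for all $\epsilon$ of the sequence, all $t\in[0,T]$ and all $r\ge0$ $$S_2(u^\epsilon(t);r):=\Big(\frac{1}{|B_r(0)|}\int_{B_r(0)}\int_{\mathbb{R}^2}|u^\epsilon(x+h,t)-u^\epsilon(x,t)|^2\,dx\,dh\Big)^{1/2}\le C'r^{\alpha/2}$$ (with $S_2:=0$ for $r=0$). 3. The limit $u$ is an energy-conservative weak solution of the incompressible Euler equations with initial velocity $u_0=K*\omega_0\in L^2(\mathbb{R}^2)$.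 That is, $u\in L^\infty(0,T;L^2(\mathbb{R}^2))$, $\operatorname{div}u(t)=0$ in the sense of distributions for almost every $t\in[0,T]$, $$\int_0^T\!\!\int_{\mathbb{R}^2}u\cdot\partial_t\Phi+\nabla\Phi:(u\otimes u)\,dx\,dt=-\int_{\mathbb{R}^2}u_0\cdot\Phi(\cdot,0)\,dx$$ for all $\Phi\in C_c^\infty([0,T)\times\mathbb{R}^2;\mathbb{R}^2)$ with $\operatorname{div}\Phi=0$, and $\|u(t)\|_{L^2}=\|u_0\|_{L^2}$ for almost every $t\in[0,T]$. 4. No energy concentration occurs: for every $g\in C_c([0,T]\times\mathbb{R}^2)$, $$\int_0^T\!\!\int_{\mathbb{R}^2} g\,|u^{\epsilon_k}|^2\,dx\,dt\to\int_0^T\!\!\int_{\mathbb{R}^2} g\,|u|^2\,dx\,dt .$$ -/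

import Mathlib

open MeasureTheory Filter Topology Set
open scoped ENNReal NNReal ZeroAtInfty SchwartzMap

noncomputable section

namespace VortexBlob

/-- The Euclidean plane `ℝ²`. -/
abbrev Plane := EuclideanSpace ℝ (Fin 2)

/-! ### Biot--Savart kernel and Biot--Savart law -/

/-- `x^⊥ = (-x₂, x₁)`. -/
def perp (x : Plane) : Plane := !₂[-x 1, x 0]

/-- The Biot--Savart kernel `K(x) = x^⊥ / (2π|x|²)`. (Its value at the origin is irrelevant; the
formula gives `0` there.) -/
def bsKernel (x : Plane) : Plane := (2 * Real.pi * ‖x‖ ^ 2)⁻¹ • perp x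

/-- The velocity `K * ω` of a finite signed measure `ω`. For finite `ω` the integral converges
absolutely for Lebesgue-almost every `x`. -/
def biotSavart (ω : SignedMeasure Plane) (x : Plane) : Plane :=
  ∫ᵛ y, bsKernel (x - y) ∂<•ω

/-! ### Vortex-sheet data -/

/-- The total variation norm of a finite signed measure. -/
def totalMass (ω : SignedMeasure Plane) : ℝ := ω.totalVariation.real univ

/-- `ω` has compact support. -/
def CompactlySupported (ω : SignedMeasure Plane) : Prop :=
  ∃ A : Set Plane, IsCompact A ∧ ω.totalVariation Aᶜ = 0

/-- A finite signed measure, viewed as a tempered distribution. -/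
def toDistribution (ω : SignedMeasure Plane) : 𝓢'(Plane, ℂ) :=
  ω.toJordanDecomposition.posPart.toTemperedDistribution
    - ω.toJordanDecomposition.negPart.toTemperedDistribution

/-- `ω ∈ H^{-1}(ℝ²)`. -/
def MemHMinusOne (ω : SignedMeasure Plane) : Prop :=
  TemperedDistribution.MemSobolev (-1) 2 (toDistribution ω)

/-- The Fourier transform `ω̂(ζ) = ∫ exp(-2πi x·ζ) dω(x)` of a finite signed measure. -/
def fourierTransform (ω : SignedMeasure Plane) (ζ : Plane) : ℂ :=
  ∫ᵛ x, Complex.exp (-2 * Real.pi * Complex.I * (inner ℝ x ζ : ℝ)) ∂<•ω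

/-- The energy `H(ω) = ∫ |ω̂(ζ)|² / (4π²|ζ|²) dζ`, the square of the homogeneous `H^{-1}` norm;
formally it equals `-(2π)⁻¹ ∬ log|x-y| dω(x) dω(y)`. -/
def energy (ω : SignedMeasure Plane) : ℝ :=
  ∫ ζ : Plane, ‖fourierTransform ω ζ‖ ^ 2 / (4 * Real.pi ^ 2 * ‖ζ‖ ^ 2)

/-- The regularized energy `H^ε(ω) = -(4π)⁻¹ ∬ log(|x-y|² + ε²) dω(x) dω(y)`. -/
def regEnergy (ε : ℝ) (ω : SignedMeasure Plane) : ℝ :=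
  -(1 / (4 * Real.pi)) *
    ∫ᵛ x, (∫ᵛ y, Real.log (‖x - y‖ ^ 2 + ε ^ 2) ∂•ω) ∂•ω

/-- Weak-∗ convergence of finite signed measures, in duality with `C₀(ℝ²)`. -/
def WeakStarTendsto (ν : ℕ → SignedMeasure Plane) (ω : SignedMeasure Plane) : Prop :=
  ∀ f : C₀(Plane, ℝ), Tendsto (fun n => ∫ᵛ x, f x ∂•(ν n)) atTop (𝓝 (∫ᵛ x, f x ∂•ω))

/-- The vorticity maximal function `M_r(ω) = sup_x |ω|(closed ball of radius r around x)`. -/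
def maximalFunction (ω : SignedMeasure Plane) (r : ℝ) : ℝ≥0∞ :=
  ⨆ x : Plane, ω.totalVariation (Metric.closedBall x r)

/-! ### The vortex-blob method -/

/-- A vortex-blob function: a radial, non-negative `C²` mollifier of unit mass, the whole mass
being contained in the unit disc and at least half of it in the disc of radius `1/2`. -/
structure IsBlob (φ : Plane → ℝ) : Prop where
  contDiff : ContDiff ℝ 2 φ
  radial : ∃ f : ℝ → ℝ, ∀ x, φ x = f ‖x‖
  nonneg : ∀ x, 0 ≤ φ x
  integral_eq_one : ∫ x, φ x = 1
  integral_ball_eq_one : ∫ x in Metric.ball 0 1, φ x = 1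
  half_le_integral : 1 / 2 ≤ ∫ x in Metric.closedBall 0 (1 / 2), φ x

/-- `φ_ε(x) = ε⁻² φ(x/ε)`. -/
def scaledBlob (φ : Plane → ℝ) (ε : ℝ) (x : Plane) : ℝ := (ε ^ 2)⁻¹ * φ (ε⁻¹ • x)

/-- The regularized kernel `K_ε = φ_ε * K`. -/
def regKernel (φ : Plane → ℝ) (ε : ℝ) : Plane → Plane :=
  convolution (scaledBlob φ ε) bsKernel (ContinuousLinearMap.lsmul ℝ ℝ) volume

/-- The discrete vorticity `∑ⱼ ξⱼ δ(· - Xⱼ)`. -/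
def pointVorticity {N : ℕ} (ξ : Fin N → ℝ) (X : Fin N → Plane) : SignedMeasure Plane :=
  ∑ j, VectorMeasure.dirac (X j) (ξ j)

/-- The smooth (blob) vorticity `x ↦ ∑ⱼ ξⱼ φ_ε(x - Xⱼ)`. -/
def blobVorticity (φ : Plane → ℝ) (ε : ℝ) {N : ℕ} (ξ : Fin N → ℝ) (X : Fin N → Plane)
    (x : Plane) : ℝ :=
  ∑ j, ξ j * scaledBlob φ ε (x - X j)

/-- The velocity `x ↦ ∑ⱼ ξⱼ K_ε(x - Xⱼ)`. -/
def blobVelocity (φ : Plane → ℝ) (ε : ℝ) {N : ℕ} (ξ : Fin N → ℝ) (X : Fin N → Plane)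
    (x : Plane) : Plane :=
  ∑ j, ξ j • regKernel φ ε (x - X j)

/-- The vortex-blob equations on `[0,T]`:
`dXⱼ/dt = ∑ₖ ξₖ K_ε(Xⱼ - Xₖ)`; the argument `X` maps a time to the vortex positions. -/
def SolvesVortexBlob (φ : Plane → ℝ) (ε T : ℝ) {N : ℕ} (ξ : Fin N → ℝ)
    (X : ℝ → Fin N → Plane) : Prop :=
  ∀ t ∈ Icc (0 : ℝ) T, ∀ j,
    HasDerivWithinAt (fun s => X s j) (∑ k, ξ k • regKernel φ ε (X t j - X t k)) (Icc 0 T) t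

/-- Good vortex-blob approximation with blob function `φ`, along a sequence `ε n → 0`. -/
structure IsGoodApproximation (φ : Plane → ℝ) (T : ℝ) (ω₀ : SignedMeasure Plane)
    (ε : ℕ → ℝ) (N : ℕ → ℕ) (ξ : ∀ n, Fin (N n) → ℝ) (X : ∀ n, ℝ → Fin (N n) → Plane) :
    Prop where
  eps_pos : ∀ n, 0 < ε n
  eps_tendsto : Tendsto ε atTop (𝓝 0)
  card_tendsto : Tendsto N atTop atTop
  solves : ∀ n, SolvesVortexBlob φ (ε n) T (ξ n) (X n)
  weakStar : WeakStarTendsto (fun n => pointVorticity (ξ n) (X n 0)) ω₀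
  mass_le : ∀ n, ∑ j, |ξ n j| ≤ totalMass ω₀
  energy_tendsto :
    Tendsto (fun n => regEnergy (ε n) (pointVorticity (ξ n) (X n 0))) atTop (𝓝 (energy ω₀))

/-! ### Structure functions, weak solutions, energy -/

/-- The structure function
`S₂(v;r) = (⨍_{B_r(0)} ∫ |v(x+h) - v(x)|² dx dh)^{1/2}`. -/
def structureFunction (v : Plane → Plane) (r : ℝ) : ℝ≥0∞ :=
  (⨍⁻ h in Metric.ball (0 : Plane) r, (∫⁻ x, ‖v (x + h) - v x‖ₑ ^ 2) ∂volume) ^ (1 / 2 : ℝ)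

/-- Lebesgue measure on `[0,T] × ℝ²`. -/
def spaceTime (T : ℝ) : Measure (ℝ × Plane) := (volume.restrict (Icc 0 T)).prod volume

/-- The divergence of a vector field. -/
def divergence (v : Plane → Plane) (x : Plane) : ℝ :=
  ∑ i, (fderiv ℝ v x (EuclideanSpace.single i 1)) i

/-- Divergence-free test fields in `C_c^∞([0,T) × ℝ²; ℝ²)`, given as restrictions of smooth
fields on `ℝ × ℝ²`. The divergence has to vanish only at the times in `[0,T)`. -/
structure IsTestField (T : ℝ) (Φ : ℝ → Plane → Plane) : Prop where
  contDiff : ContDiff ℝ (⊤ : ℕ∞) (Function.uncurry Φ)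
  compactSupport : HasCompactSupport (Function.uncurry Φ)
  support_subset : tsupport (Function.uncurry Φ) ⊆ Iio T ×ˢ univ
  div_eq_zero : ∀ t ∈ Ico (0 : ℝ) T, ∀ x, divergence (Φ t) x = 0

/-- `u ∈ L^∞(0,T;L²)` is a weak solution of the incompressible Euler equations with initial
velocity `u₀ ∈ L²`. Note that `∇Φ : (u ⊗ u) = u · (DΦ u)`. -/
structure IsWeakEulerSolution (T : ℝ) (u₀ : Plane → Plane) (u : ℝ → Plane → Plane) : Prop where
  initial_memLp : MemLp u₀ 2 volume
  aestronglyMeasurable : AEStronglyMeasurable (Function.uncurry u) (spaceTime T)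
  bounded : ∃ c : ℝ≥0, ∀ᵐ t ∂(volume.restrict (Icc 0 T)), eLpNorm (u t) 2 volume ≤ c
  divergenceFree : ∀ᵐ t ∂(volume.restrict (Icc 0 T)), ∀ ψ : Plane → ℝ,
    ContDiff ℝ (⊤ : ℕ∞) ψ → HasCompactSupport ψ → ∫ x, fderiv ℝ ψ x (u t x) = 0
  momentum : ∀ Φ : ℝ → Plane → Plane, IsTestField T Φ →
    ∫ t in Icc 0 T, ∫ x, (inner ℝ (u t x) (deriv (fun s => Φ s x) t)
        + inner ℝ (u t x) (fderiv ℝ (Φ t) x (u t x)))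
      = -∫ x, inner ℝ (u₀ x) (Φ 0 x)

/-- Conservation of energy: `‖u(t)‖_{L²} = ‖u₀‖_{L²}` for almost every `t ∈ [0,T]`. -/
def IsEnergyConservative (T : ℝ) (u₀ : Plane → Plane) (u : ℝ → Plane → Plane) : Prop :=
  ∀ᵐ t ∂(volume.restrict (Icc 0 T)), eLpNorm (u t) 2 volume = eLpNorm u₀ 2 volume

/-- No energy concentration in the limit `v k → u`: the energy densities converge to that of `u`
in the sense of measures on `[0,T] × ℝ²`, i.e. the concentration measure vanishes. -/
def NoEnergyConcentration (T : ℝ) (v : ℕ → ℝ → Plane → Plane) (u : ℝ → Plane → Plane) : Prop :=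
  ∀ g : ℝ × Plane → ℝ, Continuous g → HasCompactSupport g →
    Tendsto (fun k => ∫ t in Icc 0 T, ∫ x, g (t, x) * ‖v k t x‖ ^ 2) atTop
      (𝓝 (∫ t in Icc 0 T, ∫ x, g (t, x) * ‖u t x‖ ^ 2))

end VortexBlob

end

noncomputable section

namespace VortexBlob

/-! ### The rotation by a right angle -/

/-! Write `G = -(2π)⁻¹ log|x|` and let `ψ = G * ω` be the stream function, so that `∇ψ = u^⊥`.
Everything rests on Newton's theorem: averaging `G` over a radial probability density carried by the
disc of radius `r` leaves it unchanged outside the disc and lowers it by at most `(2π)⁻¹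
log⁺(r/|x|)` inside (`IsRadialDensity.logKernel_sub`). The bound `M_r ≤ C r^α` gives `∫
log⁺(r/|x-y|) |ω(y)| dy ≤ C r^α/α` (`HasDecay.lintegral_posLog`). Hence `ψ` differs from its average
at scale `r` by `O(r^α)`, uniformly in space, time and `ε` (`abs_stream_sub_le`). For vorticities of
zero mean `∫ |u|² = ∫ ω ψ` (`integral_norm_velocity_sq`), so this sup-norm estimate controls `L²`
quantities.

Structure function: the energy identity for `ω(·+h) - ω` turns the average of `‖u(·+h) - u‖²` over a
disc of radius `r` into `2 ∫ ω (ψ - average of ψ)`, which is `O(r^α)`.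

Compactness: the energy of the difference of two vorticities is at most the difference of their
stream functions mollified at a fixed scale `δ`, plus `O(δ^α)`, times the mass. The mollified stream
functions of the point vortices are Lipschitz in space and time uniformly in `ε`; for the time
variable this uses Delort's symmetrization, since `K_ε` is odd and `|x| |K_ε(x)|` is bounded.
Arzelà–Ascoli then makes a subsequence of velocities Cauchy in `L²`, uniformly in time
(`IsBlobSequence.exists_subseq_cauchy`).

Energy: the vortex-blob system conserves `∑ ξⱼ ξₖ (φ_ε * G)(Xⱼ - Xₖ) = ∑ ξⱼ ψ(Xⱼ)`, whereas the
kinetic energy is `∑ ξⱼ (φ_ε * ψ)(Xⱼ)`. The two differ by `O(ε^α)`, and strong convergence passes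
conservation to the limit.

Equation: a blob is carried by the velocity at its centre, not by the local velocity, so the Euler
equations hold up to an error. Symmetrization and Taylor expansion reduce this error to sums `∑ₖ ξₖ
P((x - Xₖ)/ε)` with `P` vanishing at infinity. The decay hypothesis concerns the blob vorticity,
where neighbouring vortices may cancel, and does not bound such point sums directly. A Wiener-type
argument bridges the gap: `φ̂` is nonzero almost everywhere, so `P` is a uniform limit of
convolutions `φ * g`, and the sum for `φ * g` equals `∫ ω^ε(z) g((x-z)/ε) dz`, which decay makes
small (`IsBlob.eventually_abs_sum_le`).

The initial velocity is identified by duality: a test field paired with `K * ω` is a `C₀` potential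
integrated against `ω`, to which weak-∗ convergence applies. -/

lemma perp_apply_zero (x : Plane) : perp x 0 = -x 1 := rfl

lemma perp_apply_one (x : Plane) : perp x 1 = x 0 := rfl

lemma plane_ext {x y : Plane} (h0 : x 0 = y 0) (h1 : x 1 = y 1) : x = y := by
  ext i; fin_cases i <;> assumption

lemma inner_plane (x y : Plane) : inner ℝ x y = x 0 * y 0 + x 1 * y 1 := by
  simp [PiLp.inner_apply, Fin.sum_univ_two, mul_comm]

lemma norm_sq_plane (x : Plane) : ‖x‖ ^ 2 = x 0 ^ 2 + x 1 ^ 2 := by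
  rw [← real_inner_self_eq_norm_sq, inner_plane]; ring

/-- The rotation `x ↦ x^⊥` as a continuous linear map. -/
def perpL : Plane →L[ℝ] Plane :=
  LinearMap.toContinuousLinearMap
    { toFun := perp
      map_add' := fun x y => plane_ext (by simp [perp_apply_zero]; ring) (by simp [perp_apply_one])
      map_smul' := fun c x => plane_ext (by simp [perp_apply_zero]) (by simp [perp_apply_one]) }

@[simp] lemma perpL_apply (x : Plane) : perpL x = perp x := rfl

lemma perp_sub (x y : Plane) : perp (x - y) = perp x - perp y := perpL.map_sub x y
lemma perp_smul (c : ℝ) (x : Plane) : perp (c • x) = c • perp x := perpL.map_smul c x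
lemma perp_neg (x : Plane) : perp (-x) = -perp x := perpL.map_neg x
lemma perp_perp (x : Plane) : perp (perp x) = -x :=
  plane_ext (by simp [perp_apply_zero, perp_apply_one]) (by simp [perp_apply_zero, perp_apply_one])

lemma continuous_perp : Continuous perp := perpL.continuous

lemma inner_perp_perp (x y : Plane) : inner ℝ (perp x) (perp y) = inner ℝ x y := by
  simp only [inner_plane, perp_apply_zero, perp_apply_one]; ring

lemma inner_perp_self (x : Plane) : inner ℝ (perp x) x = 0 := by
  simp only [inner_plane, perp_apply_zero, perp_apply_one]; ring

lemma inner_perp_left (x y : Plane) : inner ℝ (perp x) y = -inner ℝ x (perp y) := by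
  simp only [inner_plane, perp_apply_zero, perp_apply_one]; ring

@[simp] lemma norm_perp (x : Plane) : ‖perp x‖ = ‖x‖ := by
  have : ‖perp x‖ ^ 2 = ‖x‖ ^ 2 := by
    rw [← real_inner_self_eq_norm_sq, inner_perp_perp, real_inner_self_eq_norm_sq]
  exact (sq_eq_sq₀ (norm_nonneg _) (norm_nonneg _)).1 this

/-! ### The kernels -/

/-- The Newtonian kernel `-(2π)⁻¹ log |x|`. -/
def logKernel (x : Plane) : ℝ := -(2 * Real.pi)⁻¹ * Real.log ‖x‖

lemma bsKernel_eq (x : Plane) : bsKernel x = (2 * Real.pi)⁻¹ • (‖x‖ ^ 2)⁻¹ • perp x := by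
  rw [bsKernel, smul_smul, mul_inv]

lemma norm_bsKernel (x : Plane) : ‖bsKernel x‖ = (2 * Real.pi)⁻¹ * ‖x‖⁻¹ := by
  rw [bsKernel_eq, norm_smul, norm_smul, norm_perp, norm_inv, norm_inv, norm_mul]
  rcases eq_or_ne x 0 with rfl | hx
  · simp
  · have : ‖x‖ ≠ 0 := norm_ne_zero_iff.2 hx
    simp only [Real.norm_eq_abs, abs_pow, abs_norm, abs_of_pos Real.pi_pos, Nat.abs_ofNat]
    field_simp

lemma measurable_bsKernel : Measurable bsKernel := by
  have : bsKernel = fun x => (2 * Real.pi * ‖x‖ ^ 2)⁻¹ • perp x := rfl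
  rw [this]
  have h := continuous_perp.measurable
  fun_prop

lemma measurable_logKernel : Measurable logKernel := by
  unfold logKernel; fun_prop

lemma bsKernel_neg (x : Plane) : bsKernel (-x) = -bsKernel x := by
  simp [bsKernel_eq, perp_neg]

lemma perp_bsKernel (x : Plane) :
    perp (bsKernel x) = -((2 * Real.pi)⁻¹ * (‖x‖ ^ 2)⁻¹) • x := by
  rw [bsKernel_eq, perp_smul, perp_smul, perp_perp, smul_smul, smul_neg, neg_smul]

lemma finrank_plane : Module.finrank ℝ Plane = 2 := by simp

/-- The Jacobian of polar coordinates absorbs the singularity. This is the reference majorant for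
all exchanges of integrals below: velocities of zero mean decay like `(1+|x|)⁻²`, while `K` is
singular like `|z|⁻¹`. -/
lemma integrable_inv_norm_mul :
    Integrable (fun z : Plane => ‖z‖⁻¹ * ((1 + ‖z‖) ^ 2)⁻¹) := by
  have h := integrable_fun_norm_addHaar (volume : Measure Plane)
    (f := fun y : ℝ => y⁻¹ * ((1 + y) ^ 2)⁻¹)
  rw [h, finrank_plane]
  have h2 : IntegrableOn (fun y : ℝ => ((1 + y) ^ 2)⁻¹) (Ioi 0) := by
    have := (integrable_one_add_norm (E := ℝ) (μ := volume) (r := 2) (by simp)).integrableOn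
      (s := Ioi 0)
    refine this.congr_fun (fun y hy => ?_) measurableSet_Ioi
    have hy' : (0:ℝ) < y := hy
    simp only [Real.norm_eq_abs, abs_of_pos hy']
    rw [Real.rpow_neg (by positivity)]; norm_num
  refine h2.congr_fun (fun y hy => ?_) measurableSet_Ioi
  have hy' : (0:ℝ) < y := hy
  simp only [smul_eq_mul, Nat.add_one_sub_one, pow_one]
  field_simp

lemma locallyIntegrable_inv_norm : LocallyIntegrable (fun z : Plane => ‖z‖⁻¹) := by
  rw [locallyIntegrable_iff]
  intro k hk
  obtain ⟨r, hr⟩ := hk.isBounded.exists_norm_le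
  refine Integrable.mono' ((integrable_inv_norm_mul.const_mul ((1 + r) ^ 2)).integrableOn (s := k))
    (by fun_prop) ?_
  refine (ae_restrict_iff' hk.measurableSet).2 (Eventually.of_forall fun z hz => ?_)
  have h1 := hr z hz
  have h0 := norm_nonneg z
  rw [norm_inv, norm_norm, mul_left_comm]
  refine le_mul_of_one_le_right (by positivity) ?_
  rw [← div_eq_mul_inv, one_le_div (by positivity)]
  gcongr

lemma locallyIntegrable_bsKernel : LocallyIntegrable bsKernel := by
  refine (locallyIntegrable_inv_norm.smul ((2 * Real.pi)⁻¹)).mono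
    measurable_bsKernel.aestronglyMeasurable (Eventually.of_forall fun x => ?_)
  rw [norm_bsKernel]
  simp only [Pi.smul_apply, smul_eq_mul, norm_mul, norm_inv, Real.norm_eq_abs,
    abs_of_pos Real.pi_pos, Nat.abs_ofNat, abs_norm]
  rfl

lemma abs_log_le_inv_add {t : ℝ} (ht : 0 ≤ t) : |Real.log t| ≤ t⁻¹ + t := by
  rcases ht.eq_or_lt with rfl | ht
  · simp
  have h1 := Real.log_le_sub_one_of_pos ht
  have h2 := Real.log_le_sub_one_of_pos (inv_pos.2 ht)
  rw [Real.log_inv] at h2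
  have := inv_pos.2 ht
  rw [abs_le]; constructor <;> linarith

lemma locallyIntegrable_log_norm : LocallyIntegrable (fun z : Plane => Real.log ‖z‖) := by
  have h : LocallyIntegrable (fun z : Plane => ‖z‖⁻¹ + ‖z‖) :=
    locallyIntegrable_inv_norm.add continuous_norm.locallyIntegrable
  refine h.mono (Real.measurable_log.comp measurable_norm).aestronglyMeasurable (Eventually.of_forall fun x => ?_)
  rw [Real.norm_eq_abs, Real.norm_eq_abs, abs_of_nonneg (a := ‖x‖⁻¹ + ‖x‖) (by positivity)]
  exact abs_log_le_inv_add (norm_nonneg x)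

lemma locallyIntegrable_logKernel : LocallyIntegrable logKernel :=
  locallyIntegrable_log_norm.smul (-(2 * Real.pi)⁻¹)

/-! ### Polar coordinates -/

/-- The unit vector of angle `θ`. -/
def dir (θ : ℝ) : Plane := !₂[Real.cos θ, Real.sin θ]

lemma dir_zero (θ : ℝ) : dir θ 0 = Real.cos θ := rfl
lemma dir_one (θ : ℝ) : dir θ 1 = Real.sin θ := rfl

lemma norm_dir (θ : ℝ) : ‖dir θ‖ = 1 := by
  have : ‖dir θ‖ ^ 2 = 1 := by rw [norm_sq_plane, dir_zero, dir_one]; simp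
  nlinarith [norm_nonneg (dir θ)]

/-- The isometry between `ℂ` and the plane. -/
def ofComplex : ℂ ≃ₗᵢ[ℝ] Plane := Complex.orthonormalBasisOneI.repr

lemma ofComplex_zero (z : ℂ) : ofComplex z 0 = z.re := by
  simp [ofComplex]

lemma ofComplex_one (z : ℂ) : ofComplex z 1 = z.im := by
  simp [ofComplex]

lemma ofComplex_polar (r θ : ℝ) :
    ofComplex (r * (Real.cos θ + Real.sin θ * Complex.I)) = r • dir θ := by
  apply plane_ext
  · rw [ofComplex_zero]; simp [dir_zero, Complex.cos_ofReal_re]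
  · rw [ofComplex_one]; simp [dir_one, Complex.sin_ofReal_re]

lemma measurePreserving_ofComplex : MeasurePreserving ofComplex volume volume :=
  ofComplex.measurePreserving

lemma integral_polar {E : Type*} [NormedAddCommGroup E] [NormedSpace ℝ E] (f : Plane → E) :
    ∫ x, f x = ∫ p in Ioi (0 : ℝ) ×ˢ Ioo (-Real.pi) Real.pi, p.1 • f (p.1 • dir p.2) := by
  rw [← measurePreserving_ofComplex.integral_comp
    ofComplex.toHomeomorph.toMeasurableEquiv.measurableEmbedding,
    ← Complex.integral_comp_polarCoord_symm, polarCoord_target]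
  simp only [Complex.polarCoord_symm_apply, ofComplex_polar]

lemma lintegral_polar (f : Plane → ℝ≥0∞) :
    ∫⁻ x, f x = ∫⁻ p in Ioi (0 : ℝ) ×ˢ Ioo (-Real.pi) Real.pi,
      ENNReal.ofReal p.1 • f (p.1 • dir p.2) := by
  rw [← measurePreserving_ofComplex.lintegral_comp_emb
    ofComplex.toHomeomorph.toMeasurableEquiv.measurableEmbedding,
    ← Complex.lintegral_comp_polarCoord_symm, polarCoord_target]
  simp only [Complex.polarCoord_symm_apply, ofComplex_polar]

lemma continuous_dir : Continuous dir := by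
  unfold dir
  refine (PiLp.continuous_toLp 2 _).comp (continuous_pi fun i => ?_)
  fin_cases i
  · exact Real.continuous_cos
  · exact Real.continuous_sin

lemma continuous_polar : Continuous (fun p : ℝ × ℝ => p.1 • dir p.2) :=
  continuous_fst.smul (continuous_dir.comp continuous_snd)

/-- Polar coordinates pull null sets back to null sets because the weight `p.1` is strictly positive
on the coordinate domain. -/
lemma aestronglyMeasurable_polar {E : Type*} [NormedAddCommGroup E] {f : Plane → E}
    (hf : AEStronglyMeasurable f volume) :
    AEStronglyMeasurable (fun p : ℝ × ℝ => f (p.1 • dir p.2))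
      (volume.restrict (Ioi (0 : ℝ) ×ˢ Ioo (-Real.pi) Real.pi)) := by
  obtain ⟨g, hg, hfg⟩ := hf
  refine ⟨_, hg.comp_measurable continuous_polar.measurable, ?_⟩
  obtain ⟨s, hs, hsm, hs0⟩ := exists_measurable_superset_of_null (ae_iff.1 hfg)
  have h := lintegral_polar (s.indicator 1)
  have hm : Measurable fun p : ℝ × ℝ =>
      ENNReal.ofReal p.1 • s.indicator (1 : Plane → ℝ≥0∞) (p.1 • dir p.2) :=
    (by fun_prop : Measurable fun p : ℝ × ℝ => ENNReal.ofReal p.1).mul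
      ((measurable_one.indicator hsm).comp continuous_polar.measurable)
  rw [lintegral_indicator_one hsm, hs0, eq_comm, lintegral_eq_zero_iff hm] at h
  rw [EventuallyEq, ae_restrict_iff' (by measurability)] at h ⊢
  filter_upwards [h] with p hp hpm
  by_contra hne
  have h1 : (p.1 • dir p.2) ∈ s := hs hne
  have := hp hpm
  simp only [indicator_of_mem h1, Pi.one_apply, Pi.zero_apply, smul_eq_mul, mul_one,
    ENNReal.ofReal_eq_zero] at this
  exact absurd hpm.1 (by simpa using this)

lemma integrable_polar {E : Type*} [NormedAddCommGroup E] [NormedSpace ℝ E] {f : Plane → E}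
    (hf : Integrable f) :
    IntegrableOn (fun p : ℝ × ℝ => p.1 • f (p.1 • dir p.2))
      (Ioi (0 : ℝ) ×ˢ Ioo (-Real.pi) Real.pi) := by
  refine ⟨continuous_fst.aestronglyMeasurable.smul (aestronglyMeasurable_polar hf.1), ?_⟩
  have h := hf.2
  rw [HasFiniteIntegral, lintegral_polar] at h
  rw [HasFiniteIntegral]
  refine lt_of_le_of_lt (le_of_eq ?_) h
  refine setLIntegral_congr_fun (by measurability) fun p hp => ?_
  have : (0:ℝ) < p.1 := hp.1
  simp only [enorm_smul, Real.enorm_of_nonneg this.le, smul_eq_mul]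

lemma setIntegral_prod_symm' {g : ℝ × ℝ → ℝ} {s t : Set ℝ} (hg : IntegrableOn g (s ×ˢ t)) :
    ∫ z in s ×ˢ t, g z ∂(volume.prod volume) = ∫ y in t, ∫ x in s, g (x, y) := by
  rw [IntegrableOn, Measure.volume_eq_prod, ← Measure.prod_restrict] at hg
  rw [← Measure.prod_restrict, integral_prod_symm _ hg]

/-- Integration of the radial derivative against `|z|⁻¹`: the Newtonian kernel is a fundamental
solution of the Laplacian. -/
lemma integral_radial_deriv {f : Plane → ℝ} {f' : Plane → Plane →L[ℝ] ℝ}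
    (hf : ∀ x, HasFDerivAt f (f' x) x)
    (hint : Integrable (fun z => (‖z‖ ^ 2)⁻¹ * f' z z))
    (hlim : ∀ θ, Tendsto (fun r : ℝ => f (r • dir θ)) atTop (𝓝 0)) :
    ∫ z, (‖z‖ ^ 2)⁻¹ * f' z z = -(2 * Real.pi) * f 0 := by
  have hI := integrable_polar hint
  rw [integral_polar, Measure.volume_eq_prod, setIntegral_prod_symm' hI]
  have key : ∀ᵐ θ ∂(volume.restrict (Ioo (-Real.pi) Real.pi)),
      ∫ r in Ioi (0:ℝ), r • ((‖r • dir θ‖ ^ 2)⁻¹ * f' (r • dir θ) (r • dir θ)) = -f 0 := by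
    rw [IntegrableOn, Measure.volume_eq_prod, ← Measure.prod_restrict] at hI
    filter_upwards [hI.prod_left_ae] with θ hθ
    -- The Jacobian `r` cancels the powers of `r`, leaving exactly the derivative of `f` along the
    -- ray.
    have hcongr : ∀ r ∈ Ioi (0:ℝ), r • ((‖r • dir θ‖ ^ 2)⁻¹ * f' (r • dir θ) (r • dir θ))
        = f' (r • dir θ) (dir θ) := by
      intro r hr
      have hr' : (0:ℝ) < r := hr
      rw [norm_smul, norm_dir, mul_one, map_smul, Real.norm_eq_abs, sq_abs]
      simp only [smul_eq_mul]
      field_simp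
    have hθ' : IntegrableOn (fun r : ℝ => f' (r • dir θ) (dir θ)) (Ioi 0) :=
      IntegrableOn.congr_fun (f := fun r : ℝ => r • ((‖r • dir θ‖ ^ 2)⁻¹ * f' (r • dir θ) (r • dir θ)))
        hθ hcongr measurableSet_Ioi
    rw [setIntegral_congr_fun measurableSet_Ioi hcongr]
    have hder : ∀ r ∈ Ici (0:ℝ), HasDerivAt (fun r : ℝ => f (r • dir θ)) (f' (r • dir θ) (dir θ)) r := by
      intro r _
      have h1 : HasDerivAt (fun r : ℝ => r • dir θ) (dir θ) r := by
        simpa using (hasDerivAt_id r).smul_const (dir θ)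
      exact (hf (r • dir θ)).comp_hasDerivAt r h1
    rw [integral_Ioi_of_hasDerivAt_of_tendsto' hder hθ' (hlim θ)]
    simp
  rw [integral_congr_ae key]
  simp only [integral_const, MeasurableSet.univ, measureReal_restrict_apply, univ_inter,
    Real.volume_real_Ioo_of_le (by linarith [Real.pi_pos] : -Real.pi ≤ Real.pi), smul_eq_mul]
  ring

lemma hasDerivAt_dir (θ : ℝ) : HasDerivAt dir (perp (dir θ)) θ := by
  have h : HasDerivAt (fun θ : ℝ => (![Real.cos θ, Real.sin θ] : Fin 2 → ℝ))
      ![-Real.sin θ, Real.cos θ] θ := by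
    rw [hasDerivAt_pi]
    intro i
    fin_cases i
    · exact Real.hasDerivAt_cos θ
    · exact Real.hasDerivAt_sin θ
  exact (PiLp.hasFDerivAt_toLp (𝕜 := ℝ) 2 _).comp_hasDerivAt θ h

/-- The angular derivative has vanishing integral against `|z|⁻²`. -/
lemma integral_angular_deriv {f : Plane → ℝ} {f' : Plane → Plane →L[ℝ] ℝ}
    (hf : ∀ x, HasFDerivAt f (f' x) x)
    (hint : Integrable (fun z => (‖z‖ ^ 2)⁻¹ * f' z (perp z))) :
    ∫ z, (‖z‖ ^ 2)⁻¹ * f' z (perp z) = 0 := by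
  have hI := integrable_polar hint
  rw [integral_polar, Measure.volume_eq_prod, setIntegral_prod _ hI]
  have key : ∀ᵐ r ∂(volume.restrict (Ioi (0:ℝ))), ∫ θ in Ioo (-Real.pi) Real.pi,
      r • ((‖r • dir θ‖ ^ 2)⁻¹ * f' (r • dir θ) (perp (r • dir θ))) = 0 := by
    rw [IntegrableOn, Measure.volume_eq_prod, ← Measure.prod_restrict] at hI
    filter_upwards [hI.prod_right_ae, ae_restrict_mem measurableSet_Ioi] with r hr hr0
    have hr' : (0:ℝ) < r := hr0
    have hcongr : ∀ θ, r • ((‖r • dir θ‖ ^ 2)⁻¹ * f' (r • dir θ) (perp (r • dir θ)))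
        = r⁻¹ * f' (r • dir θ) (r • perp (dir θ)) := by
      intro θ
      rw [norm_smul, norm_dir, mul_one, perp_smul, map_smul, Real.norm_eq_abs, sq_abs]
      simp only [smul_eq_mul]
      field_simp
    simp only [hcongr] at hr ⊢
    have hder : ∀ θ, HasDerivAt (fun θ => r⁻¹ * f (r • dir θ))
        (r⁻¹ * f' (r • dir θ) (r • perp (dir θ))) θ := fun θ =>
      ((hf (r • dir θ)).comp_hasDerivAt θ ((hasDerivAt_dir θ).const_smul r)).const_mul _
    have hle : -Real.pi ≤ Real.pi := by linarith [Real.pi_pos]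
    rw [← integral_Ioc_eq_integral_Ioo, ← intervalIntegral.integral_of_le hle,
      intervalIntegral.integral_eq_sub_of_hasDerivAt (fun θ _ => hder θ)]
    -- On each circle the integrand is the derivative of a periodic function of the angle.
    · have : dir Real.pi = dir (-Real.pi) := plane_ext (by simp [dir_zero]) (by simp [dir_one])
      rw [this, sub_self]
    · rw [intervalIntegrable_iff_integrableOn_Ioo_of_le hle]
      exact hr
  rw [integral_congr_ae key]
  simp

/-! ### Newton's theorem -/

/-- The rotation of angle `θ`. -/
def rotPlane (θ : ℝ) : Plane ≃ₗᵢ[ℝ] Plane :=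
  (ofComplex.symm.trans (rotation (Circle.exp θ))).trans ofComplex

lemma rotPlane_apply (θ : ℝ) (y : Plane) :
    rotPlane θ y = Real.cos θ • y + Real.sin θ • perp y := by
  obtain ⟨w, rfl⟩ := ofComplex.surjective y
  have h : rotPlane θ (ofComplex w) = ofComplex (Circle.exp θ * w) := by
    simp [rotPlane, rotation_apply]
  rw [h, Circle.coe_exp]
  apply plane_ext
  · simp [ofComplex_zero, ofComplex_one, perp_apply_zero, Complex.exp_ofReal_mul_I_re,
      Complex.exp_ofReal_mul_I_im, sub_eq_add_neg]
  · simp [ofComplex_zero, ofComplex_one, perp_apply_one, Complex.exp_ofReal_mul_I_re,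
      Complex.exp_ofReal_mul_I_im]

lemma continuous_rotPlane : Continuous (fun p : ℝ × Plane => rotPlane p.1 p.2) := by
  simp only [rotPlane_apply]
  have := continuous_perp
  fun_prop

/-- The points `rotPlane θ y` run through the circle of radius `‖y‖`, so this is the circle average
of `log |z - ·|` from Jensen's formula, shifted in angle by the argument of `y`. -/
lemma average_log_norm_sub_rotPlane (z y : Plane) (hy : y ≠ 0) :
    (2 * Real.pi)⁻¹ * ∫ θ in (0:ℝ)..2 * Real.pi, Real.log ‖z - rotPlane θ y‖
      = Real.log ‖y‖ + Real.posLog (‖y‖⁻¹ * ‖z‖) := by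
  obtain ⟨w, rfl⟩ := ofComplex.surjective y
  obtain ⟨a, rfl⟩ := ofComplex.surjective z
  have hw : ‖w‖ ≠ 0 := by
    simpa using hy
  have h := circleAverage_log_norm_sub_const_eq_log_radius_add_posLog (c := 0) (a := a) hw
  rw [Real.circleAverage_eq_integral_add w.arg] at h
  simp only [LinearIsometryEquiv.norm_map, zero_sub, norm_neg] at h ⊢
  rw [← h, smul_eq_mul]
  congr 1
  refine intervalIntegral.integral_congr fun θ _ => ?_
  have : rotPlane θ (ofComplex w) = ofComplex (circleMap 0 ‖w‖ (θ + w.arg)) := by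
    simp only [rotPlane, LinearIsometryEquiv.trans_apply, LinearIsometryEquiv.symm_apply_apply,
      rotation_apply, Circle.coe_exp, circleMap, zero_add]
    congr 1
    conv_lhs => rw [← Complex.norm_mul_exp_arg_mul_I w]
    push_cast
    rw [add_mul, Complex.exp_add]; ring
  simp only [this, ← map_sub, LinearIsometryEquiv.norm_map]
  rw [norm_sub_rev]

/-- Radial probability densities on the plane, supported in the disc of radius `r`. -/
structure IsRadialDensity (η : Plane → ℝ) (r : ℝ) : Prop where
  measurable : Measurable η
  radial : ∃ f : ℝ → ℝ, ∀ x, η x = f ‖x‖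
  nonneg : ∀ x, 0 ≤ η x
  bounded : ∃ B, ∀ x, η x ≤ B
  integral_eq_one : ∫ x, η x = 1
  eq_zero : ∀ x, r < ‖x‖ → η x = 0

variable {η : Plane → ℝ} {r : ℝ}

lemma IsRadialDensity.rotPlane (h : IsRadialDensity η r) (θ : ℝ) (x : Plane) :
    η (rotPlane θ x) = η x := by
  obtain ⟨f, hf⟩ := h.radial
  rw [hf, hf, LinearIsometryEquiv.norm_map]

lemma IsRadialDensity.neg (h : IsRadialDensity η r) (x : Plane) : η (-x) = η x := by
  obtain ⟨f, hf⟩ := h.radial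
  rw [hf, hf, norm_neg]

lemma IsRadialDensity.integrable_smul {E : Type*} [NormedAddCommGroup E] [NormedSpace ℝ E]
    (h : IsRadialDensity η r) {g : Plane → E} (hg : LocallyIntegrable g) :
    Integrable (fun y => η y • g y) := by
  obtain ⟨B, hB⟩ := h.bounded
  have h1 : Integrable (fun y => B * ‖(Metric.closedBall (0:Plane) r).indicator g y‖) :=
    ((hg.integrableOn_isCompact (isCompact_closedBall 0 r)).integrable_indicator
      Metric.isClosed_closedBall.measurableSet).norm.const_mul B
  refine h1.mono' (h.measurable.aestronglyMeasurable.smul hg.aestronglyMeasurable)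
    (Eventually.of_forall fun y => ?_)
  by_cases hy : ‖y‖ ≤ r
  · rw [indicator_of_mem (by simpa using hy), norm_smul, Real.norm_of_nonneg (h.nonneg y)]
    exact mul_le_mul_of_nonneg_right (hB y) (norm_nonneg _)
  · rw [h.eq_zero y (not_le.1 hy), indicator_of_notMem (by simpa using hy)]
    simp

lemma locallyIntegrable_comp_sub_left {E : Type*} [NormedAddCommGroup E] {g : Plane → E}
    (hg : LocallyIntegrable g) (z : Plane) : LocallyIntegrable (fun y => g (z - y)) := by
  rw [locallyIntegrable_iff]
  intro k hk
  have h1 : MeasurePreserving (fun y : Plane => z - y) volume volume :=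
    Measure.measurePreserving_sub_left volume z
  have hk' : IsCompact ((fun y : Plane => z - y) ⁻¹' k) := by
    have : (fun y : Plane => z - y) ⁻¹' k = (fun y : Plane => z - y) '' k := by
      ext y; constructor
      · intro hy; exact ⟨z - y, hy, by simp⟩
      · rintro ⟨w, hw, rfl⟩; simpa using hw
    rw [this]; exact hk.image (by fun_prop)
  have h2 := (h1.restrict_preimage_emb (Homeomorph.subLeft z).measurableEmbedding
    ((fun y : Plane => z - y) ⁻¹' k)).integrable_comp_of_integrable
    (g := g) (by
      have h3 := hg.integrableOn_isCompact hk'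
      exact h3)
  have h4 : (fun y : Plane => z - y) ⁻¹' ((fun y : Plane => z - y) ⁻¹' k) = k := by
    ext y; simp
  rw [h4] at h2
  exact h2

/-- The left integral does not change when `y` is rotated, since `η` is radial and rotations
preserve area. Averaging over all angles and applying Fubini replaces `log ‖z - y‖` by its circle
average. -/
lemma IsRadialDensity.integral_log (h : IsRadialDensity η r) (z : Plane) :
    Integrable (fun y => η y * (Real.log ‖y‖ + Real.posLog (‖y‖⁻¹ * ‖z‖))) ∧
    ∫ y, η y * Real.log ‖z - y‖
      = ∫ y, η y * (Real.log ‖y‖ + Real.posLog (‖y‖⁻¹ * ‖z‖)) := by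
  have hint : Integrable (fun y => η y * Real.log ‖z - y‖) :=
    h.integrable_smul (E := ℝ) (locallyIntegrable_comp_sub_left locallyIntegrable_log_norm z)
  have hmp : ∀ θ, MeasurePreserving (VortexBlob.rotPlane θ) volume volume :=
    fun θ => (VortexBlob.rotPlane θ).measurePreserving
  have hemb : ∀ θ, MeasurableEmbedding (VortexBlob.rotPlane θ) :=
    fun θ => (VortexBlob.rotPlane θ).toHomeomorph.toMeasurableEquiv.measurableEmbedding
  set F : ℝ → Plane → ℝ := fun θ y => η y * Real.log ‖z - VortexBlob.rotPlane θ y‖ with hF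
  have hF1 : ∀ θ, F θ = (fun y => η y * Real.log ‖z - y‖) ∘ VortexBlob.rotPlane θ := by
    intro θ; ext y; simp [hF, h.rotPlane]
  have hFint : ∀ θ, Integrable (F θ) := fun θ => by
    rw [hF1, (hmp θ).integrable_comp_emb (hemb θ)]; exact hint
  have hFI : ∀ θ, ∫ y, F θ y = ∫ y, η y * Real.log ‖z - y‖ := fun θ => by
    rw [hF1]; exact (hmp θ).integral_comp (hemb θ) (fun y => η y * Real.log ‖z - y‖)
  have hFN : ∀ θ, ∫ y, ‖F θ y‖ = ∫ y, ‖η y * Real.log ‖z - y‖‖ := fun θ => by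
    rw [hF1]; exact (hmp θ).integral_comp (hemb θ) (fun y => ‖η y * Real.log ‖z - y‖‖)
  have hmeas : Measurable (Function.uncurry F) := by
    have := continuous_rotPlane.measurable
    have h2 := h.measurable
    exact (h2.comp measurable_snd).mul
      (Real.measurable_log.comp (measurable_const.sub this).norm)
  have hprod : Integrable (Function.uncurry F)
      ((volume.restrict (Ioc 0 (2 * Real.pi))).prod volume) := by
    rw [integrable_prod_iff hmeas.aestronglyMeasurable]
    refine ⟨Eventually.of_forall hFint, ?_⟩
    simp only [Function.uncurry_apply_pair, hFN]
    exact integrable_const _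
  have hpi : 0 ≤ 2 * Real.pi := by linarith [Real.pi_pos]
  have havg : (fun y => (2 * Real.pi)⁻¹ * ∫ θ in Ioc 0 (2 * Real.pi), F θ y) =ᵐ[volume]
      fun y => η y * (Real.log ‖y‖ + Real.posLog (‖y‖⁻¹ * ‖z‖)) := by
    have h0 : ∀ᵐ y : Plane, y ≠ 0 := by simp [ae_iff]
    filter_upwards [h0] with y hy
    rw [← average_log_norm_sub_rotPlane z y hy, intervalIntegral.integral_of_le hpi,
      integral_const_mul]
    ring
  refine ⟨(hprod.integral_prod_right.const_mul _).congr havg, ?_⟩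
  rw [← integral_congr_ae havg, integral_const_mul, ← integral_integral_swap hprod]
  simp only [hFI, integral_const, smul_eq_mul]
  rw [measureReal_restrict_apply MeasurableSet.univ, univ_inter, Real.volume_real_Ioc_of_le hpi]
  have := Real.pi_pos
  field_simp
  ring

/-- Smoothing the Newtonian kernel with a radial density only changes it on the support of the
density, and decreases it. -/
lemma IsRadialDensity.logKernel_sub (h : IsRadialDensity η r) {z : Plane}
    (hz : z ≠ 0) :
    0 ≤ logKernel z - ∫ y, η y * logKernel (z - y) ∧
    logKernel z - ∫ y, η y * logKernel (z - y)
      ≤ (2 * Real.pi)⁻¹ * Real.posLog (r * ‖z‖⁻¹) := by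
  have hz' : 0 < ‖z‖ := norm_pos_iff.2 hz
  obtain ⟨hi, he⟩ := h.integral_log z
  have hη : Integrable η := by
    simpa using h.integrable_smul (E := ℝ) (g := fun _ : Plane => (1:ℝ)) (locallyIntegrable_const 1)
  have h1 : logKernel z - ∫ y, η y * logKernel (z - y)
      = (2 * Real.pi)⁻¹ * ∫ y, η y * (Real.log ‖y‖ + Real.posLog (‖y‖⁻¹ * ‖z‖) - Real.log ‖z‖) := by
    have h2 : ∀ y, η y * (Real.log ‖y‖ + Real.posLog (‖y‖⁻¹ * ‖z‖) - Real.log ‖z‖)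
      = η y * (Real.log ‖y‖ + Real.posLog (‖y‖⁻¹ * ‖z‖)) - η y * Real.log ‖z‖ := fun y => by ring
    have h3 : ∀ y, η y * logKernel (z - y) = -(2 * Real.pi)⁻¹ * (η y * Real.log ‖z - y‖) :=
      fun y => by rw [logKernel]; ring
    simp only [h2, h3]
    rw [integral_sub hi (hη.mul_const _), integral_const_mul, he, integral_mul_const,
      h.integral_eq_one, logKernel]
    ring
  have hpi : 0 ≤ (2 * Real.pi)⁻¹ := by have := Real.pi_pos; positivity
  -- This is `log⁺ s - log⁺ s⁻¹ = log s` with `s = ‖y‖/‖z‖`. It makes the defect nonnegative and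
  -- monotone in `‖y‖`, hence largest at `‖y‖ = r`.
  have h4 : ∀ᵐ y : Plane, Real.log ‖y‖ + Real.posLog (‖y‖⁻¹ * ‖z‖) - Real.log ‖z‖
      = Real.posLog (‖y‖ * ‖z‖⁻¹) := by
    have h0 : ∀ᵐ y : Plane, y ≠ 0 := by simp [ae_iff]
    filter_upwards [h0] with y hy
    have hy' : 0 < ‖y‖ := norm_pos_iff.2 hy
    have := Real.posLog_sub_posLog_inv (x := ‖y‖ * ‖z‖⁻¹)
    rw [Real.log_mul hy'.ne' (inv_pos.2 hz').ne', Real.log_inv, mul_inv, inv_inv] at this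
    linarith
  rw [h1]
  constructor
  · refine mul_nonneg hpi (integral_nonneg_of_ae ?_)
    filter_upwards [h4] with y hy
    rw [hy]
    exact mul_nonneg (h.nonneg y) Real.posLog_nonneg
  · refine mul_le_mul_of_nonneg_left ?_ hpi
    have h5 : Real.posLog (r * ‖z‖⁻¹) = ∫ y, η y * Real.posLog (r * ‖z‖⁻¹) := by
      rw [integral_mul_const, h.integral_eq_one, one_mul]
    rw [h5]
    refine integral_mono_ae ?_ (hη.mul_const _) ?_
    · refine (hi.sub (hη.mul_const (Real.log ‖z‖))).congr (Eventually.of_forall fun y => ?_)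
      simp only [Pi.sub_apply]; ring
    · filter_upwards [h4] with y hy
      simp only [hy]
      by_cases hyr : ‖y‖ ≤ r
      · refine mul_le_mul_of_nonneg_left (Real.posLog_le_posLog (by positivity) ?_) (h.nonneg y)
        gcongr
      · rw [h.eq_zero y (not_le.1 hyr)]; simp

/-! ### Decay of the vorticity maximal function -/

/-- The mass of `|ω|` in discs of radius `r` is at most `C r^α`. -/
def HasDecay (ω : Plane → ℝ) (C α : ℝ) : Prop :=
  ∀ x : Plane, ∀ r : ℝ, 0 < r →
    ∫⁻ y in Metric.closedBall x r, ‖ω y‖ₑ ≤ ENNReal.ofReal (C * r ^ α)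

/-- Layer-cake formula: the set where `log⁺(r/|x-y|) ≥ t` lies in the closed disc of radius `r
e^{-t}`, whose mass is at most `C r^α e^{-αt}`. Integrating over `t > 0` produces the factor `1/α`.
-/
lemma HasDecay.lintegral_posLog {ω : Plane → ℝ} {C α : ℝ} (h : HasDecay ω C α)
    (hω : Measurable ω) (hC : 0 ≤ C) (hα : 0 < α) {r : ℝ} (hr : 0 < r) (x : Plane) :
    ∫⁻ y, ENNReal.ofReal (Real.posLog (r * ‖x - y‖⁻¹)) * ‖ω y‖ₑ
      ≤ ENNReal.ofReal (C * r ^ α / α) := by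
  set μ : Measure Plane := volume.withDensity fun y => ‖ω y‖ₑ with hμ
  have hlm : Measurable fun y : Plane => Real.posLog (r * ‖x - y‖⁻¹) :=
    Real.continuous_posLog.measurable.comp (by fun_prop)
  have h1 : ∫⁻ y, ENNReal.ofReal (Real.posLog (r * ‖x - y‖⁻¹)) * ‖ω y‖ₑ
      = ∫⁻ y, ENNReal.ofReal (Real.posLog (r * ‖x - y‖⁻¹)) ∂μ := by
    rw [hμ, lintegral_withDensity_eq_lintegral_mul _ (by fun_prop) hlm.ennreal_ofReal]
    simp only [Pi.mul_apply, mul_comm]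
  rw [h1, lintegral_eq_lintegral_meas_le μ
    (Eventually.of_forall fun y => Real.posLog_nonneg) hlm.aemeasurable]
  have h2 : ∀ t ∈ Ioi (0:ℝ), μ {y | t ≤ Real.posLog (r * ‖x - y‖⁻¹)}
      ≤ ENNReal.ofReal (C * r ^ α * Real.exp (-α * t)) := by
    intro t ht
    have ht' : 0 < t := ht
    have hsub : {y | t ≤ Real.posLog (r * ‖x - y‖⁻¹)}
        ⊆ Metric.closedBall x (r * Real.exp (-t)) := by
      intro y hy
      have hy' : t ≤ Real.posLog (r * ‖x - y‖⁻¹) := hy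
      rcases eq_or_ne y x with rfl | hne
      · simp at hy'; linarith
      have hpos : 0 < ‖x - y‖ := norm_pos_iff.2 (sub_ne_zero.2 hne.symm)
      rw [Real.posLog_apply, le_max_iff] at hy'
      have h3 : t ≤ Real.log (r * ‖x - y‖⁻¹) := hy'.resolve_left (by linarith)
      rw [Real.le_log_iff_exp_le (by positivity)] at h3
      rw [mem_closedBall_iff_norm', Real.exp_neg]
      rw [← div_eq_mul_inv, le_div_iff₀ hpos] at h3
      rw [← div_eq_mul_inv, le_div_iff₀ (Real.exp_pos t)]
      linarith
    refine (measure_mono hsub).trans ?_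
    rw [hμ, withDensity_apply _ Metric.isClosed_closedBall.measurableSet]
    refine (h x (r * Real.exp (-t)) (by positivity)).trans (le_of_eq ?_)
    rw [Real.mul_rpow hr.le (Real.exp_pos _).le, ← Real.exp_mul]
    congr 1
    rw [mul_assoc]
    congr 3
    ring
  refine (setLIntegral_mono' measurableSet_Ioi h2).trans (le_of_eq ?_)
  rw [← ofReal_integral_eq_lintegral_ofReal ((integrableOn_exp_mul_Ioi (by linarith) 0).const_mul _)
    (Eventually.of_forall fun t => by positivity), integral_const_mul,
    integral_exp_mul_Ioi (by linarith) 0]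
  congr 1
  simp
  field_simp

/-! ### Velocity and stream function of a density -/

/-- The velocity `ω * K`. -/
def velocity (ω : Plane → ℝ) : Plane → Plane :=
  convolution ω bsKernel (ContinuousLinearMap.lsmul ℝ ℝ) volume

/-- The stream function `ω * G`. -/
def stream (ω : Plane → ℝ) : Plane → ℝ :=
  convolution ω logKernel (ContinuousLinearMap.lsmul ℝ ℝ) volume

lemma velocity_apply (ω : Plane → ℝ) (x : Plane) :
    velocity ω x = ∫ t, ω t • bsKernel (x - t) := rfl

lemma stream_apply (ω : Plane → ℝ) (x : Plane) :
    stream ω x = ∫ t, ω t * logKernel (x - t) := rfl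

/-! ### Differential calculus of the velocity and the stream function. -/

section Basic

variable {ω : Plane → ℝ}

lemma integrable_smul_bsKernel (hω : Continuous ω) (hc : HasCompactSupport ω) (x : Plane) :
    Integrable fun t => ω t • bsKernel (x - t) :=
  hc.convolutionExists_left (ContinuousLinearMap.lsmul ℝ ℝ) hω locallyIntegrable_bsKernel x

lemma integrable_mul_logKernel (hω : Continuous ω) (hc : HasCompactSupport ω) (x : Plane) :
    Integrable fun t => ω t * logKernel (x - t) :=
  hc.convolutionExists_left (ContinuousLinearMap.lsmul ℝ ℝ) hω locallyIntegrable_logKernel x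

lemma continuous_velocity (hω : Continuous ω) (hc : HasCompactSupport ω) :
    Continuous (velocity ω) :=
  hc.continuous_convolution_left _ hω locallyIntegrable_bsKernel

lemma continuous_stream (hω : Continuous ω) (hc : HasCompactSupport ω) :
    Continuous (stream ω) :=
  hc.continuous_convolution_left _ hω locallyIntegrable_logKernel

lemma contDiff_velocity {n : ℕ∞} (hω : ContDiff ℝ n ω) (hc : HasCompactSupport ω) :
    ContDiff ℝ n (velocity ω) :=
  hc.contDiff_convolution_left _ hω locallyIntegrable_bsKernel

lemma contDiff_stream {n : ℕ∞} (hω : ContDiff ℝ n ω) (hc : HasCompactSupport ω) :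
    ContDiff ℝ n (stream ω) :=
  hc.contDiff_convolution_left _ hω locallyIntegrable_logKernel

lemma continuous_fderiv_apply (hω : ContDiff ℝ 1 ω) (v : Plane) :
    Continuous fun t => fderiv ℝ ω t v :=
  (hω.continuous_fderiv one_ne_zero).clm_apply continuous_const

lemma hasCompactSupport_fderiv_apply (hc : HasCompactSupport ω) (v : Plane) :
    HasCompactSupport fun t => fderiv ℝ ω t v :=
  hc.fderiv_apply ℝ v

lemma fderiv_velocity (hω : ContDiff ℝ 1 ω) (hc : HasCompactSupport ω) (x v : Plane) :
    fderiv ℝ (velocity ω) x v = velocity (fun t => fderiv ℝ ω t v) x := by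
  have h := hc.hasFDerivAt_convolution_left (ContinuousLinearMap.lsmul ℝ ℝ) hω
    locallyIntegrable_bsKernel x
  have hex := (hc.fderiv ℝ).convolutionExists_left
    ((ContinuousLinearMap.lsmul ℝ ℝ : ℝ →L[ℝ] Plane →L[ℝ] Plane).precompL Plane)
    (hω.continuous_fderiv one_ne_zero) locallyIntegrable_bsKernel x
  have h2 : fderiv ℝ (velocity ω) x = _ := h.fderiv
  rw [h2, convolution_def, ContinuousLinearMap.integral_apply hex.integrable]
  rfl

lemma fderiv_stream (hω : ContDiff ℝ 1 ω) (hc : HasCompactSupport ω) (x v : Plane) :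
    fderiv ℝ (stream ω) x v = stream (fun t => fderiv ℝ ω t v) x := by
  have h := hc.hasFDerivAt_convolution_left (ContinuousLinearMap.lsmul ℝ ℝ) hω
    locallyIntegrable_logKernel x
  have hex := (hc.fderiv ℝ).convolutionExists_left
    ((ContinuousLinearMap.lsmul ℝ ℝ : ℝ →L[ℝ] ℝ →L[ℝ] ℝ).precompL Plane)
    (hω.continuous_fderiv one_ne_zero) locallyIntegrable_logKernel x
  have h2 : fderiv ℝ (stream ω) x = _ := h.fderiv
  rw [h2, convolution_def, ContinuousLinearMap.integral_apply hex.integrable]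
  rfl

lemma integral_plane_apply {f : Plane → Plane} (hf : Integrable f) (i : Fin 2) :
    (∫ x, f x) i = ∫ x, f x i :=
  ((EuclideanSpace.proj (𝕜 := ℝ) i).integral_comp_comm hf).symm

lemma plane_eq_sum (v : Plane) :
    v = v 0 • EuclideanSpace.single 0 1 + v 1 • EuclideanSpace.single 1 1 := by
  apply plane_ext <;> simp

lemma clm_plane_apply {E : Type*} [NormedAddCommGroup E] [NormedSpace ℝ E] (A : Plane →L[ℝ] E)
    (v : Plane) : A v = v 0 • A (EuclideanSpace.single 0 1) + v 1 • A (EuclideanSpace.single 1 1) := by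
  conv_lhs => rw [plane_eq_sum v]
  simp

lemma divergence_eq (v : Plane → Plane) (x : Plane) :
    divergence v x = fderiv ℝ v x (EuclideanSpace.single 0 1) 0
      + fderiv ℝ v x (EuclideanSpace.single 1 1) 1 := by
  rw [divergence, Fin.sum_univ_two]

lemma hasFDerivAt_comp_add (hω : ContDiff ℝ 1 ω) (x z : Plane) :
    HasFDerivAt (fun z => ω (x + z)) (fderiv ℝ ω (x + z)) z := by
  have h := (hω.differentiable one_ne_zero (x + z)).hasFDerivAt
  simpa using! h.comp z ((hasFDerivAt_id z).const_add x)

lemma exists_radius (hc : HasCompactSupport ω) : ∃ R, 1 ≤ R ∧ ∀ y, R < ‖y‖ → ω y = 0 := by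
  obtain ⟨R, hR⟩ := hc.isCompact.isBounded.exists_norm_le
  refine ⟨max R 1, le_max_right _ _, fun y hy => ?_⟩
  by_contra hne
  exact absurd (hR y (subset_tsupport _ hne)) (not_le.2 ((le_max_left _ _).trans_lt hy))

lemma tendsto_along_ray (hc : HasCompactSupport ω) (x : Plane) (θ : ℝ) :
    Tendsto (fun r : ℝ => ω (x + r • dir θ)) atTop (𝓝 0) := by
  obtain ⟨R, -, hR⟩ := exists_radius hc
  refine tendsto_const_nhds.congr' ?_
  filter_upwards [eventually_gt_atTop (R + ‖x‖), eventually_ge_atTop 0] with r hr hr0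
  refine (hR _ ?_).symm
  have h1 : ‖r • dir θ‖ = r := by rw [norm_smul, norm_dir, mul_one, Real.norm_of_nonneg hr0]
  have h2 := norm_sub_le (x + r • dir θ) x
  rw [add_sub_cancel_left, h1] at h2
  linarith

/-- With the derivatives moved onto `ω`, the divergence at `x` is a multiple of the integral of the
angular derivative of `ω(x + ·)` against `|z|⁻²`, which vanishes. -/
lemma divergence_velocity (hω : ContDiff ℝ 1 ω) (hc : HasCompactSupport ω) (x : Plane) :
    divergence (velocity ω) x = 0 := by
  have hi : ∀ v, Integrable fun t => fderiv ℝ ω t v • bsKernel (x - t) := fun v =>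
    integrable_smul_bsKernel (continuous_fderiv_apply hω v) (hasCompactSupport_fderiv_apply hc v) x
  have hi' : ∀ v i, Integrable fun t => (fderiv ℝ ω t v • bsKernel (x - t)) i := fun v i =>
    (EuclideanSpace.proj (𝕜 := ℝ) i).integrable_comp (hi v)
  rw [divergence_eq, fderiv_velocity hω hc, fderiv_velocity hω hc, velocity_apply, velocity_apply,
    integral_plane_apply (hi _), integral_plane_apply (hi _), ← integral_add (hi' _ _) (hi' _ _)]
  have hs := (hi' (EuclideanSpace.single 0 1) 0).add (hi' (EuclideanSpace.single 1 1) 1)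
  have he : ∀ t, (fderiv ℝ ω t (EuclideanSpace.single 0 1) • bsKernel (x - t)) 0
      + (fderiv ℝ ω t (EuclideanSpace.single 1 1) • bsKernel (x - t)) 1
      = -(2 * Real.pi)⁻¹ * ((‖t - x‖ ^ 2)⁻¹ * fderiv ℝ ω (x + (t - x)) (perp (t - x))) := by
    intro t
    rw [clm_plane_apply (fderiv ℝ ω (x + (t - x))) (perp (t - x)), add_sub_cancel,
      ← neg_sub t x, bsKernel_neg, bsKernel_eq]
    simp; ring
  simp only [Pi.add_def, he] at hs
  simp only [he]
  rw [integral_const_mul, integral_sub_right_eq_self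
    (fun z => (‖z‖ ^ 2)⁻¹ * fderiv ℝ ω (x + z) (perp z)) x, integral_angular_deriv, mul_zero]
  · exact hasFDerivAt_comp_add hω x
  · have h2 := (hs.const_mul (-(2 * Real.pi))).comp_add_right x
    refine h2.congr (Eventually.of_forall fun z => ?_)
    simp only [add_sub_cancel_right]
    have := Real.pi_pos
    field_simp

/-- As for the divergence, but now the radial derivative of `ω(x + ·)` appears, and its integral
against `|z|⁻²` is `-2π ω(x)`. -/
lemma curl_velocity (hω : ContDiff ℝ 1 ω) (hc : HasCompactSupport ω) (x : Plane) :
    fderiv ℝ (velocity ω) x (EuclideanSpace.single 0 1) 1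
      - fderiv ℝ (velocity ω) x (EuclideanSpace.single 1 1) 0 = ω x := by
  have hi : ∀ v, Integrable fun t => fderiv ℝ ω t v • bsKernel (x - t) := fun v =>
    integrable_smul_bsKernel (continuous_fderiv_apply hω v) (hasCompactSupport_fderiv_apply hc v) x
  have hi' : ∀ v i, Integrable fun t => (fderiv ℝ ω t v • bsKernel (x - t)) i := fun v i =>
    (EuclideanSpace.proj (𝕜 := ℝ) i).integrable_comp (hi v)
  rw [fderiv_velocity hω hc, fderiv_velocity hω hc, velocity_apply, velocity_apply,
    integral_plane_apply (hi _), integral_plane_apply (hi _), ← integral_sub (hi' _ _) (hi' _ _)]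
  have hs := (hi' (EuclideanSpace.single 0 1) 1).sub (hi' (EuclideanSpace.single 1 1) 0)
  have he : ∀ t, (fderiv ℝ ω t (EuclideanSpace.single 0 1) • bsKernel (x - t)) 1
      - (fderiv ℝ ω t (EuclideanSpace.single 1 1) • bsKernel (x - t)) 0
      = -(2 * Real.pi)⁻¹ * ((‖t - x‖ ^ 2)⁻¹ * fderiv ℝ ω (x + (t - x)) (t - x)) := by
    intro t
    rw [clm_plane_apply (fderiv ℝ ω (x + (t - x))) (t - x), add_sub_cancel,
      ← neg_sub t x, bsKernel_neg, bsKernel_eq]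
    simp [perp_apply_zero, perp_apply_one]; ring
  simp only [Pi.sub_def, he] at hs
  simp only [he]
  rw [integral_const_mul, integral_sub_right_eq_self
    (fun z => (‖z‖ ^ 2)⁻¹ * fderiv ℝ ω (x + z) z) x,
    integral_radial_deriv (f := fun z => ω (x + z)) (f' := fun z => fderiv ℝ ω (x + z)), add_zero]
  · have := Real.pi_pos
    field_simp
  · exact hasFDerivAt_comp_add hω x
  · have h2 := (hs.const_mul (-(2 * Real.pi))).comp_add_right x
    refine h2.congr (Eventually.of_forall fun z => ?_)
    simp only [add_sub_cancel_right]
    have := Real.pi_pos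
    field_simp
  · intro θ
    exact tendsto_along_ray hc x θ

/-- The weak gradient of `log|z|` is `z/|z|²`, with no extra mass at the origin. The singularity is
smoothed as `½ log(|z|² + δ)`, for which integration by parts is classical, and both sides converge
dominatedly as `δ → 0`. -/
lemma integral_fderiv_mul_log {f : Plane → ℝ} (hf : ContDiff ℝ 1 f) (hc : HasCompactSupport f)
    (v : Plane) :
    ∫ z, fderiv ℝ f z v * Real.log ‖z‖ = -∫ z, f z * ((‖z‖ ^ 2)⁻¹ * inner ℝ z v) := by
  have hf0 := hf.continuous
  have hf1 := continuous_fderiv_apply hf v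
  have hc1 := hasCompactSupport_fderiv_apply hc v
  set δ : ℕ → ℝ := fun n => 1 / ((n : ℝ) + 1) with hδ
  have hδ0 : ∀ n, 0 < δ n := fun n => by positivity
  have hδ1 : ∀ n, δ n ≤ 1 := fun n => by
    rw [hδ]; simp only; rw [div_le_one (by positivity)]; linarith [Nat.cast_nonneg (α := ℝ) n]
  have hδl : Tendsto δ atTop (𝓝 0) := tendsto_one_div_add_atTop_nhds_zero_nat
  have hpos : ∀ n (z : Plane), 0 < ‖z‖ ^ 2 + δ n := fun n z => by have := hδ0 n; positivity
  have hg : ∀ n z, HasFDerivAt (fun z : Plane => 2⁻¹ * Real.log (‖z‖ ^ 2 + δ n))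
      ((2:ℝ)⁻¹ • ((‖z‖ ^ 2 + δ n)⁻¹ • (2 • innerSL ℝ z))) z := fun n z =>
    (((hasStrictFDerivAt_norm_sq z).hasFDerivAt.add_const (δ n)).log (hpos n z).ne').const_mul _
  have hg' : ∀ n (z : Plane), ((2:ℝ)⁻¹ • ((‖z‖ ^ 2 + δ n)⁻¹ • (2 • innerSL ℝ z))) v
      = (‖z‖ ^ 2 + δ n)⁻¹ * inner ℝ z v := fun n z => by
    simp; ring
  have hgc : ∀ n, Continuous (fun z : Plane => 2⁻¹ * Real.log (‖z‖ ^ 2 + δ n)) := fun n =>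
    continuous_const.mul (Continuous.log (by fun_prop) fun z => (hpos n z).ne')
  have hgc' : ∀ n, Continuous (fun z : Plane => (‖z‖ ^ 2 + δ n)⁻¹ * inner ℝ z v) := fun n =>
    (Continuous.inv₀ (by fun_prop) fun z => (hpos n z).ne').mul (by fun_prop)
  have hibp : ∀ n, ∫ z, fderiv ℝ f z v * (2⁻¹ * Real.log (‖z‖ ^ 2 + δ n))
      = -∫ z, f z * ((‖z‖ ^ 2 + δ n)⁻¹ * inner ℝ z v) := fun n => by
    have h := integral_bilinear_hasFDerivAt_right_eq_neg_left_of_integrable (v := v)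
      (B := ContinuousLinearMap.mul ℝ ℝ) (μ := (volume : Measure Plane)) (f := f)
      (f' := fun z => fderiv ℝ f z)
      (g := fun z : Plane => 2⁻¹ * Real.log (‖z‖ ^ 2 + δ n))
      (g' := fun z => (2:ℝ)⁻¹ • ((‖z‖ ^ 2 + δ n)⁻¹ • (2 • innerSL ℝ z)))
      ((hf1.mul (hgc n)).integrable_of_hasCompactSupport hc1.mul_right)
      (by
        simp only [hg', ContinuousLinearMap.mul_apply']
        exact (hf0.mul (hgc' n)).integrable_of_hasCompactSupport hc.mul_right)
      ((hf0.mul (hgc n)).integrable_of_hasCompactSupport hc.mul_right)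
      (fun z _ => (hf.differentiable one_ne_zero z).hasFDerivAt) (fun z _ => hg n z)
    simp only [hg', ContinuousLinearMap.mul_apply'] at h
    rw [h, neg_neg]
  have h0 : ∀ᵐ z : Plane, z ≠ 0 := by simp [ae_iff]
  have hlim1 : Tendsto (fun n => ∫ z, fderiv ℝ f z v * (2⁻¹ * Real.log (‖z‖ ^ 2 + δ n))) atTop
      (𝓝 (∫ z, fderiv ℝ f z v * Real.log ‖z‖)) := by
    refine tendsto_integral_of_dominated_convergence
      (fun z => |fderiv ℝ f z v| * (|Real.log ‖z‖| + 2⁻¹ * Real.log (‖z‖ ^ 2 + 1)))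
      (fun n => (hf1.mul (hgc n)).aestronglyMeasurable) ?_ (fun n => ?_) ?_
    · have hloc : LocallyIntegrable
          (fun z : Plane => |Real.log ‖z‖| + 2⁻¹ * Real.log (‖z‖ ^ 2 + 1)) := by
        refine LocallyIntegrable.add (locallyIntegrable_log_norm.mono
          (Real.measurable_log.comp measurable_norm).abs.aestronglyMeasurable
          (Eventually.of_forall fun z => by simp)) (Continuous.locallyIntegrable ?_)
        exact continuous_const.mul (Continuous.log (by fun_prop) fun z => by positivity)
      exact hloc.integrable_smul_left_of_hasCompactSupport hf1.abs hc1.abs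
    · filter_upwards [h0] with z hz
      have hz' : 0 < ‖z‖ := norm_pos_iff.2 hz
      rw [norm_mul]
      refine mul_le_mul_of_nonneg_left ?_ (abs_nonneg _)
      have h1 : Real.log (‖z‖ ^ 2) ≤ Real.log (‖z‖ ^ 2 + δ n) :=
        Real.log_le_log (by positivity) (by linarith [hδ0 n])
      have h2 : Real.log (‖z‖ ^ 2 + δ n) ≤ Real.log (‖z‖ ^ 2 + 1) :=
        Real.log_le_log (hpos n z) (by linarith [hδ1 n])
      have h3 : 0 ≤ Real.log (‖z‖ ^ 2 + 1) := Real.log_nonneg (by nlinarith)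
      rw [Real.log_pow] at h1
      push_cast at h1
      have h4 := neg_abs_le (Real.log ‖z‖)
      have h5 := abs_nonneg (Real.log ‖z‖)
      rw [Real.norm_eq_abs, abs_le]
      constructor <;> linarith
    · filter_upwards [h0] with z hz
      have hz' : 0 < ‖z‖ := norm_pos_iff.2 hz
      have h1 : Tendsto (fun n => Real.log (‖z‖ ^ 2 + δ n)) atTop (𝓝 (Real.log (‖z‖ ^ 2 + 0))) :=
        (tendsto_const_nhds.add hδl).log (by positivity)
      have h2 : Real.log ‖z‖ = 2⁻¹ * Real.log (‖z‖ ^ 2 + 0) := by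
        rw [add_zero, Real.log_pow]; push_cast; ring
      rw [h2]
      exact (h1.const_mul _).const_mul _
  have hlim2 : Tendsto (fun n => ∫ z, f z * ((‖z‖ ^ 2 + δ n)⁻¹ * inner ℝ z v)) atTop
      (𝓝 (∫ z, f z * ((‖z‖ ^ 2)⁻¹ * inner ℝ z v))) := by
    refine tendsto_integral_of_dominated_convergence
      (fun z => |f z| * (‖z‖⁻¹ * ‖v‖))
      (fun n => (hf0.mul (hgc' n)).aestronglyMeasurable) ?_ (fun n => ?_) ?_
    · have hloc : LocallyIntegrable (fun z : Plane => ‖z‖⁻¹ * ‖v‖) := by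
        simpa only [mul_comm, smul_eq_mul] using! locallyIntegrable_inv_norm.smul ‖v‖
      exact hloc.integrable_smul_left_of_hasCompactSupport hf0.abs hc.abs
    · filter_upwards [h0] with z hz
      have hz' : 0 < ‖z‖ := norm_pos_iff.2 hz
      rw [norm_mul]
      refine mul_le_mul_of_nonneg_left ?_ (abs_nonneg _)
      rw [norm_mul, norm_inv, Real.norm_of_nonneg (hpos n z).le]
      have h1 : ‖(inner ℝ z v : ℝ)‖ ≤ ‖z‖ * ‖v‖ := norm_inner_le_norm z v
      calc (‖z‖ ^ 2 + δ n)⁻¹ * ‖(inner ℝ z v : ℝ)‖ ≤ (‖z‖ ^ 2)⁻¹ * (‖z‖ * ‖v‖) := by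
            gcongr; linarith [hδ0 n]
        _ = ‖z‖⁻¹ * ‖v‖ := by field_simp
    · filter_upwards [h0] with z hz
      have hz' : 0 < ‖z‖ := norm_pos_iff.2 hz
      have h1 : Tendsto (fun n => (‖z‖ ^ 2 + δ n)⁻¹) atTop (𝓝 ((‖z‖ ^ 2 + 0)⁻¹)) :=
        (tendsto_const_nhds.add hδl).inv₀ (by positivity)
      rw [add_zero] at h1
      exact (h1.mul_const _).const_mul _
  refine tendsto_nhds_unique hlim1 ?_
  simp only [hibp]
  exact hlim2.neg

/-- The gradient of the stream function is the rotated velocity. -/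
lemma fderiv_stream_eq (hω : ContDiff ℝ 1 ω) (hc : HasCompactSupport ω) (x v : Plane) :
    fderiv ℝ (stream ω) x v = inner ℝ (perp (velocity ω x)) v := by
  have hi := integrable_smul_bsKernel hω.continuous hc x
  have h1 : inner ℝ (perp (velocity ω x)) v
      = ∫ t, ω t * inner ℝ (perp (bsKernel (x - t))) v := by
    rw [velocity_apply, ← perpL_apply, real_inner_comm, ← innerSL_apply_apply ℝ,
      ← ContinuousLinearMap.integral_comp_comm _ hi, ← ContinuousLinearMap.integral_comp_comm _
        (perpL.integrable_comp hi)]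
    refine integral_congr_ae (Eventually.of_forall fun t => ?_)
    simp [real_inner_comm]
  rw [h1, fderiv_stream hω hc, stream_apply]
  have hf : ContDiff ℝ 1 fun z => ω (x + z) := hω.comp (contDiff_const.add contDiff_id)
  have hfc : HasCompactSupport fun z => ω (x + z) :=
    hc.comp_homeomorph (Homeomorph.addLeft x)
  have h2 := integral_fderiv_mul_log hf hfc v
  have h3 : ∀ z, fderiv ℝ (fun z => ω (x + z)) z = fderiv ℝ ω (x + z) := fun z =>
    (hasFDerivAt_comp_add hω x z).fderiv
  simp only [h3] at h2
  rw [← integral_sub_right_eq_self (fun z => fderiv ℝ ω (x + z) v * Real.log ‖z‖) x,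
    ← integral_sub_right_eq_self (fun z => ω (x + z) * ((‖z‖ ^ 2)⁻¹ * inner ℝ z v)) x] at h2
  simp only [add_sub_cancel] at h2
  have h4 : ∀ t, fderiv ℝ ω t v * logKernel (x - t)
      = -(2 * Real.pi)⁻¹ * (fderiv ℝ ω t v * Real.log ‖t - x‖) := fun t => by
    rw [logKernel, norm_sub_rev]; ring
  have h5 : ∀ t, ω t * inner ℝ (perp (bsKernel (x - t))) v
      = (2 * Real.pi)⁻¹ * (ω t * ((‖t - x‖ ^ 2)⁻¹ * inner ℝ (t - x) v)) := fun t => by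
    rw [perp_bsKernel, inner_smul_left, ← neg_sub t x, inner_neg_left, norm_neg]
    simp; ring
  simp only [h4, h5]
  rw [integral_const_mul, integral_const_mul, h2]
  ring

lemma hasFDerivAt_stream (hω : ContDiff ℝ 1 ω) (hc : HasCompactSupport ω) (x : Plane) :
    HasFDerivAt (stream ω) (innerSL ℝ (perp (velocity ω x))) x := by
  have h := ((contDiff_stream (n := 1) hω hc).differentiable one_ne_zero x).hasFDerivAt
  have he : fderiv ℝ (stream ω) x = innerSL ℝ (perp (velocity ω x)) :=
    ContinuousLinearMap.ext fun v => fderiv_stream_eq hω hc x v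
  rwa [he] at h

end Basic

/-! ### Decay at infinity and the energy identity -/

/-- Up to a rotation and the factor `(2π)⁻¹`, `K` is the inversion in the unit circle, whose effect
on distances is known exactly. -/
lemma norm_bsKernel_sub {a b : Plane} (ha : a ≠ 0) (hb : b ≠ 0) :
    ‖bsKernel a - bsKernel b‖ = (2 * Real.pi)⁻¹ * (‖a - b‖ * (‖a‖⁻¹ * ‖b‖⁻¹)) := by
  have h := EuclideanGeometry.dist_inversion_inversion (c := (0 : Plane)) (x := a) (y := b) ha hb 1
  simp only [EuclideanGeometry.inversion, vsub_eq_sub, sub_zero, vadd_eq_add, add_zero,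
    dist_eq_norm, one_div, one_pow, inv_pow] at h
  rw [bsKernel_eq, bsKernel_eq, ← smul_sub, ← perp_smul, ← perp_smul, ← perp_sub, norm_smul,
    norm_perp, h, Real.norm_of_nonneg (by have := Real.pi_pos; positivity), mul_inv]
  ring

/-- The inequality `1 + |x-y| ≤ (1+|y|)(1+|x|)` moves the weight from `x` to `x - y` at the price of
`(1+|y|)²`; the rest is translation invariant. -/
lemma integrable_bsKernel_weight (y : Plane) :
    Integrable (fun x => ‖bsKernel (x - y)‖ * ((1 + ‖x‖) ^ 2)⁻¹) ∧
      ∫ x, ‖bsKernel (x - y)‖ * ((1 + ‖x‖) ^ 2)⁻¹ ≤ (1 + ‖y‖) ^ 2 *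
        ∫ z : Plane, (2 * Real.pi)⁻¹ * (‖z‖⁻¹ * ((1 + ‖z‖) ^ 2)⁻¹) := by
  have hpi : 0 < (2 * Real.pi)⁻¹ := by have := Real.pi_pos; positivity
  have hb : Integrable (fun x : Plane => (1 + ‖y‖) ^ 2 *
      ((2 * Real.pi)⁻¹ * (‖x - y‖⁻¹ * ((1 + ‖x - y‖) ^ 2)⁻¹))) :=
    ((integrable_inv_norm_mul.const_mul _).comp_sub_right y).const_mul _
  have hle : ∀ x : Plane, ‖bsKernel (x - y)‖ * ((1 + ‖x‖) ^ 2)⁻¹ ≤ (1 + ‖y‖) ^ 2 *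
      ((2 * Real.pi)⁻¹ * (‖x - y‖⁻¹ * ((1 + ‖x - y‖) ^ 2)⁻¹)) := by
    intro x
    have h1 : 1 + ‖x - y‖ ≤ (1 + ‖y‖) * (1 + ‖x‖) := by
      have := norm_sub_le x y
      nlinarith [norm_nonneg x, norm_nonneg y]
    have h2 : ((1 + ‖x‖) ^ 2)⁻¹ ≤ (1 + ‖y‖) ^ 2 * ((1 + ‖x - y‖) ^ 2)⁻¹ := by
      rw [← div_eq_mul_inv, le_div_iff₀ (by positivity), inv_mul_le_iff₀ (by positivity),
        ← mul_pow, mul_comm (1 + ‖x‖)]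
      gcongr
    rw [norm_bsKernel]
    calc (2 * Real.pi)⁻¹ * ‖x - y‖⁻¹ * ((1 + ‖x‖) ^ 2)⁻¹
        ≤ (2 * Real.pi)⁻¹ * ‖x - y‖⁻¹ * ((1 + ‖y‖) ^ 2 * ((1 + ‖x - y‖) ^ 2)⁻¹) := by gcongr
      _ = _ := by ring
  have hint : Integrable (fun x => ‖bsKernel (x - y)‖ * ((1 + ‖x‖) ^ 2)⁻¹) := by
    refine hb.mono' ?_ (Eventually.of_forall fun x => ?_)
    · exact ((measurable_bsKernel.comp (measurable_id.sub_const y)).norm.mul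
        (by fun_prop)).aestronglyMeasurable
    · rw [Real.norm_of_nonneg (by positivity)]
      exact hle x
  refine ⟨hint, (integral_mono hint hb hle).trans (le_of_eq ?_)⟩
  rw [integral_const_mul, integral_sub_right_eq_self
    (fun z : Plane => (2 * Real.pi)⁻¹ * (‖z‖⁻¹ * ((1 + ‖z‖) ^ 2)⁻¹)) y]

lemma integrable_prod_bsKernel {μ : Measure Plane} [SFinite μ] {h : Plane → ℝ}
    (hm : AEStronglyMeasurable h μ) (hh : Integrable (fun y => (1 + ‖y‖) ^ 2 * h y) μ) :
    Integrable (fun p : Plane × Plane =>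
      h p.2 * (‖bsKernel (p.1 - p.2)‖ * ((1 + ‖p.1‖) ^ 2)⁻¹)) (volume.prod μ) := by
  have hmeas : AEStronglyMeasurable (fun p : Plane × Plane =>
      h p.2 * (‖bsKernel (p.1 - p.2)‖ * ((1 + ‖p.1‖) ^ 2)⁻¹)) (volume.prod μ) := by
    refine hm.comp_snd.mul (Measurable.aestronglyMeasurable ?_)
    exact (measurable_bsKernel.comp (measurable_fst.sub measurable_snd)).norm.mul (by fun_prop)
  set I := ∫ z : Plane, (2 * Real.pi)⁻¹ * (‖z‖⁻¹ * ((1 + ‖z‖) ^ 2)⁻¹) with hI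
  have key := integrable_bsKernel_weight
  rw [integrable_prod_iff' hmeas]
  refine ⟨Eventually.of_forall fun y => (key y).1.const_mul (h y), ?_⟩
  refine (hh.norm.mul_const I).mono' hmeas.norm.prod_swap.integral_prod_right'
    (Eventually.of_forall fun y => ?_)
  have h3 : ∀ x, ‖h y * (‖bsKernel (x - y)‖ * ((1 + ‖x‖) ^ 2)⁻¹)‖
      = |h y| * (‖bsKernel (x - y)‖ * ((1 + ‖x‖) ^ 2)⁻¹) := fun x => by
    rw [norm_mul, Real.norm_eq_abs, Real.norm_of_nonneg (by positivity)]
  simp only [h3]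
  rw [integral_const_mul, Real.norm_of_nonneg
    (mul_nonneg (abs_nonneg _) (integral_nonneg fun x => by positivity)), norm_mul,
    Real.norm_of_nonneg (by positivity), Real.norm_eq_abs]
  calc |h y| * _ ≤ |h y| * ((1 + ‖y‖) ^ 2 * I) := by
        gcongr; exact (key y).2
    _ = _ := by ring

/-- Fubini for `u(x) · K(x-y)`, with absolute convergence from `integrable_prod_bsKernel`. The
measure `μ` is kept general so that the lemma serves both smooth densities and the Jordan parts of
`ω₀`. -/
lemma integral_inner_bsKernel_swap {μ : Measure Plane} [SFinite μ] {h : Plane → ℝ}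
    (hm : AEStronglyMeasurable h μ) (hh : Integrable (fun y => (1 + ‖y‖) ^ 2 * h y) μ)
    {u : Plane → Plane} (hu : AEStronglyMeasurable u volume) {c : ℝ}
    (hc : ∀ x, ‖u x‖ ≤ c * ((1 + ‖x‖) ^ 2)⁻¹) :
    (∀ᵐ x, Integrable (fun y => h y • bsKernel (x - y)) μ) ∧
    Integrable (fun x => inner ℝ (u x) (∫ y, h y • bsKernel (x - y) ∂μ)) ∧
    ∫ x, inner ℝ (u x) (∫ y, h y • bsKernel (x - y) ∂μ)
      = ∫ y, h y * (∫ x, inner ℝ (u x) (bsKernel (x - y))) ∂μ := by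
  have hP := integrable_prod_bsKernel hm hh
  have h1 : ∀ᵐ x, Integrable (fun y => h y • bsKernel (x - y)) μ := by
    filter_upwards [hP.prod_right_ae] with x hx
    have hx2 := hx.mul_const ((1 + ‖x‖) ^ 2)
    refine hx2.mono (hm.smul (measurable_bsKernel.comp
      (measurable_const.sub measurable_id)).aestronglyMeasurable) (Eventually.of_forall fun y => ?_)
    rw [norm_smul, norm_mul, norm_mul, norm_mul, norm_norm, norm_inv,
      Real.norm_of_nonneg (by positivity : (0:ℝ) ≤ (1 + ‖x‖) ^ 2)]
    refine le_of_eq ?_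
    have : (1 + ‖x‖) ^ 2 ≠ 0 := by positivity
    field_simp
  have h2 : Integrable (fun p : Plane × Plane => h p.2 * inner ℝ (u p.1) (bsKernel (p.1 - p.2)))
      (volume.prod μ) := by
    refine (hP.norm.const_mul c).mono' ?_ (Eventually.of_forall fun p => ?_)
    · exact hm.comp_snd.mul (hu.comp_fst.inner
        (measurable_bsKernel.comp (measurable_fst.sub measurable_snd)).aestronglyMeasurable)
    · rw [norm_mul, norm_mul, Real.norm_of_nonneg (r := ‖bsKernel _‖ * _) (by positivity)]
      calc ‖h p.2‖ * ‖inner ℝ (u p.1) (bsKernel (p.1 - p.2))‖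
          ≤ ‖h p.2‖ * ((c * ((1 + ‖p.1‖) ^ 2)⁻¹) * ‖bsKernel (p.1 - p.2)‖) := by
            gcongr
            exact (norm_inner_le_norm _ _).trans (by gcongr; exact hc p.1)
        _ = _ := by ring
  have h3 : (fun x => inner ℝ (u x) (∫ y, h y • bsKernel (x - y) ∂μ)) =ᵐ[volume]
      fun x => ∫ y, h y * inner ℝ (u x) (bsKernel (x - y)) ∂μ := by
    filter_upwards [h1] with x hx
    rw [← innerSL_apply_apply ℝ, ← ContinuousLinearMap.integral_comp_comm _ hx]
    refine integral_congr_ae (Eventually.of_forall fun y => ?_)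
    simp
  refine ⟨h1, h2.integral_prod_left.congr h3.symm, ?_⟩
  rw [integral_congr_ae h3, integral_integral_swap h2]
  simp only [integral_const_mul]

/-! ### The energy identity for vorticities of zero mean. -/

section Energy

variable {ω : Plane → ℝ}

/-- Zero mean allows `K(x)` to be subtracted under the integral, and `|K(x-t) - K(x)| = O(|x|⁻²)`
for `t` in the support. This extra power of decay is what makes the velocity square integrable. -/
lemma exists_velocity_bound (hω : Continuous ω) (hc : HasCompactSupport ω)
    (hmean : ∫ x, ω x = 0) : ∃ c, ∀ x, ‖velocity ω x‖ ≤ c * ((1 + ‖x‖) ^ 2)⁻¹ := by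
  obtain ⟨R, hR1, hR⟩ := exists_radius hc
  have hωi := hω.integrable_of_hasCompactSupport (μ := volume) hc
  obtain ⟨B, hB⟩ := (isCompact_closedBall (0:Plane) (2 * R)).exists_bound_of_continuousOn
    (continuous_velocity hω hc).continuousOn
  set M := ∫ x, |ω x| with hM
  have hM0 : 0 ≤ M := integral_nonneg fun x => abs_nonneg _
  have hpi := Real.pi_pos
  have hB0 : 0 ≤ B := (norm_nonneg _).trans (hB 0 (by simp; linarith))
  refine ⟨B * (1 + 2 * R) ^ 2 + 8 * R * M, fun x => ?_⟩
  rw [← div_eq_mul_inv, le_div_iff₀ (by positivity)]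
  rcases le_total ‖x‖ (2 * R) with hx | hx
  · have h1 := hB x (by simpa using hx)
    calc ‖velocity ω x‖ * (1 + ‖x‖) ^ 2 ≤ B * (1 + 2 * R) ^ 2 := by gcongr
      _ ≤ _ := by nlinarith [mul_nonneg (by linarith : (0:ℝ) ≤ 8 * R) hM0]
  · have hx0 : 0 < ‖x‖ := by linarith
    have hxne : x ≠ 0 := norm_pos_iff.1 hx0
    have h1 : velocity ω x = ∫ t, ω t • (bsKernel (x - t) - bsKernel x) := by
      simp only [smul_sub]
      rw [integral_sub (integrable_smul_bsKernel hω hc x) (hωi.smul_const _),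
        integral_smul_const, hmean, zero_smul, sub_zero, velocity_apply]
    have h2 : ‖velocity ω x‖ ≤ ∫ t, |ω t| * ((2 * Real.pi)⁻¹ * (2 * R * (‖x‖ ^ 2)⁻¹)) := by
      rw [h1]
      refine norm_integral_le_of_norm_le (hωi.abs.mul_const _) (Eventually.of_forall fun t => ?_)
      rw [norm_smul, Real.norm_eq_abs]
      by_cases ht : ‖t‖ ≤ R
      · have h3 : ‖x‖ / 2 ≤ ‖x - t‖ := by have := norm_sub_norm_le x t; linarith
        have h4 : x - t ≠ 0 := norm_pos_iff.1 (by linarith)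
        rw [norm_bsKernel_sub h4 hxne, sub_sub_cancel_left, norm_neg]
        refine mul_le_mul_of_nonneg_left (mul_le_mul_of_nonneg_left ?_ (by positivity))
          (abs_nonneg _)
        calc ‖t‖ * (‖x - t‖⁻¹ * ‖x‖⁻¹) ≤ R * ((‖x‖ / 2)⁻¹ * ‖x‖⁻¹) := by gcongr
          _ = 2 * R * (‖x‖ ^ 2)⁻¹ := by field_simp
      · rw [hR t (not_le.1 ht)]; simp
    rw [integral_mul_const] at h2
    have h5 : (2 * Real.pi)⁻¹ ≤ 1 := by
      rw [inv_le_one_iff₀]; right; linarith [Real.pi_gt_three]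
    have h6 : (1 + ‖x‖) ^ 2 ≤ 4 * ‖x‖ ^ 2 := by nlinarith
    calc ‖velocity ω x‖ * (1 + ‖x‖) ^ 2
        ≤ (M * (1 * (2 * R * (‖x‖ ^ 2)⁻¹))) * (4 * ‖x‖ ^ 2) := by
          refine mul_le_mul (h2.trans ?_) h6 (by positivity) (by positivity)
          gcongr
      _ = 8 * R * M := by field_simp; ring
      _ ≤ _ := by nlinarith [mul_nonneg hB0 (sq_nonneg (1 + 2 * R))]

/-- Zero mean again: subtracting `G(x)` under the integral leaves differences of logarithms, of size
`O(|x|⁻¹)`. -/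
lemma tendsto_stream_along_ray (hω : Continuous ω) (hc : HasCompactSupport ω)
    (hmean : ∫ x, ω x = 0) (y : Plane) (θ : ℝ) :
    Tendsto (fun r : ℝ => stream ω (y + r • dir θ)) atTop (𝓝 0) := by
  obtain ⟨R, hR1, hR⟩ := exists_radius hc
  have hωi := hω.integrable_of_hasCompactSupport (μ := volume) hc
  set M := ∫ x, |ω x| with hM
  have hM0 : 0 ≤ M := integral_nonneg fun x => abs_nonneg _
  have hpi := Real.pi_pos
  have hbound : ∀ x : Plane, 2 * R ≤ ‖x‖ → |stream ω x| ≤ M * (2 * R * ‖x‖⁻¹) := by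
    intro x hx
    have hx0 : 0 < ‖x‖ := by linarith
    have h1 : stream ω x = ∫ t, ω t * (logKernel (x - t) - logKernel x) := by
      simp only [mul_sub]
      rw [integral_sub (integrable_mul_logKernel hω hc x) (hωi.mul_const _),
        integral_mul_const, hmean, zero_mul, sub_zero, stream_apply]
    rw [h1, ← Real.norm_eq_abs, hM, ← integral_mul_const]
    refine norm_integral_le_of_norm_le (hωi.abs.mul_const _) (Eventually.of_forall fun t => ?_)
    rw [norm_mul, Real.norm_eq_abs, Real.norm_eq_abs]
    by_cases ht : ‖t‖ ≤ R
    · refine mul_le_mul_of_nonneg_left ?_ (abs_nonneg _)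
      have ha := norm_sub_norm_le x t
      have hb := norm_sub_le x t
      have h3 : 0 < ‖x - t‖ := by linarith
      have h5 : |(2 * Real.pi)⁻¹| ≤ 1 := by
        rw [abs_of_pos (by positivity), inv_le_one_iff₀]; right; linarith [Real.pi_gt_three]
      have h6 : |Real.log ‖x - t‖ - Real.log ‖x‖| ≤ 2 * R * ‖x‖⁻¹ := by
        rw [← Real.log_div h3.ne' hx0.ne', ← div_eq_mul_inv, abs_le]
        have e1 := Real.log_le_sub_one_of_pos (div_pos h3 hx0)
        have e2 := Real.log_le_sub_one_of_pos (div_pos hx0 h3)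
        have e3 : Real.log (‖x‖ / ‖x - t‖) = -Real.log (‖x - t‖ / ‖x‖) := by
          rw [← Real.log_inv, inv_div]
        rw [e3] at e2
        have e4 : ‖x - t‖ / ‖x‖ - 1 ≤ 2 * R / ‖x‖ := by
          rw [div_sub_one hx0.ne']
          gcongr; linarith
        have e5 : ‖x‖ / ‖x - t‖ - 1 ≤ 2 * R / ‖x‖ := by
          rw [div_sub_one h3.ne', div_le_div_iff₀ h3 hx0]
          nlinarith
        constructor <;> linarith
      rw [logKernel, logKernel, ← mul_sub, abs_mul, abs_neg]
      calc |(2 * Real.pi)⁻¹| * |Real.log ‖x - t‖ - Real.log ‖x‖|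
          ≤ 1 * (2 * R * ‖x‖⁻¹) := by gcongr
        _ = _ := one_mul _
    · rw [hR t (not_le.1 ht)]; simp
  have hnorm : Tendsto (fun r : ℝ => ‖y + r • dir θ‖) atTop atTop := by
    refine tendsto_atTop_mono' _ ?_ (tendsto_atTop_add_const_right atTop (-‖y‖) tendsto_id)
    filter_upwards [eventually_ge_atTop 0] with r hr0
    have h1 : ‖r • dir θ‖ = r := by rw [norm_smul, norm_dir, mul_one, Real.norm_of_nonneg hr0]
    have h2 := norm_sub_le (y + r • dir θ) y
    rw [add_sub_cancel_left, h1] at h2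
    simp only [id]; linarith
  have hz : Tendsto (fun r : ℝ => M * (2 * R * ‖y + r • dir θ‖⁻¹)) atTop (𝓝 0) := by
    simpa using ((tendsto_inv_atTop_zero.comp hnorm).const_mul (2 * R)).const_mul M
  refine squeeze_zero_norm' ?_ hz
  filter_upwards [hnorm.eventually_ge_atTop (2 * R)] with r hr
  exact hbound _ hr

/-- Since `∇ψ = u^⊥`, the integrand is, up to a constant, the radial derivative of `ψ` about `y`
against `|x-y|⁻²`. As `ψ` vanishes along rays, `integral_radial_deriv` returns its value at `y`. -/
lemma integral_inner_velocity_bsKernel (hω : ContDiff ℝ 1 ω) (hc : HasCompactSupport ω)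
    (hmean : ∫ x, ω x = 0) (y : Plane) :
    ∫ x, inner ℝ (velocity ω x) (bsKernel (x - y)) = stream ω y := by
  obtain ⟨c, hb⟩ := exists_velocity_bound hω.continuous hc hmean
  have hpi := Real.pi_pos
  have h1 : ∀ x, inner ℝ (velocity ω x) (bsKernel (x - y))
      = -(2 * Real.pi)⁻¹ * ((‖x - y‖ ^ 2)⁻¹ *
        innerSL ℝ (perp (velocity ω (y + (x - y)))) (x - y)) := by
    intro x
    rw [add_sub_cancel, bsKernel_eq, inner_smul_right, inner_smul_right, innerSL_apply_apply,
      inner_perp_left]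
    ring
  have hK : Integrable (fun x => inner ℝ (velocity ω x) (bsKernel (x - y))) := by
    refine ((integrable_bsKernel_weight y).1.const_mul c).mono' ?_ (Eventually.of_forall fun x => ?_)
    · exact (continuous_velocity hω.continuous hc).aestronglyMeasurable.inner
        (measurable_bsKernel.comp (measurable_id.sub_const y)).aestronglyMeasurable
    · calc ‖inner ℝ (velocity ω x) (bsKernel (x - y))‖
          ≤ c * ((1 + ‖x‖) ^ 2)⁻¹ * ‖bsKernel (x - y)‖ :=
            (norm_inner_le_norm _ _).trans (by gcongr; exact hb x)
        _ = _ := by ring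
  have hd : ∀ z, HasFDerivAt (fun z => stream ω (y + z))
      (innerSL ℝ (perp (velocity ω (y + z)))) z := fun z => by
    simpa using! (hasFDerivAt_stream hω hc (y + z)).comp z ((hasFDerivAt_id z).const_add y)
  simp only [h1] at hK ⊢
  rw [integral_const_mul, integral_sub_right_eq_self (fun z => (‖z‖ ^ 2)⁻¹ *
        innerSL ℝ (perp (velocity ω (y + z))) z) y, integral_radial_deriv hd, add_zero]
  · field_simp
  · have h2 := (hK.const_mul (-(2 * Real.pi))).comp_add_right y
    refine h2.congr (Eventually.of_forall fun z => ?_)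
    simp only [add_sub_cancel_right]
    field_simp
  · exact tendsto_stream_along_ray hω.continuous hc hmean y

/-- The kinetic energy in terms of the stream function. -/
lemma integral_norm_velocity_sq (hω : ContDiff ℝ 1 ω) (hc : HasCompactSupport ω)
    (hmean : ∫ x, ω x = 0) :
    Integrable (fun x => ‖velocity ω x‖ ^ 2) ∧
    ∫ x, ‖velocity ω x‖ ^ 2 = ∫ y, ω y * stream ω y := by
  obtain ⟨c, hb⟩ := exists_velocity_bound hω.continuous hc hmean
  obtain ⟨-, h2, h3⟩ := integral_inner_bsKernel_swap (μ := volume)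
    hω.continuous.aestronglyMeasurable
    (((by fun_prop : Continuous fun y : Plane => (1 + ‖y‖) ^ 2).mul
      hω.continuous).integrable_of_hasCompactSupport hc.mul_left)
    (continuous_velocity hω.continuous hc).aestronglyMeasurable hb
  simp only [← velocity_apply, real_inner_self_eq_norm_sq,
    integral_inner_velocity_bsKernel hω hc hmean] at h2 h3
  exact ⟨h2, h3⟩

end Energy

/-! ### Densities with decaying maximal function -/

/-- `C¹` vorticities of zero mean supported in the disc of radius `R`, of mass at most `M` and with
a vorticity maximal function bounded by `C r^α`. -/
structure IsVortexDensity (ω : Plane → ℝ) (C α R M : ℝ) : Prop where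
  contDiff : ContDiff ℝ 1 ω
  eq_zero : ∀ x, R ≤ ‖x‖ → ω x = 0
  mean : ∫ x, ω x = 0
  mass : ∫ x, |ω x| ≤ M
  decay : HasDecay ω C α

section Density

variable {ω ω' η : Plane → ℝ} {C α R M r : ℝ}

lemma IsVortexDensity.compactSupport (h : IsVortexDensity ω C α R M) : HasCompactSupport ω := by
  refine HasCompactSupport.intro (isCompact_closedBall (0 : Plane) R) fun x hx => h.eq_zero x ?_
  simp only [Metric.mem_closedBall, dist_zero_right, not_le] at hx
  exact hx.le

lemma IsVortexDensity.continuous (h : IsVortexDensity ω C α R M) : Continuous ω :=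
  h.contDiff.continuous

lemma IsVortexDensity.integrable (h : IsVortexDensity ω C α R M) : Integrable ω :=
  h.continuous.integrable_of_hasCompactSupport h.compactSupport

lemma IsVortexDensity.mass_nonneg (h : IsVortexDensity ω C α R M) : 0 ≤ M :=
  (integral_nonneg fun _ => abs_nonneg _).trans h.mass

/-- The class is stable under differences with doubled constants, so the energy identity can measure
the distance between two velocities. -/
lemma IsVortexDensity.sub (h : IsVortexDensity ω C α R M) (h' : IsVortexDensity ω' C α R M)
    (hC : 0 ≤ C) : IsVortexDensity (fun x => ω x - ω' x) (2 * C) α R (2 * M) where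
  contDiff := h.contDiff.sub h'.contDiff
  eq_zero x hx := by rw [h.eq_zero x hx, h'.eq_zero x hx, sub_zero]
  mean := by rw [integral_sub h.integrable h'.integrable, h.mean, h'.mean, sub_zero]
  mass := by
    have h1 : ∫ x, |ω x - ω' x| ≤ ∫ x, (|ω x| + |ω' x|) :=
      integral_mono (h.integrable.sub h'.integrable).abs
        (h.integrable.abs.add h'.integrable.abs) fun x => abs_sub _ _
    rw [integral_add h.integrable.abs h'.integrable.abs] at h1
    linarith [h.mass, h'.mass]
  decay x r hr := by
    have h1 : ∫⁻ y in Metric.closedBall x r, ‖ω y - ω' y‖ₑ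
        ≤ ∫⁻ y in Metric.closedBall x r, (‖ω y‖ₑ + ‖ω' y‖ₑ) :=
      lintegral_mono fun y => enorm_sub_le
    rw [lintegral_add_left h.continuous.measurable.enorm] at h1
    refine h1.trans ((add_le_add (h.decay x r hr) (h'.decay x r hr)).trans (le_of_eq ?_))
    rw [← ENNReal.ofReal_add (by positivity) (by positivity)]
    congr 1; ring

lemma velocity_sub (hω : Continuous ω) (hc : HasCompactSupport ω) (hω' : Continuous ω')
    (hc' : HasCompactSupport ω') (x : Plane) :
    velocity (fun x => ω x - ω' x) x = velocity ω x - velocity ω' x := by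
  simp only [velocity_apply, sub_smul]
  exact integral_sub (integrable_smul_bsKernel hω hc x) (integrable_smul_bsKernel hω' hc' x)

lemma stream_sub (hω : Continuous ω) (hc : HasCompactSupport ω) (hω' : Continuous ω')
    (hc' : HasCompactSupport ω') (x : Plane) :
    stream (fun x => ω x - ω' x) x = stream ω x - stream ω' x := by
  simp only [stream_apply, sub_mul]
  exact integral_sub (integrable_mul_logKernel hω hc x) (integrable_mul_logKernel hω' hc' x)

lemma velocity_translate (ω : Plane → ℝ) (h x : Plane) :
    velocity (fun x => ω (x + h)) x = velocity ω (x + h) := by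
  rw [velocity_apply, velocity_apply,
    ← integral_add_right_eq_self (fun t => ω t • bsKernel (x + h - t)) h]
  simp only [add_sub_add_right_eq_sub]

lemma stream_translate (ω : Plane → ℝ) (h x : Plane) :
    stream (fun x => ω (x + h)) x = stream ω (x + h) := by
  rw [stream_apply, stream_apply,
    ← integral_add_right_eq_self (fun t => ω t * logKernel (x + h - t)) h]
  simp only [add_sub_add_right_eq_sub]

/-! ### Smoothing of stream functions -/

lemma IsRadialDensity.integrable (hη : IsRadialDensity η r) : Integrable η := by
  simpa using hη.integrable_smul (E := ℝ) (g := fun _ : Plane => (1:ℝ)) (locallyIntegrable_const 1)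

/-- Associativity of convolution, `η * (G * ω) = (η * G) * ω`: the average of `ψ` is obtained by
averaging the kernel, to which Newton's theorem applies. -/
lemma IsRadialDensity.integral_stream (hη : IsRadialDensity η r) (hω : Continuous ω)
    (hc : HasCompactSupport ω) (x : Plane) :
    Integrable (fun t => ω t * stream η (x - t)) ∧
    ∫ y, η y * stream ω (x - y) = ∫ t, ω t * stream η (x - t) := by
  have hm : Measurable (fun p : Plane × Plane => η p.1 * (ω p.2 * logKernel (x - p.1 - p.2))) := by
    have h1 := hη.measurable
    have h2 := measurable_logKernel
    have h3 := hω.measurable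
    fun_prop
  have hp : Integrable (fun p : Plane × Plane => η p.1 * (ω p.2 * logKernel (x - p.1 - p.2)))
      (volume.prod volume) := by
    rw [integrable_prod_iff hm.aestronglyMeasurable]
    refine ⟨Eventually.of_forall fun y =>
      (integrable_mul_logKernel hω hc (x - y)).const_mul (η y), ?_⟩
    have hlog : LocallyIntegrable fun z => |logKernel z| :=
      locallyIntegrable_logKernel.mono measurable_logKernel.abs.aestronglyMeasurable
        (Eventually.of_forall fun z => by simp)
    have h1 : Continuous (convolution (fun t => |ω t|) (fun z => |logKernel z|)
        (ContinuousLinearMap.lsmul ℝ ℝ) volume) :=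
      hc.abs.continuous_convolution_left _ hω.abs hlog
    have h2 : Continuous fun y => convolution (fun t => |ω t|) (fun z => |logKernel z|)
        (ContinuousLinearMap.lsmul ℝ ℝ) volume (x - y) := h1.comp (by fun_prop)
    refine (hη.integrable_smul (E := ℝ) h2.locallyIntegrable).congr
      (Eventually.of_forall fun y => ?_)
    simp only [norm_mul, Real.norm_eq_abs, convolution_def, smul_eq_mul,
      ContinuousLinearMap.lsmul_apply, abs_of_nonneg (hη.nonneg y)]
    rw [integral_const_mul]
  have hi : ∀ t, ∫ y, η y * (ω t * logKernel (x - y - t)) = ω t * stream η (x - t) := fun t => by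
    rw [stream_apply, ← integral_const_mul]
    refine integral_congr_ae (Eventually.of_forall fun y => ?_)
    simp only
    rw [show x - y - t = x - t - y by abel]; ring
  refine ⟨hp.integral_prod_right.congr (Eventually.of_forall hi), ?_⟩
  simp only [← hi, stream_apply ω]
  simp only [← integral_const_mul]
  rw [integral_integral_swap hp]

/-- The central estimate. By Newton's theorem the averaged kernel differs from `G` by at most
`(2π)⁻¹ log⁺(r/|x-t|)`, and the integral of this against `|ω|` is bounded through the decay of the
vorticity. Neither mass nor support enters the bound. -/
lemma abs_stream_sub_le (hω : Continuous ω) (hc : HasCompactSupport ω) (hd : HasDecay ω C α)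
    (hη : IsRadialDensity η r) (hC : 0 ≤ C) (hα : 0 < α) (hr : 0 < r) (x : Plane) :
    |stream ω x - ∫ y, η y * stream ω (x - y)| ≤ (2 * Real.pi)⁻¹ * (C * r ^ α / α) := by
  have hpi := Real.pi_pos
  obtain ⟨h2, h1⟩ := hη.integral_stream hω hc x
  rw [h1, stream_apply, ← integral_sub (integrable_mul_logKernel hω hc x) h2,
    ← ENNReal.ofReal_le_ofReal_iff (by positivity), ← Real.enorm_eq_ofReal_abs]
  refine (enorm_integral_le_lintegral_enorm _).trans ?_
  have h0 : ∀ᵐ t : Plane, t ≠ x := by simp [ae_iff]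
  have h3 : ∀ᵐ t : Plane, ‖ω t * logKernel (x - t) - ω t * stream η (x - t)‖ₑ
      ≤ ENNReal.ofReal (2 * Real.pi)⁻¹ *
        (ENNReal.ofReal (Real.posLog (r * ‖x - t‖⁻¹)) * ‖ω t‖ₑ) := by
    filter_upwards [h0] with t ht
    obtain ⟨ha, hb⟩ := hη.logKernel_sub (z := x - t) (sub_ne_zero.2 ht.symm)
    rw [← mul_sub, enorm_mul, mul_comm, ← mul_assoc, ← ENNReal.ofReal_mul (by positivity)]
    gcongr
    have e : ‖logKernel (x - t) - stream η (x - t)‖ₑ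
        = ENNReal.ofReal (logKernel (x - t) - stream η (x - t)) := Real.enorm_of_nonneg ha
    rw [e]
    exact ENNReal.ofReal_le_ofReal hb
  refine (lintegral_mono_ae h3).trans ?_
  rw [lintegral_const_mul' _ _ ENNReal.ofReal_ne_top, ENNReal.ofReal_mul (by positivity)]
  gcongr
  exact hd.lintegral_posLog hω.measurable hC hα hr x

/-- In `∫ |u|² = ∫ ω ψ` only values of `ψ` on the disc of radius `R` matter, and there `ψ` is its
average, bounded by `S`, plus `O(r^α)`. Applied to differences of vorticities this turns uniform
convergence of mollified stream functions into `L²` convergence of velocities. -/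
lemma IsVortexDensity.energy_le (h : IsVortexDensity ω C α R M) (hη : IsRadialDensity η r)
    (hC : 0 ≤ C) (hα : 0 < α) (hr : 0 < r) {S : ℝ} (hS0 : 0 ≤ S)
    (hS : ∀ x, ‖x‖ ≤ R → |∫ t, ω t * stream η (x - t)| ≤ S) :
    ∫ x, ‖velocity ω x‖ ^ 2 ≤ M * ((2 * Real.pi)⁻¹ * (C * r ^ α / α) + S) := by
  have hpi := Real.pi_pos
  rw [(integral_norm_velocity_sq h.contDiff h.compactSupport h.mean).2]
  set B := (2 * Real.pi)⁻¹ * (C * r ^ α / α) + S with hB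
  have hb : ∀ x, ‖x‖ ≤ R → |stream ω x| ≤ B := fun x hx => by
    have h1 := abs_stream_sub_le h.continuous h.compactSupport h.decay hη hC hα hr x
    have h2 := hS x hx
    rw [← (hη.integral_stream h.continuous h.compactSupport x).2] at h2
    have h3 := abs_sub_abs_le_abs_sub (stream ω x) (∫ y, η y * stream ω (x - y))
    linarith
  have h4 : ‖∫ y, ω y * stream ω y‖ ≤ ∫ y, |ω y| * B := by
    refine norm_integral_le_of_norm_le (h.integrable.abs.mul_const _)
      (Eventually.of_forall fun y => ?_)
    rw [norm_mul, Real.norm_eq_abs, Real.norm_eq_abs]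
    rcases le_total ‖y‖ R with hy | hy
    · exact mul_le_mul_of_nonneg_left (hb y hy) (abs_nonneg _)
    · rw [h.eq_zero y hy]; simp
  rw [integral_mul_const] at h4
  have hB0 : 0 ≤ B := by positivity
  exact (le_abs_self _).trans (h4.trans (mul_le_mul_of_nonneg_right h.mass hB0))

/-! ### The structure function -/

/-- The uniform density on the disc of radius `r`. -/
def discDensity (r : ℝ) : Plane → ℝ :=
  (Metric.ball (0 : Plane) r).indicator fun _ => (volume.real (Metric.ball (0 : Plane) r))⁻¹

lemma volume_real_ball_pos (hr : 0 < r) : 0 < volume.real (Metric.ball (0 : Plane) r) :=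
  ENNReal.toReal_pos (Metric.measure_ball_pos volume _ hr).ne' measure_ball_lt_top.ne

lemma isRadialDensity_discDensity (hr : 0 < r) : IsRadialDensity (discDensity r) r where
  measurable := measurable_const.indicator measurableSet_ball
  radial := ⟨fun s => if s < r then (volume.real (Metric.ball (0 : Plane) r))⁻¹ else 0, fun x => by
    by_cases hx : ‖x‖ < r <;> simp [discDensity, indicator, hx]⟩
  nonneg x := indicator_nonneg (fun _ _ => by positivity) _
  bounded := ⟨(volume.real (Metric.ball (0 : Plane) r))⁻¹, fun x =>
    indicator_le_self' (fun _ _ => by positivity) x⟩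
  integral_eq_one := by
    rw [discDensity, integral_indicator measurableSet_ball, setIntegral_const, smul_eq_mul,
      mul_inv_cancel₀ (volume_real_ball_pos hr).ne']
  eq_zero x hx := indicator_of_notMem (by simpa using hx.le) _

lemma IsVortexDensity.translate (h : IsVortexDensity ω C α R M) (v : Plane) :
    ContDiff ℝ 1 (fun x => ω (x + v)) ∧ HasCompactSupport (fun x => ω (x + v)) ∧
      Integrable (fun x => ω (x + v)) ∧ ∫ x, ω (x + v) = 0 :=
  ⟨h.contDiff.comp (contDiff_id.add contDiff_const),
    h.compactSupport.comp_homeomorph (Homeomorph.addRight v), h.integrable.comp_add_right v, by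
    rw [integral_add_right_eq_self, h.mean]⟩

/-- The energy identity for `ω(·+v) - ω`, whose mean is zero; translating the terms that contain
`ω(x+v)` produces the second difference of `ψ`. -/
lemma IsVortexDensity.integral_increment (h : IsVortexDensity ω C α R M) (v : Plane) :
    Integrable (fun x => ‖velocity ω (x + v) - velocity ω x‖ ^ 2) ∧
    ∫ x, ‖velocity ω (x + v) - velocity ω x‖ ^ 2
      = ∫ x, ω x * (2 * stream ω x - stream ω (x - v) - stream ω (x + v)) := by
  obtain ⟨h1, h2, h3, h4⟩ := h.translate v
  have hc := h.compactSupport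
  have hs := continuous_stream h.continuous hc
  have key := integral_norm_velocity_sq (h1.sub h.contDiff)
    (h2.sub hc) (by rw [integral_sub h3 h.integrable, h4, h.mean, sub_zero])
  simp only [velocity_sub h1.continuous h2 h.continuous hc, velocity_translate,
    stream_sub h1.continuous h2 h.continuous hc, stream_translate] at key
  refine ⟨key.1, key.2.trans ?_⟩
  have i1 : ∀ g : Plane → ℝ, Continuous g → Integrable fun x => ω x * g x := fun g hg =>
    (h.continuous.mul hg).integrable_of_hasCompactSupport hc.mul_right
  have i2 : ∀ g : Plane → ℝ, Continuous g → Integrable fun x => ω (x + v) * g x := fun g hg =>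
    (h1.continuous.mul hg).integrable_of_hasCompactSupport h2.mul_right
  have e1 : ∀ x, (ω (x + v) - ω x) * (stream ω (x + v) - stream ω x)
      = ω (x + v) * (stream ω (x + v) - stream ω x)
        - ω x * (stream ω (x + v) - stream ω x) := fun x => by ring
  have e2 : ∫ x, ω (x + v) * (stream ω (x + v) - stream ω x)
      = ∫ x, ω x * (stream ω x - stream ω (x - v)) := by
    rw [← integral_add_right_eq_self (fun x => ω x * (stream ω x - stream ω (x - v))) v]
    simp only [add_sub_cancel_right]
  simp only [e1]
  rw [integral_sub (i2 _ (by fun_prop)) (i1 _ (by fun_prop)), e2,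
    ← integral_sub (i1 _ (by fun_prop)) (i1 _ (by fun_prop))]
  refine integral_congr_ae (Eventually.of_forall fun x => ?_)
  simp only; ring

/-- Since `η` is even, averaging the second difference of `ψ` over `v` gives twice `ψ` minus its
average, to which `abs_stream_sub_le` applies. -/
lemma IsVortexDensity.integral_average_increment (h : IsVortexDensity ω C α R M)
    (hη : IsRadialDensity η r) (hC : 0 ≤ C) (hα : 0 < α) (hr : 0 < r) :
    Integrable (fun v => η v * ∫ x, ‖velocity ω (x + v) - velocity ω x‖ ^ 2) ∧
    ∫ v, η v * ∫ x, ‖velocity ω (x + v) - velocity ω x‖ ^ 2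
      ≤ 2 * M * ((2 * Real.pi)⁻¹ * (C * r ^ α / α)) := by
  have hpi := Real.pi_pos
  have hc := h.compactSupport
  have hs := continuous_stream h.continuous hc
  set F : Plane → Plane → ℝ := fun v x =>
    η v * (ω x * (2 * stream ω x - stream ω (x - v) - stream ω (x + v))) with hF
  have hFe : ∀ v, η v * ∫ x, ‖velocity ω (x + v) - velocity ω x‖ ^ 2 = ∫ x, F v x := fun v => by
    rw [(h.integral_increment v).2, hF]
    simp only [integral_const_mul]
  have hprod : Integrable (Function.uncurry F) (volume.prod volume) := by
    obtain ⟨B, hB⟩ := (isCompact_closedBall (0 : Plane) (R + r)).exists_bound_of_continuousOn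
      hs.continuousOn
    refine ((hη.integrable.norm.mul_prod h.integrable.norm).mul_const (4 * B)).mono'
      (Measurable.aestronglyMeasurable ?_) (Eventually.of_forall fun p => ?_)
    · have h1 := hη.measurable
      have h2 := h.continuous.measurable
      have h3 := hs.measurable
      rw [hF]
      unfold Function.uncurry
      fun_prop
    · obtain ⟨v, x⟩ := p
      simp only [Function.uncurry, hF]
      rw [norm_mul, norm_mul, ← mul_assoc]
      by_cases hv : ‖v‖ ≤ r
      · rcases le_total ‖x‖ R with hx | hx
        · refine mul_le_mul_of_nonneg_left ?_ (by positivity)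
          have hr0 := (norm_nonneg v).trans hv
          have b1 := hB x (by simp; linarith)
          have b2 := hB (x - v) (by simp; linarith [norm_sub_le x v])
          have b3 := hB (x + v) (by simp; linarith [norm_add_le x v])
          have c1 := norm_sub_le (2 * stream ω x - stream ω (x - v)) (stream ω (x + v))
          have c2 := norm_sub_le (2 * stream ω x) (stream ω (x - v))
          rw [norm_mul, Real.norm_ofNat] at c2
          linarith
        · rw [h.eq_zero x hx]; simp
      · rw [hη.eq_zero v (not_le.1 hv)]; simp
  have hsm : ∀ x, ∫ v, F v x
      = ω x * (2 * (stream ω x - ∫ v, η v * stream ω (x - v))) := by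
    intro x
    have i1 : Integrable fun v => η v * stream ω (x - v) :=
      hη.integrable_smul (E := ℝ) (hs.comp (by fun_prop)).locallyIntegrable
    have i2 : Integrable fun v => η v * stream ω (x + v) :=
      hη.integrable_smul (E := ℝ) (hs.comp (by fun_prop)).locallyIntegrable
    have e1 : ∫ v, η v * stream ω (x + v) = ∫ v, η v * stream ω (x - v) := by
      rw [← integral_neg_eq_self]
      simp only [hη.neg, sub_eq_add_neg]
    have e2 : ∀ v, F v x = ω x * (η v * (2 * stream ω x) - η v * stream ω (x - v)
      - η v * stream ω (x + v)) := fun v => by simp only [hF]; ring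
    simp only [e2]
    have i0 : Integrable fun v => η v * (2 * stream ω x) := hη.integrable.mul_const _
    have i3 : Integrable fun v => η v * (2 * stream ω x) - η v * stream ω (x - v) := i0.sub i1
    rw [integral_const_mul, integral_sub i3 i2, integral_sub i0 i1, integral_mul_const, hη.integral_eq_one, e1]
    ring
  simp only [hFe]
  refine ⟨hprod.integral_prod_left, ?_⟩
  rw [integral_integral_swap hprod]
  simp only [hsm]
  set B := (2 * Real.pi)⁻¹ * (C * r ^ α / α) with hB
  have h4 : ‖∫ x, ω x * (2 * (stream ω x - ∫ v, η v * stream ω (x - v)))‖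
      ≤ ∫ x, |ω x| * (2 * B) := by
    refine norm_integral_le_of_norm_le (h.integrable.abs.mul_const _)
      (Eventually.of_forall fun y => ?_)
    rw [norm_mul, norm_mul, Real.norm_ofNat, Real.norm_eq_abs, Real.norm_eq_abs]
    gcongr
    exact abs_stream_sub_le h.continuous hc h.decay hη hC hα hr y
  rw [integral_mul_const] at h4
  have hB0 : 0 ≤ 2 * B := by positivity
  calc _ ≤ _ := le_abs_self _
    _ ≤ _ := h4
    _ ≤ M * (2 * B) := mul_le_mul_of_nonneg_right h.mass hB0
    _ = _ := by ring

lemma lintegral_enorm_sq_eq {v : Plane → Plane} (hv : Integrable fun x => ‖v x‖ ^ 2) :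
    ∫⁻ x, ‖v x‖ₑ ^ 2 = ENNReal.ofReal (∫ x, ‖v x‖ ^ 2) := by
  rw [ofReal_integral_eq_lintegral_ofReal hv (Eventually.of_forall fun x => by positivity)]
  refine lintegral_congr fun x => ?_
  rw [← ofReal_norm, ENNReal.ofReal_pow (norm_nonneg _)]

lemma IsVortexDensity.structureFunction_le (h : IsVortexDensity ω C α R M)
    (hC : 0 ≤ C) (hα : 0 < α) (hr : 0 < r) :
    structureFunction (velocity ω) r
      ≤ ENNReal.ofReal (Real.sqrt (2 * M * ((2 * Real.pi)⁻¹ * (C / α))) * r ^ (α / 2)) := by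
  have hpi := Real.pi_pos
  have hM := h.mass_nonneg
  obtain ⟨hi, hle⟩ := h.integral_average_increment (isRadialDensity_discDensity hr) hC hα hr
  set V := volume.real (Metric.ball (0 : Plane) r) with hV
  have hV0 : 0 < V := volume_real_ball_pos hr
  have h1 : (⨍⁻ v in Metric.ball (0 : Plane) r,
        (∫⁻ x, ‖velocity ω (x + v) - velocity ω x‖ₑ ^ 2) ∂volume)
      = ENNReal.ofReal (∫ v, discDensity r v * ∫ x, ‖velocity ω (x + v) - velocity ω x‖ ^ 2) := by
    rw [ofReal_integral_eq_lintegral_ofReal hi (Eventually.of_forall fun v =>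
      mul_nonneg ((isRadialDensity_discDensity hr).nonneg v)
        (integral_nonneg fun x => by positivity)), setLAverage_eq,
      ENNReal.div_eq_inv_mul, ← lintegral_const_mul'' _ ?_]
    · rw [← lintegral_indicator measurableSet_ball]
      refine lintegral_congr fun v => ?_
      by_cases hv : v ∈ Metric.ball (0 : Plane) r
      · rw [indicator_of_mem hv, discDensity, indicator_of_mem hv,
          lintegral_enorm_sq_eq (h.integral_increment v).1, ENNReal.ofReal_mul (by positivity),
          ← hV, ENNReal.ofReal_inv_of_pos hV0, hV, ofReal_measureReal]
      · rw [indicator_of_notMem hv, discDensity, indicator_of_notMem hv]; simp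
    · have hcv := continuous_velocity h.continuous h.compactSupport
      refine (Measurable.lintegral_prod_right' (f := fun p : Plane × Plane =>
        ‖velocity ω (p.2 + p.1) - velocity ω p.2‖ₑ ^ 2) ?_).aemeasurable
      have := hcv.measurable
      fun_prop
  rw [structureFunction, h1, ENNReal.ofReal_rpow_of_nonneg (integral_nonneg fun v =>
    mul_nonneg ((isRadialDensity_discDensity hr).nonneg v)
        (integral_nonneg fun x => by positivity)) (by norm_num)]
  refine ENNReal.ofReal_le_ofReal ?_
  rw [← Real.sqrt_eq_rpow]
  -- The square root halves the exponent: the mean squared increment is `O(r^α)`.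
  refine (Real.sqrt_le_sqrt hle).trans (le_of_eq ?_)
  rw [show 2 * M * ((2 * Real.pi)⁻¹ * (C * r ^ α / α))
    = 2 * M * ((2 * Real.pi)⁻¹ * (C / α)) * r ^ α by ring, Real.sqrt_mul (by positivity),
    Real.sqrt_eq_rpow (r ^ α), ← Real.rpow_mul hr.le, mul_one_div]

end Density

/-! ### Blob functions -/

section Blob

variable {φ : Plane → ℝ} {ε δ : ℝ}

lemma IsBlob.continuous (hφ : IsBlob φ) : Continuous φ := hφ.contDiff.continuous

lemma IsBlob.integrable (hφ : IsBlob φ) : Integrable φ := by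
  by_contra h
  have := hφ.integral_eq_one
  rw [integral_undef h] at this
  exact zero_ne_one this

lemma IsBlob.eq_zero (hφ : IsBlob φ) {x : Plane} (hx : 1 ≤ ‖x‖) : φ x = 0 := by
  have h1 : ∫ x in (Metric.ball (0 : Plane) 1)ᶜ, φ x = 0 := by
    have := integral_add_compl (μ := volume) (measurableSet_ball (x := (0 : Plane)) (ε := 1))
      hφ.integrable
    rw [hφ.integral_ball_eq_one, hφ.integral_eq_one] at this
    linarith
  have h2 : φ =ᵐ[volume.restrict (Metric.ball (0 : Plane) 1)ᶜ] 0 :=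
    (setIntegral_eq_zero_iff_of_nonneg_ae (Eventually.of_forall hφ.nonneg)
      hφ.integrable.integrableOn).1 h1
  have h3 : φ =ᵐ[volume.restrict (Metric.closedBall (0 : Plane) 1)ᶜ] 0 :=
    ae_restrict_of_ae_restrict_of_subset (compl_subset_compl.2 Metric.ball_subset_closedBall) h2
  have h4 := Measure.eqOn_open_of_ae_eq h3 Metric.isClosed_closedBall.isOpen_compl
    hφ.continuous.continuousOn continuousOn_const
  -- Passing to the closure of `{‖x‖ > 1}` includes the unit circle itself.
  have h5 := h4.closure hφ.continuous continuous_const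
  rw [closure_compl, interior_closedBall _ one_ne_zero] at h5
  exact h5 (by simpa using hx)

lemma scaledBlob_one : scaledBlob φ 1 = φ := by
  ext x; simp [scaledBlob]

lemma IsBlob.contDiff_scaledBlob (hφ : IsBlob φ) (ε : ℝ) : ContDiff ℝ 2 (scaledBlob φ ε) :=
  contDiff_const.mul (hφ.contDiff.comp (contDiff_const_smul _))

lemma IsBlob.isRadialDensity (hφ : IsBlob φ) (hε : 0 < ε) :
    IsRadialDensity (scaledBlob φ ε) ε where
  measurable := (hφ.contDiff_scaledBlob ε).continuous.measurable
  radial := by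
    obtain ⟨f, hf⟩ := hφ.radial
    refine ⟨fun s => (ε ^ 2)⁻¹ * f (ε⁻¹ * s), fun x => ?_⟩
    rw [scaledBlob, hf, norm_smul, Real.norm_of_nonneg (inv_nonneg.2 hε.le)]
  nonneg x := mul_nonneg (by positivity) (hφ.nonneg _)
  bounded := by
    obtain ⟨B, hB⟩ := (isCompact_closedBall (0:Plane) 1).exists_bound_of_continuousOn
      hφ.continuous.continuousOn
    refine ⟨(ε ^ 2)⁻¹ * B, fun x => mul_le_mul_of_nonneg_left ?_ (by positivity)⟩
    rcases le_total ‖ε⁻¹ • x‖ 1 with h | h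
    · exact (le_abs_self _).trans (hB _ (by simpa using h))
    · rw [hφ.eq_zero h]
      exact (norm_nonneg _).trans (hB 0 (by simp))
  integral_eq_one := by
    simp only [scaledBlob]
    rw [integral_const_mul, Measure.integral_comp_smul, finrank_plane, hφ.integral_eq_one,
      inv_pow, inv_inv, abs_of_pos (by positivity), smul_eq_mul, mul_one,
      inv_mul_cancel₀ (by positivity)]
  eq_zero x hx := by
    rw [scaledBlob, hφ.eq_zero, mul_zero]
    rw [norm_smul, Real.norm_of_nonneg (inv_nonneg.2 hε.le), ← div_eq_inv_mul, le_div_iff₀ hε]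
    linarith

lemma IsRadialDensity.hasCompactSupport {η : Plane → ℝ} {r : ℝ} (h : IsRadialDensity η r) :
    HasCompactSupport η := by
  refine HasCompactSupport.intro (isCompact_closedBall (0 : Plane) r) fun x hx => h.eq_zero x ?_
  simpa using hx

lemma IsBlob.hasCompactSupport_scaledBlob (hφ : IsBlob φ) (hε : 0 < ε) :
    HasCompactSupport (scaledBlob φ ε) := (hφ.isRadialDensity hε).hasCompactSupport

lemma IsBlob.hasCompactSupport (hφ : IsBlob φ) : HasCompactSupport φ := by
  simpa [scaledBlob_one] using hφ.hasCompactSupport_scaledBlob one_pos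

/-! ### The regularized kernel -/

lemma regKernel_eq_velocity (φ : Plane → ℝ) (ε : ℝ) :
    regKernel φ ε = velocity (scaledBlob φ ε) := rfl

lemma bsKernel_smul {c : ℝ} (hc : c ≠ 0) (x : Plane) : bsKernel (c • x) = c⁻¹ • bsKernel x := by
  rw [bsKernel_eq, bsKernel_eq, perp_smul, norm_smul, mul_pow, Real.norm_eq_abs, sq_abs,
    smul_comm c⁻¹, smul_smul _ c, smul_smul c⁻¹]
  congr 2
  rw [mul_inv]
  field_simp

lemma regKernel_scaling (φ : Plane → ℝ) (hε : 0 < ε) (x : Plane) :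
    regKernel φ ε x = ε⁻¹ • velocity φ (ε⁻¹ • x) := by
  have h := Measure.integral_comp_smul (volume : Measure Plane)
    (fun s => φ s • bsKernel (x - ε • s)) ε⁻¹
  rw [finrank_plane, inv_pow, inv_inv, abs_of_pos (by positivity)] at h
  rw [regKernel_eq_velocity, velocity_apply, velocity_apply]
  simp only [scaledBlob, mul_smul]
  simp only [smul_inv_smul₀ hε.ne'] at h
  rw [integral_smul, h, smul_smul, inv_mul_cancel₀ (by positivity), one_smul, ← integral_smul]
  refine integral_congr_ae (Eventually.of_forall fun s => ?_)
  simp only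
  rw [show x - ε • s = ε • (ε⁻¹ • x - s) by rw [smul_sub, smul_inv_smul₀ hε.ne'],
    bsKernel_smul hε.ne', smul_comm]

lemma IsRadialDensity.velocity_neg {η : Plane → ℝ} {r : ℝ} (h : IsRadialDensity η r) (x : Plane) :
    velocity η (-x) = -velocity η x := by
  rw [velocity_apply, velocity_apply, ← integral_neg, ← integral_neg_eq_self]
  refine integral_congr_ae (Eventually.of_forall fun t => ?_)
  simp only
  rw [h.neg, show -x - -t = -(x - t) by abel, bsKernel_neg, smul_neg]

lemma IsBlob.regKernel_neg (hφ : IsBlob φ) (hε : 0 < ε) (x : Plane) :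
    regKernel φ ε (-x) = -regKernel φ ε x := (hφ.isRadialDensity hε).velocity_neg x

/-- Without zero mean the velocity still decays like `|x|⁻¹`, because `|x - t| ≥ |x|/2` on the
support once `|x|` is large. -/
lemma exists_velocity_bound_inv {ω : Plane → ℝ} (hω : Continuous ω) (hc : HasCompactSupport ω) :
    ∃ c, 0 ≤ c ∧ ∀ x, ‖velocity ω x‖ ≤ c ∧ ‖velocity ω x‖ * ‖x‖ ≤ c := by
  obtain ⟨R, hR1, hR⟩ := exists_radius hc
  have hωi := hω.integrable_of_hasCompactSupport (μ := volume) hc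
  obtain ⟨B, hB⟩ := (isCompact_closedBall (0:Plane) (2 * R)).exists_bound_of_continuousOn
    (continuous_velocity hω hc).continuousOn
  set M := ∫ x, |ω x| with hM
  have hM0 : 0 ≤ M := integral_nonneg fun x => abs_nonneg _
  have hpi := Real.pi_pos
  have hB0 : 0 ≤ B := (norm_nonneg _).trans (hB 0 (by simp; linarith))
  have hBR : 0 ≤ B * (2 * R) := mul_nonneg hB0 (by linarith)
  refine ⟨B * (2 * R) + B + 2 * M, by positivity, fun x => ?_⟩
  rcases le_total ‖x‖ (2 * R) with hx | hx
  · have h1 := hB x (by simpa using hx)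
    constructor
    · linarith
    · have : ‖velocity ω x‖ * ‖x‖ ≤ B * (2 * R) := by gcongr
      linarith
  · have hx0 : 0 < ‖x‖ := by linarith
    have h2 : ‖velocity ω x‖ ≤ ∫ t, |ω t| * (1 * (2 * ‖x‖⁻¹)) := by
      rw [velocity_apply]
      refine norm_integral_le_of_norm_le (hωi.abs.mul_const _) (Eventually.of_forall fun t => ?_)
      rw [norm_smul, Real.norm_eq_abs]
      by_cases ht : ‖t‖ ≤ R
      · have h3 : ‖x‖ / 2 ≤ ‖x - t‖ := by have := norm_sub_norm_le x t; linarith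
        have h5 : (2 * Real.pi)⁻¹ ≤ 1 := by
          rw [inv_le_one_iff₀]; right; linarith [Real.pi_gt_three]
        rw [norm_bsKernel]
        refine mul_le_mul_of_nonneg_left ?_ (abs_nonneg _)
        refine mul_le_mul h5 ?_ (by positivity) zero_le_one
        calc ‖x - t‖⁻¹ ≤ (‖x‖ / 2)⁻¹ := by gcongr
          _ = 2 * ‖x‖⁻¹ := by field_simp
      · rw [hR t (not_le.1 ht)]; simp
    rw [integral_mul_const, one_mul, ← hM] at h2
    have h6 : ‖velocity ω x‖ * ‖x‖ ≤ 2 * M := by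
      calc ‖velocity ω x‖ * ‖x‖ ≤ M * (2 * ‖x‖⁻¹) * ‖x‖ := by gcongr
        _ = 2 * M := by field_simp
    have h7 : ‖velocity ω x‖ ≤ ‖velocity ω x‖ * ‖x‖ :=
      le_mul_of_one_le_right (norm_nonneg _) (by linarith)
    constructor <;> linarith

/-- The product `|K_ε(x)| |x|` is scale invariant, so the bound for `ε = 1` holds for every `ε`.
Paired with a Lipschitz increment it compensates the singularity of the kernel uniformly in `ε`. -/
lemma IsBlob.exists_regKernel_bound (hφ : IsBlob φ) :
    ∃ c, 0 ≤ c ∧ ∀ ε, 0 < ε → ∀ x, ‖regKernel φ ε x‖ * ‖x‖ ≤ c := by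
  obtain ⟨c, hc0, hc⟩ := exists_velocity_bound_inv hφ.continuous hφ.hasCompactSupport
  refine ⟨c, hc0, fun ε hε x => ?_⟩
  have h := (hc (ε⁻¹ • x)).2
  rw [norm_smul, norm_inv, Real.norm_of_nonneg hε.le] at h
  rw [regKernel_scaling φ hε, norm_smul, norm_inv, Real.norm_of_nonneg hε.le]
  calc _ = _ := by ring
    _ ≤ c := h

lemma exists_lipschitz_velocity {ω : Plane → ℝ} (hω : ContDiff ℝ 1 ω) (hc : HasCompactSupport ω) :
    ∃ L, 0 ≤ L ∧ ∀ x y, ‖velocity ω x - velocity ω y‖ ≤ L * ‖x - y‖ := by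
  have hb : ∀ v, ∃ c, 0 ≤ c ∧ ∀ x, ‖fderiv ℝ (velocity ω) x v‖ ≤ c := fun v => by
    obtain ⟨c, hc0, h⟩ := exists_velocity_bound_inv (continuous_fderiv_apply hω v)
      (hasCompactSupport_fderiv_apply hc v)
    exact ⟨c, hc0, fun x => by rw [fderiv_velocity hω hc]; exact (h x).1⟩
  obtain ⟨c0, h00, h0⟩ := hb (EuclideanSpace.single 0 1)
  obtain ⟨c1, h10, h1⟩ := hb (EuclideanSpace.single 1 1)
  refine ⟨c0 + c1, by positivity, fun x y => ?_⟩
  have hd := (contDiff_velocity (n := 1) hω hc).differentiable one_ne_zero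
  refine Convex.norm_image_sub_le_of_norm_fderiv_le (𝕜 := ℝ) (fun z _ => hd z) (fun z _ => ?_)
    convex_univ (mem_univ y) (mem_univ x)
  refine ContinuousLinearMap.opNorm_le_bound _ (by positivity) fun v => ?_
  rw [clm_plane_apply]
  refine (norm_add_le _ _).trans ?_
  rw [norm_smul, norm_smul, add_mul]
  have e0 : ‖v 0‖ ≤ ‖v‖ := PiLp.norm_apply_le v 0
  have e1 : ‖v 1‖ ≤ ‖v‖ := PiLp.norm_apply_le v 1
  rw [mul_comm c0, mul_comm c1]
  gcongr
  · exact h0 z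
  · exact h1 z

end Blob

/-! ### Blob vorticities -/

section BlobVorticity

variable {φ : Plane → ℝ} {ε C α R M T : ℝ} {N : ℕ} {ξ : Fin N → ℝ} {X : Fin N → Plane}

lemma IsBlob.contDiff_sub (hφ : IsBlob φ) (ε : ℝ) (p : Plane) :
    ContDiff ℝ 2 fun x => scaledBlob φ ε (x - p) :=
  (hφ.contDiff_scaledBlob ε).comp (contDiff_id.sub contDiff_const)

lemma IsBlob.integrable_sub (hφ : IsBlob φ) (hε : 0 < ε) (p : Plane) :
    Integrable fun x => scaledBlob φ ε (x - p) :=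
  (hφ.isRadialDensity hε).integrable.comp_sub_right p

lemma IsBlob.contDiff_blobVorticity (hφ : IsBlob φ) :
    ContDiff ℝ 2 (blobVorticity φ ε ξ X) := by
  unfold blobVorticity
  exact ContDiff.sum fun j _ => contDiff_const.mul (hφ.contDiff_sub ε (X j))

lemma IsBlob.hasCompactSupport_sub (hφ : IsBlob φ) (hε : 0 < ε) (p : Plane) :
    HasCompactSupport fun x => scaledBlob φ ε (x - p) :=
  (hφ.hasCompactSupport_scaledBlob hε).comp_homeomorph (Homeomorph.subRight p)

lemma IsBlob.integral_blobVorticity (hφ : IsBlob φ) (hε : 0 < ε) :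
    ∫ x, blobVorticity φ ε ξ X x = ∑ j, ξ j := by
  simp only [blobVorticity]
  rw [integral_finsetSum _ fun j _ => (hφ.integrable_sub hε (X j)).const_mul _]
  refine Finset.sum_congr rfl fun j _ => ?_
  rw [integral_const_mul, integral_sub_right_eq_self (scaledBlob φ ε),
    (hφ.isRadialDensity hε).integral_eq_one, mul_one]

lemma IsBlob.integral_abs_blobVorticity_le (hφ : IsBlob φ) (hε : 0 < ε) :
    ∫ x, |blobVorticity φ ε ξ X x| ≤ ∑ j, |ξ j| := by
  have h := hφ.isRadialDensity hε
  have h1 : ∀ j, Integrable fun x => |ξ j| * scaledBlob φ ε (x - X j) := fun j =>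
    (hφ.integrable_sub hε (X j)).const_mul _
  have h2 : ∫ x, ∑ j, |ξ j| * scaledBlob φ ε (x - X j) = ∑ j, |ξ j| := by
    rw [integral_finsetSum _ fun j _ => h1 j]
    refine Finset.sum_congr rfl fun j _ => ?_
    rw [integral_const_mul, integral_sub_right_eq_self (scaledBlob φ ε), h.integral_eq_one,
      mul_one]
  rw [← h2]
  refine integral_mono_of_nonneg (Eventually.of_forall fun x => abs_nonneg _)
    (integrable_finsetSum _ fun j _ => h1 j) (Eventually.of_forall fun x => ?_)
  refine (Finset.abs_sum_le_sum_abs _ _).trans (le_of_eq (Finset.sum_congr rfl fun j _ => ?_))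
  rw [abs_mul, abs_of_nonneg (h.nonneg _)]

lemma IsBlob.integral_blobVorticity_smul (hφ : IsBlob φ) (hε : 0 < ε) {E : Type*}
    [NormedAddCommGroup E] [NormedSpace ℝ E] {g : Plane → E} (hg : LocallyIntegrable g) :
    ∫ x, blobVorticity φ ε ξ X x • g x
      = ∑ j, ξ j • ∫ x, scaledBlob φ ε (x - X j) • g x := by
  simp only [blobVorticity, Finset.sum_smul, mul_smul]
  have h1 : ∀ j, Integrable fun x => scaledBlob φ ε (x - X j) • g x := fun j =>
    hg.integrable_smul_left_of_hasCompactSupport (hφ.contDiff_sub ε (X j)).continuous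
      (hφ.hasCompactSupport_sub hε (X j))
  have h2 : ∀ j, Integrable fun x => ξ j • scaledBlob φ ε (x - X j) • g x := fun j =>
    (h1 j).smul (ξ j)
  rw [integral_finsetSum _ fun j _ => h2 j]
  simp only [integral_smul]

lemma IsBlob.velocity_blobVorticity (hφ : IsBlob φ) (hε : 0 < ε) :
    velocity (blobVorticity φ ε ξ X) = blobVelocity φ ε ξ X := by
  ext1 x
  rw [velocity_apply, hφ.integral_blobVorticity_smul hε
    (locallyIntegrable_comp_sub_left locallyIntegrable_bsKernel x), blobVelocity]
  refine Finset.sum_congr rfl fun j _ => ?_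
  rw [regKernel_eq_velocity, sub_eq_add_neg, ← velocity_translate, velocity_apply]
  simp only [sub_eq_add_neg]

lemma IsBlob.stream_blobVorticity (hφ : IsBlob φ) (hε : 0 < ε) (x : Plane) :
    stream (blobVorticity φ ε ξ X) x = ∑ j, ξ j * stream (scaledBlob φ ε) (x - X j) := by
  have h := hφ.integral_blobVorticity_smul (ξ := ξ) (X := X) hε
    (locallyIntegrable_comp_sub_left locallyIntegrable_logKernel x)
  simp only [smul_eq_mul] at h
  rw [stream_apply, h]
  refine Finset.sum_congr rfl fun j _ => ?_
  rw [sub_eq_add_neg, ← stream_translate, stream_apply]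
  simp only [sub_eq_add_neg]

lemma IsBlob.hasDecay (hφ : IsBlob φ) (hε : 0 < ε)
    (h : ∀ r : ℝ, 0 < r → maximalFunction (volume.withDensityᵥ (blobVorticity φ ε ξ X)) r
      ≤ ENNReal.ofReal (C * r ^ α)) : HasDecay (blobVorticity φ ε ξ X) C α := by
  intro x r hr
  have hi : Integrable (blobVorticity φ ε ξ X) := by
    unfold blobVorticity
    exact integrable_finsetSum _ fun j _ => (hφ.integrable_sub hε (X j)).const_mul _
  refine le_trans ?_ (h r hr)
  refine le_trans (le_of_eq ?_) (le_iSup _ x)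
  rw [SignedMeasure.totalVariation_eq_variation, Measure.variation_withDensityᵥ hi,
    withDensity_apply _ Metric.isClosed_closedBall.measurableSet]

lemma IsBlob.isVortexDensity (hφ : IsBlob φ) (hε : 0 < ε)
    (h : ∀ r : ℝ, 0 < r → maximalFunction (volume.withDensityᵥ (blobVorticity φ ε ξ X)) r
      ≤ ENNReal.ofReal (C * r ^ α))
    (hs : tsupport (blobVorticity φ ε ξ X) ⊆ Metric.ball 0 R) (hmean : ∑ j, ξ j = 0)
    (hM : ∑ j, |ξ j| ≤ M) : IsVortexDensity (blobVorticity φ ε ξ X) C α R M where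
  contDiff := hφ.contDiff_blobVorticity.of_le (by norm_num)
  eq_zero x hx := by
    by_contra hne
    have := hs (subset_tsupport _ hne)
    simp only [Metric.mem_ball, dist_zero_right] at this
    linarith
  mean := by rw [hφ.integral_blobVorticity hε, hmean]
  mass := (hφ.integral_abs_blobVorticity_le hε).trans hM
  decay := hφ.hasDecay hε h

/-! ### The Hamiltonian -/

/-- The Hamiltonian of the vortex-blob system. -/
def hamiltonian (φ : Plane → ℝ) (ε : ℝ) {N : ℕ} (ξ : Fin N → ℝ) (X : Fin N → Plane) : ℝ :=
  ∑ j, ∑ k, ξ j * ξ k * stream (scaledBlob φ ε) (X j - X k)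

/-- The energy identity gives `∫ |u^ε|² = ∑ ξⱼ (φ_ε * ψ)(Xⱼ)`, while the Hamiltonian is `∑ ξⱼ
ψ(Xⱼ)`. They differ by one averaging of `ψ` at scale `ε`. -/
lemma IsBlob.abs_energy_sub_hamiltonian_le (hφ : IsBlob φ) (hε : 0 < ε) (hC : 0 ≤ C) (hα : 0 < α)
    (h : IsVortexDensity (blobVorticity φ ε ξ X) C α R M) :
    |(∫ x, ‖blobVelocity φ ε ξ X x‖ ^ 2) - hamiltonian φ ε ξ X|
      ≤ (∑ j, |ξ j|) * ((2 * Real.pi)⁻¹ * (C * ε ^ α / α)) := by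
  set ψ := stream (blobVorticity φ ε ξ X) with hψ
  have hψc : Continuous ψ := continuous_stream h.continuous h.compactSupport
  have hη := hφ.isRadialDensity hε
  have h1 : ∫ x, ‖blobVelocity φ ε ξ X x‖ ^ 2
      = ∑ j, ξ j * ∫ y, scaledBlob φ ε y * ψ (X j - y) := by
    have h2 := hφ.integral_blobVorticity_smul (ξ := ξ) (X := X) hε hψc.locallyIntegrable
    simp only [smul_eq_mul] at h2
    rw [← hφ.velocity_blobVorticity hε,
      (integral_norm_velocity_sq h.contDiff h.compactSupport h.mean).2, ← hψ, h2]
    refine Finset.sum_congr rfl fun j _ => ?_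
    congr 1
    rw [← integral_sub_left_eq_self (fun y => scaledBlob φ ε y * ψ (X j - y)) volume (X j)]
    refine integral_congr_ae (Eventually.of_forall fun x => ?_)
    simp only [sub_sub_cancel]
    rw [← neg_sub, hη.neg]
  have h3 : hamiltonian φ ε ξ X = ∑ j, ξ j * ψ (X j) := by
    simp only [hamiltonian, hψ, hφ.stream_blobVorticity hε, Finset.mul_sum, mul_assoc]
  rw [h1, h3, ← Finset.sum_sub_distrib, Finset.sum_mul]
  refine (Finset.abs_sum_le_sum_abs _ _).trans (Finset.sum_le_sum fun j _ => ?_)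
  rw [← mul_sub, abs_mul, abs_sub_comm]
  gcongr
  exact abs_stream_sub_le h.continuous h.compactSupport h.decay hη hC hα hε (X j)

/-- Delort's symmetrization: exchanging `j` and `k` and using that `κ` is odd replaces `q j` by half
of the increment `q j - q k`, which can offset the size of `κ` near the origin. -/
lemma sum_inner_odd_symm {κ : Plane → Plane} (hκ : ∀ x, κ (-x) = -κ x) (q : Fin N → Plane) :
    ∑ j, ∑ k, ξ j * ξ k * inner ℝ (q j) (κ (X j - X k))
      = 2⁻¹ * ∑ j, ∑ k, ξ j * ξ k * inner ℝ (q j - q k) (κ (X j - X k)) := by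
  have h1 : ∑ j, ∑ k, ξ j * ξ k * inner ℝ (q k) (κ (X j - X k))
      = -∑ j, ∑ k, ξ j * ξ k * inner ℝ (q j) (κ (X j - X k)) := by
    rw [Finset.sum_comm, ← Finset.sum_neg_distrib]
    refine Finset.sum_congr rfl fun j _ => ?_
    rw [← Finset.sum_neg_distrib]
    refine Finset.sum_congr rfl fun k _ => ?_
    rw [← neg_sub (X j) (X k), hκ, inner_neg_right]
    ring
  simp only [inner_sub_left, mul_sub, Finset.sum_sub_distrib, h1]
  ring

lemma sum_sum_abs_le (A : Fin N → Fin N → ℝ) {B : ℝ} (hB : ∀ j k, |A j k| ≤ B) :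
    |∑ j, ∑ k, ξ j * ξ k * A j k| ≤ (∑ j, |ξ j|) ^ 2 * B := by
  have h1 : (∑ j, |ξ j|) ^ 2 * B = ∑ j, ∑ k, |ξ j| * |ξ k| * B := by
    rw [sq, Finset.sum_mul_sum, Finset.sum_mul]
    simp only [Finset.sum_mul]
  rw [h1]
  refine (Finset.abs_sum_le_sum_abs _ _).trans (Finset.sum_le_sum fun j _ => ?_)
  refine (Finset.abs_sum_le_sum_abs _ _).trans (Finset.sum_le_sum fun k _ => ?_)
  rw [abs_mul, abs_mul]
  gcongr
  exact hB j k

lemma sum_inner_blobVelocity (q : Fin N → Plane) :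
    ∑ j, ξ j * inner ℝ (q j) (blobVelocity φ ε ξ X (X j))
      = ∑ j, ∑ k, ξ j * ξ k * inner ℝ (q j) (regKernel φ ε (X j - X k)) := by
  simp only [blobVelocity, inner_sum, inner_smul_right, Finset.mul_sum, mul_assoc]

/-- The gradient of the Hamiltonian in `Xⱼ` is a multiple of the rotated velocity of `Xⱼ`, hence
orthogonal to the motion. -/
lemma IsBlob.hamiltonian_eq (hφ : IsBlob φ) (hε : 0 < ε) {X : ℝ → Fin N → Plane}
    (hX : SolvesVortexBlob φ ε T ξ X) {t : ℝ} (ht : t ∈ Icc 0 T) :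
    hamiltonian φ ε ξ (X t) = hamiltonian φ ε ξ (X 0) := by
  have hη := hφ.isRadialDensity hε
  have hder : ∀ s ∈ Icc 0 T, HasDerivWithinAt (fun s => hamiltonian φ ε ξ (X s)) 0 (Icc 0 T) s := by
    intro s hs
    have hd : HasDerivWithinAt (fun s => hamiltonian φ ε ξ (X s))
        (∑ j, ∑ k, ξ j * ξ k * inner ℝ (perp (regKernel φ ε (X s j - X s k)))
          (blobVelocity φ ε ξ (X s) (X s j) - blobVelocity φ ε ξ (X s) (X s k))) (Icc 0 T) s := by
      unfold hamiltonian
      refine HasDerivWithinAt.fun_sum fun j _ => HasDerivWithinAt.fun_sum fun k _ => ?_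
      refine HasDerivWithinAt.const_mul _ ?_
      exact (hasFDerivAt_stream ((hφ.contDiff_scaledBlob ε).of_le (by norm_num))
        (hφ.hasCompactSupport_scaledBlob hε) _).comp_hasDerivWithinAt s ((hX s hs j).sub (hX s hs k))
    convert hd using 1
    symm
    have hodd : ∀ x, perp (regKernel φ ε (-x)) = -perp (regKernel φ ε x) := fun x => by
      rw [hφ.regKernel_neg hε, perp_neg]
    have h1 := sum_inner_odd_symm (ξ := ξ) (X := X s) (κ := fun x => perp (regKernel φ ε x)) hodd
      (fun j => blobVelocity φ ε ξ (X s) (X s j))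
    -- Summing over `k` first rebuilds the full velocity `uⱼ`, so each term is a multiple of `uⱼ ·
    -- uⱼ^⊥ = 0`.
    have h2 : ∑ j, ∑ k, ξ j * ξ k * inner ℝ (blobVelocity φ ε ξ (X s) (X s j))
        (perp (regKernel φ ε (X s j - X s k))) = 0 := by
      have h3 := sum_inner_blobVelocity (φ := φ) (ε := ε) (ξ := ξ) (X := X s)
        (fun j => -perp (blobVelocity φ ε ξ (X s) (X s j)))
      have h5 : ∀ j, inner ℝ (-perp (blobVelocity φ ε ξ (X s) (X s j)))
          (blobVelocity φ ε ξ (X s) (X s j)) = 0 := fun j => by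
        rw [inner_neg_left, inner_perp_self, neg_zero]
      have h6 : ∀ j k, inner ℝ (-perp (blobVelocity φ ε ξ (X s) (X s j)))
          (regKernel φ ε (X s j - X s k)) = inner ℝ (blobVelocity φ ε ξ (X s) (X s j))
          (perp (regKernel φ ε (X s j - X s k))) := fun j k => by
        rw [inner_neg_left, inner_perp_left, neg_neg]
      simp only [h5, h6, mul_zero, Finset.sum_const_zero] at h3
      exact h3.symm
    rw [h2] at h1
    have h4 : ∀ j k, inner ℝ (perp (regKernel φ ε (X s j - X s k)))
          (blobVelocity φ ε ξ (X s) (X s j) - blobVelocity φ ε ξ (X s) (X s k))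
        = inner ℝ (blobVelocity φ ε ξ (X s) (X s j) - blobVelocity φ ε ξ (X s) (X s k))
          (perp (regKernel φ ε (X s j - X s k))) := fun j k => real_inner_comm _ _
    simp only [h4]
    linarith
  have h0 : (0:ℝ) ∈ Icc 0 T := ⟨le_rfl, ht.1.trans ht.2⟩
  have := (convex_Icc (0:ℝ) T).norm_image_sub_le_of_norm_hasDerivWithin_le (C := 0) hder
    (fun s _ => by simp) h0 ht
  rw [zero_mul, norm_le_zero_iff, sub_eq_zero] at this
  exact this

/-- After symmetrization the Lipschitz increment of `q` meets the bound on `|x| |K_ε(x)|`. The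
estimate is independent of `ε` and needs no decay of the vorticity. -/
lemma abs_sum_inner_blobVelocity_le (hφ : IsBlob φ) (hε : 0 < ε) {c L : ℝ} (hL : 0 ≤ L)
    (hc : ∀ x, ‖regKernel φ ε x‖ * ‖x‖ ≤ c) {q : Plane → Plane}
    (hq : ∀ x y, ‖q x - q y‖ ≤ L * ‖x - y‖) :
    |∑ j, ξ j * inner ℝ (q (X j)) (blobVelocity φ ε ξ X (X j))| ≤ (∑ j, |ξ j|) ^ 2 * (L * c) := by
  have hc0 : 0 ≤ c := by simpa using hc 0
  rw [sum_inner_blobVelocity (fun j => q (X j)), sum_inner_odd_symm (hφ.regKernel_neg hε),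
    abs_mul, abs_of_pos (by norm_num)]
  have h1 := sum_sum_abs_le (ξ := ξ)
    (fun j k => inner ℝ (q (X j) - q (X k)) (regKernel φ ε (X j - X k))) (B := L * c) fun j k => by
      calc |inner ℝ (q (X j) - q (X k)) (regKernel φ ε (X j - X k))|
          ≤ (L * ‖X j - X k‖) * ‖regKernel φ ε (X j - X k)‖ :=
            (abs_real_inner_le_norm _ _).trans (by gcongr; exact hq _ _)
        _ = L * (‖regKernel φ ε (X j - X k)‖ * ‖X j - X k‖) := by ring
        _ ≤ L * c := by gcongr; exact hc _
  have h2 := abs_nonneg (∑ j, ∑ k, ξ j * ξ k *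
    inner ℝ (q (X j) - q (X k)) (regKernel φ ε (X j - X k)))
  linarith

end BlobVorticity

/-! ### Approximation by convolutions with the blob function -/

section Wiener

open scoped FourierTransform

variable {φ : Plane → ℝ}

lemma countable_zeros_of_entire {f : ℂ → ℂ} (hf : Differentiable ℂ f) {z : ℂ} (hz : f z ≠ 0) :
    {w | f w = 0}.Countable := by
  have h1 := (hf.differentiableOn.analyticOnNhd isOpen_univ).preimage_zero_mem_codiscrete hz
  have h2 := (mem_codiscrete'.1 h1).2
  have h3 : (f ⁻¹' {0}ᶜ)ᶜ = {w | f w = 0} := by ext; simp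
  rw [h3] at h2
  have := isDiscrete_iff_discreteTopology.1 h2
  exact Set.countable_coe_iff.1 (TopologicalSpace.separableSpace_iff_countable.1 inferInstance)

lemma IsBlob.fourier_zero (hφ : IsBlob φ) : 𝓕 (fun x => (φ x : ℂ)) 0 = 1 := by
  rw [Real.fourier_eq']
  simp only [inner_zero_right, mul_zero, Complex.ofReal_zero, zero_mul, Complex.exp_zero, one_smul]
  rw [integral_complex_ofReal, hφ.integral_eq_one, Complex.ofReal_one]

lemma IsBlob.integrable_ofReal (hφ : IsBlob φ) : Integrable fun x => (φ x : ℂ) :=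
  hφ.integrable.ofReal

lemma IsBlob.continuous_fourier (hφ : IsBlob φ) : Continuous (𝓕 (fun x => (φ x : ℂ))) :=
  VectorFourier.fourierIntegral_continuous (L := innerₗ Plane) Real.continuous_fourierChar
    continuous_inner hφ.integrable_ofReal

lemma IsBlob.norm_fourier_le (hφ : IsBlob φ) (ζ : Plane) : ‖𝓕 (fun x => (φ x : ℂ)) ζ‖ ≤ 1 := by
  refine (VectorFourier.norm_fourierIntegral_le_integral_norm _ _ _ _ ζ).trans (le_of_eq ?_)
  rw [← hφ.integral_eq_one]
  refine integral_congr_ae (Eventually.of_forall fun x => ?_)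
  simp [abs_of_nonneg (hφ.nonneg x)]

/-- Two vectors of equal norm are exchanged by a reflection, which leaves `φ` invariant. -/
lemma IsBlob.fourier_radial (hφ : IsBlob φ) {ζ η : Plane} (h : ‖ζ‖ = ‖η‖) :
    𝓕 (fun x => (φ x : ℂ)) ζ = 𝓕 (fun x => (φ x : ℂ)) η := by
  obtain ⟨f, hf⟩ := hφ.radial
  have h1 := Real.fourier_comp_linearIsometry (Submodule.reflection (Submodule.span ℝ {ζ - η})ᗮ)
    (fun x => (φ x : ℂ)) ζ
  rw [Submodule.reflection_sub h] at h1
  rw [← h1]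
  have h2 : (fun x => (φ x : ℂ)) ∘ Submodule.reflection (Submodule.span ℝ {ζ - η})ᗮ
      = fun x => (φ x : ℂ) := by
    funext x
    simp only [Function.comp_apply, hf, LinearIsometryEquiv.norm_map]
  rw [h2]

/-- Along a line, `φ̂` is the restriction to the imaginary axis of the complex moment generating
function of `x·e` under the measure `φ dx`. Since `φ` has compact support, this function is entire,
and it is nonzero at the origin because `φ` has unit mass. -/
lemma IsBlob.countable_zeros_fourier (hφ : IsBlob φ) (e : Plane) :
    {s : ℝ | 𝓕 (fun x => (φ x : ℂ)) (s • e) = 0}.Countable := by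
  set μ : Measure Plane := volume.withDensity fun x => ENNReal.ofReal (φ x) with hμ
  set Y : Plane → ℝ := fun x => inner ℝ x e with hY
  have hYc : Continuous Y := continuous_id.inner continuous_const
  have hφm : Measurable fun x => ENNReal.ofReal (φ x) :=
    hφ.continuous.measurable.ennreal_ofReal
  have hfin : IsFiniteMeasure μ :=
    isFiniteMeasure_withDensity_ofReal hφ.integrable.hasFiniteIntegral
  have hset : ProbabilityTheory.integrableExpSet Y μ = univ := by
    refine eq_univ_of_forall fun t => ?_
    refine Integrable.of_bound (C := Real.exp (|t| * ‖e‖))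
      (Real.continuous_exp.comp (continuous_const.mul hYc)).aestronglyMeasurable ?_
    rw [hμ, ae_withDensity_iff hφm]
    refine Eventually.of_forall fun x hx => ?_
    have hx1 : ‖x‖ ≤ 1 := by
      by_contra h
      exact hx (by rw [hφ.eq_zero (not_le.1 h).le]; simp)
    rw [Real.norm_eq_abs, Real.abs_exp, Real.exp_le_exp]
    refine (le_abs_self _).trans ?_
    rw [abs_mul]
    gcongr
    calc |Y x| ≤ ‖x‖ * ‖e‖ := abs_real_inner_le_norm _ _
      _ ≤ 1 * ‖e‖ := by gcongr
      _ = ‖e‖ := one_mul _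
  have hd : Differentiable ℂ (ProbabilityTheory.complexMGF Y μ) := fun z =>
    (ProbabilityTheory.hasDerivAt_complexMGF (by simp [hset])).differentiableAt
  have hval : ∀ s : ℝ, 𝓕 (fun x => (φ x : ℂ)) (s • e)
      = ProbabilityTheory.complexMGF Y μ (-2 * Real.pi * Complex.I * s) := by
    intro s
    rw [Real.fourier_eq', ProbabilityTheory.complexMGF, hμ,
      integral_withDensity_eq_integral_toReal_smul hφm
        (Eventually.of_forall fun x => ENNReal.ofReal_lt_top)]
    refine integral_congr_ae (Eventually.of_forall fun x => ?_)
    simp only [ENNReal.toReal_ofReal (hφ.nonneg x), smul_eq_mul, Complex.real_smul]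
    rw [mul_comm]
    congr 2
    rw [inner_smul_right]
    push_cast
    ring
  have h0 : ProbabilityTheory.complexMGF Y μ 0 ≠ 0 := by
    have := hval 0
    rw [zero_smul, hφ.fourier_zero, Complex.ofReal_zero, mul_zero] at this
    rw [← this]
    exact one_ne_zero
  have hc := countable_zeros_of_entire hd h0
  have hinj : Function.Injective fun s : ℝ => (-2 * Real.pi * Complex.I * s : ℂ) := by
    intro a b hab
    have : (-2 * Real.pi * Complex.I : ℂ) ≠ 0 := by simp [Real.pi_ne_zero]
    exact_mod_cast mul_left_cancel₀ this hab
  refine (hc.preimage_of_injOn hinj.injOn).mono fun s hs => ?_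
  change ProbabilityTheory.complexMGF Y μ (-2 * Real.pi * Complex.I * s) = 0
  rw [← hval]
  exact hs

/-- By radial symmetry the zeros lie on circles whose radii are zeros along a single line: countably
many null sets. -/
lemma IsBlob.fourier_ne_zero_ae (hφ : IsBlob φ) : ∀ᵐ ζ, 𝓕 (fun x => (φ x : ℂ)) ζ ≠ 0 := by
  have hc := hφ.countable_zeros_fourier (EuclideanSpace.single 0 1)
  have hsub : {ζ : Plane | ¬ 𝓕 (fun x => (φ x : ℂ)) ζ ≠ 0} ⊆
      ⋃ s ∈ {s : ℝ | 𝓕 (fun x => (φ x : ℂ)) (s • (EuclideanSpace.single 0 1 : Plane)) = 0},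
        Metric.sphere (0 : Plane) s := by
    intro ζ hζ
    simp only [mem_iUnion]
    refine ⟨‖ζ‖, ?_, by simp⟩
    change 𝓕 (fun x => (φ x : ℂ)) (‖ζ‖ • (EuclideanSpace.single 0 1 : Plane)) = 0
    rw [hφ.fourier_radial (η := ζ) (by simp [norm_smul])]
    exact not_not.1 hζ
  rw [ae_iff]
  refine measure_mono_null hsub ((measure_biUnion_null_iff hc).2 fun s _ => ?_)
  exact Measure.addHaar_sphere volume 0 s

/-- Division by the Fourier transform of the blob, up to a small error in `L¹`. -/
lemma IsBlob.exists_integral_sub_fourier_mul_le (hφ : IsBlob φ) {f : Plane → ℂ}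
    (hf : Integrable f) {δ : ℝ} (hδ : 0 < δ) :
    ∃ G : 𝓢(Plane, ℂ), Integrable (fun ζ => f ζ - 𝓕 (fun x => (φ x : ℂ)) ζ * G ζ) ∧
      ∫ ζ, ‖f ζ - 𝓕 (fun x => (φ x : ℂ)) ζ * G ζ‖ ≤ δ := by
  set F := 𝓕 (fun x => (φ x : ℂ)) with hF
  have hFc : Continuous F := hφ.continuous_fourier
  have hF1 : ∀ ζ, ‖F ζ‖ ≤ 1 := hφ.norm_fourier_le
  have hden : ∀ (n : ℕ) ζ, 0 < ‖F ζ‖ ^ 2 + 1 / ((n : ℝ) + 1) := fun n ζ => by positivity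
  -- Regularized quotient: `f φ̂⁻¹` is replaced by `f` times the conjugate of `φ̂` over `|φ̂|² +
  -- 1/(n+1)`. This is integrable, and multiplying it by `φ̂` gives `f` times a factor in `[0,1]`
  -- tending to `1` wherever `φ̂ ≠ 0`.
  let h : ℕ → Plane → ℂ := fun n ζ =>
    f ζ * (((‖F ζ‖ ^ 2 + 1 / ((n : ℝ) + 1))⁻¹ : ℝ) * starRingEnd ℂ (F ζ))
  have hcont : ∀ n : ℕ, Continuous fun ζ =>
      (((‖F ζ‖ ^ 2 + 1 / ((n : ℝ) + 1))⁻¹ : ℝ) : ℂ) * starRingEnd ℂ (F ζ) := fun n =>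
    (Complex.continuous_ofReal.comp (((hFc.norm.pow 2).add continuous_const).inv₀
      fun ζ => (hden n ζ).ne')).mul (Complex.continuous_conj.comp hFc)
  have hh : ∀ n, Integrable (h n) := fun n => by
    refine hf.mul_bdd (c := (1 / ((n : ℝ) + 1))⁻¹) (hcont n).aestronglyMeasurable
      (Eventually.of_forall fun ζ => ?_)
    rw [norm_mul, Complex.norm_real, RCLike.norm_conj,
      Real.norm_of_nonneg (inv_nonneg.2 (hden n ζ).le)]
    refine (mul_le_of_le_one_right (inv_nonneg.2 (hden n ζ).le) (hF1 ζ)).trans ?_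
    gcongr
    exact le_add_of_nonneg_left (by positivity)
  have hFh : ∀ n ζ, F ζ * h n ζ
      = f ζ * ((‖F ζ‖ ^ 2 * (‖F ζ‖ ^ 2 + 1 / ((n : ℝ) + 1))⁻¹ : ℝ) : ℂ) := fun n ζ => by
    simp only [h]
    push_cast
    rw [← Complex.mul_conj']
    ring
  have hlim : Tendsto (fun n => ∫ ζ, ‖f ζ - F ζ * h n ζ‖) atTop (𝓝 (∫ _ : Plane, (0:ℝ))) := by
    refine tendsto_integral_of_dominated_convergence (fun ζ => ‖f ζ‖) (fun n => ?_) hf.norm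
      (fun n => Eventually.of_forall fun ζ => ?_) ?_
    · exact (hf.aestronglyMeasurable.sub
        (hFc.aestronglyMeasurable.mul (hh n).aestronglyMeasurable)).norm
    · rw [hFh, norm_norm, ← mul_one_sub, norm_mul]
      refine mul_le_of_le_one_right (norm_nonneg _) ?_
      rw [← Complex.ofReal_one, ← Complex.ofReal_sub, Complex.norm_real, Real.norm_eq_abs, abs_le]
      have h1 : ‖F ζ‖ ^ 2 * (‖F ζ‖ ^ 2 + 1 / ((n : ℝ) + 1))⁻¹ ≤ 1 := by
        rw [← div_eq_mul_inv, div_le_one (hden n ζ)]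
        exact le_add_of_nonneg_right (by positivity)
      have h2 : 0 ≤ ‖F ζ‖ ^ 2 * (‖F ζ‖ ^ 2 + 1 / ((n : ℝ) + 1))⁻¹ :=
        mul_nonneg (by positivity) (inv_nonneg.2 (hden n ζ).le)
      constructor <;> linarith
    · filter_upwards [hφ.fourier_ne_zero_ae] with ζ hζ
      have hpos : 0 < ‖F ζ‖ ^ 2 := by have := norm_pos_iff.2 hζ; positivity
      have h3 : Tendsto (fun n : ℕ => ‖F ζ‖ ^ 2 * (‖F ζ‖ ^ 2 + 1 / ((n : ℝ) + 1))⁻¹) atTop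
          (𝓝 (‖F ζ‖ ^ 2 * (‖F ζ‖ ^ 2 + 0)⁻¹)) :=
        ((tendsto_one_div_add_atTop_nhds_zero_nat.const_add _).inv₀ (by simpa using hpos.ne')).const_mul _
      rw [add_zero, mul_inv_cancel₀ hpos.ne'] at h3
      have h4 := (((Complex.continuous_ofReal.tendsto _).comp h3).const_mul (f ζ)).const_sub (f ζ)
      simp only [Complex.ofReal_one, mul_one, sub_self] at h4
      simp only [hFh]
      simpa using h4.norm
  rw [integral_zero] at hlim
  obtain ⟨n, hn⟩ := (hlim.eventually (gt_mem_nhds (half_pos hδ))).exists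
  -- The quotient is only integrable; a smooth compactly supported `L¹` approximation makes it a
  -- Schwartz function, whose inverse Fourier transform again vanishes at infinity.
  obtain ⟨g, hg1, hg2, hg3⟩ := (memLp_one_iff_integrable.2 (hh n)).exist_eLpNorm_sub_le
    ENNReal.one_ne_top le_rfl (half_pos hδ)
  set G := hg1.toSchwartzMap hg2 with hG
  have hGg : ∀ ζ, G ζ = g ζ := fun ζ => rfl
  have hgi : Integrable g := G.integrable
  have hsub : Integrable fun ζ => h n ζ - g ζ := (hh n).sub hgi
  have hle : ∫ ζ, ‖h n ζ - g ζ‖ ≤ δ / 2 := by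
    rw [eLpNorm_one_eq_lintegral_enorm] at hg3
    rw [integral_norm_eq_lintegral_enorm hsub.aestronglyMeasurable]
    exact ENNReal.toReal_le_of_le_ofReal (by positivity) hg3
  have hFmul : ∀ {k : Plane → ℂ}, Integrable k → Integrable fun ζ => F ζ * k ζ := fun hk =>
    hk.bdd_mul (c := 1) hFc.aestronglyMeasurable (Eventually.of_forall hF1)
  have hI1 : Integrable fun ζ => f ζ - F ζ * h n ζ := hf.sub (hFmul (hh n))
  refine ⟨G, hf.sub (hFmul G.integrable), ?_⟩
  calc ∫ ζ, ‖f ζ - F ζ * G ζ‖ ≤ ∫ ζ, (‖f ζ - F ζ * h n ζ‖ + ‖h n ζ - g ζ‖) := by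
        refine integral_mono (hf.sub (hFmul G.integrable)).norm (hI1.norm.add hsub.norm) fun ζ => ?_
        simp only [hGg]
        rw [show f ζ - F ζ * g ζ = (f ζ - F ζ * h n ζ) + F ζ * (h n ζ - g ζ) by ring]
        refine (norm_add_le _ _).trans ?_
        rw [norm_mul]
        gcongr
        exact mul_le_of_le_one_left (norm_nonneg _) (hF1 ζ)
    _ ≤ δ := by
        rw [integral_add hI1.norm hsub.norm]
        linarith

lemma IsBlob.integrable_fourier_mul (hφ : IsBlob φ) {k : Plane → ℂ} (hk : Integrable k) :
    Integrable fun ζ => 𝓕 (fun x => (φ x : ℂ)) ζ * k ζ :=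
  hk.bdd_mul (c := 1) hφ.continuous_fourier.aestronglyMeasurable
    (Eventually.of_forall hφ.norm_fourier_le)

lemma IsBlob.integral_smul_eq_fourierInv (hφ : IsBlob φ) (g : 𝓢(Plane, ℂ)) (x : Plane) :
    ∫ y, φ y • g (x - y) = 𝓕⁻ (fun ζ => 𝓕 (fun x => (φ x : ℂ)) ζ * 𝓕 (g : Plane → ℂ) ζ) x := by
  have hφc : Continuous fun x => (φ x : ℂ) := Complex.continuous_ofReal.comp hφ.continuous
  have hφs : HasCompactSupport fun x => (φ x : ℂ) := 
    hφ.hasCompactSupport.comp_left (g := Complex.ofReal) Complex.ofReal_zero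
  set q := convolution (fun x => (φ x : ℂ)) g (ContinuousLinearMap.lsmul ℂ ℂ) volume with hq
  have hqc : Continuous q :=
    HasCompactSupport.continuous_convolution_left (𝕜 := ℂ) (ContinuousLinearMap.lsmul ℂ ℂ)
      hφs hφc g.integrable.locallyIntegrable
  have hqi : Integrable q := hφ.integrable_ofReal.integrable_convolution _ g.integrable
  have hgi : Integrable (𝓕 (g : Plane → ℂ)) := by
    rw [← SchwartzMap.fourier_coe]
    exact (𝓕 g).integrable
  have hFq : 𝓕 q = fun ζ => 𝓕 (fun x => (φ x : ℂ)) ζ * 𝓕 (g : Plane → ℂ) ζ := by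
    funext ζ
    rw [hq, Real.fourier_smul_convolution_eq hφ.integrable_ofReal g.integrable, smul_eq_mul]
  have h1 : q x = 𝓕⁻ (fun ζ => 𝓕 (fun x => (φ x : ℂ)) ζ * 𝓕 (g : Plane → ℂ) ζ) x := by
    have hqF : Integrable (𝓕 q) := by
      rw [hFq]
      exact hφ.integrable_fourier_mul hgi
    rw [← hFq, hqc.fourierInv_fourier_eq hqi hqF]
  rw [← h1, hq, convolution]
  refine integral_congr_ae (Eventually.of_forall fun y => ?_)
  simp

lemma norm_fourierInv_sub_le {f g : Plane → ℂ} (hf : Integrable f) (hg : Integrable g)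
    (x : Plane) : ‖𝓕⁻ f x - 𝓕⁻ g x‖ ≤ ∫ ζ, ‖f ζ - g ζ‖ := by
  have hi : ∀ {k : Plane → ℂ}, Integrable k →
      Integrable fun ζ : Plane => Complex.exp ((2 * Real.pi * inner ℝ ζ x : ℝ) * Complex.I) • k ζ := by
    intro k hk
    simp only [smul_eq_mul]
    refine hk.bdd_mul (c := 1) ?_ ?_
    · exact Continuous.aestronglyMeasurable (by fun_prop)
    · exact Eventually.of_forall fun ζ => (Complex.norm_exp_ofReal_mul_I _).le
  rw [Real.fourierInv_eq', Real.fourierInv_eq', ← integral_sub (hi hf) (hi hg)]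
  refine (norm_integral_le_integral_norm _).trans ?_
  refine le_of_eq (integral_congr_ae (Eventually.of_forall fun ζ => ?_))
  simp only
  rw [← smul_sub, norm_smul, Complex.norm_exp_ofReal_mul_I, one_mul]

/-- By Fourier inversion the sup norm of `P - φ * g` is at most the `L¹` norm of `P̂ - φ̂ ĝ`, which
division by `φ̂` makes small. -/
lemma IsBlob.exists_norm_sub_convolution_le (hφ : IsBlob φ) (P : 𝓢(Plane, ℂ)) {δ : ℝ}
    (hδ : 0 < δ) : ∃ g : 𝓢(Plane, ℂ), ∀ x, ‖P x - ∫ y, φ y • g (x - y)‖ ≤ δ := by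
  obtain ⟨G, hG1, hG2⟩ := hφ.exists_integral_sub_fourier_mul_le (𝓕 P).integrable hδ
  refine ⟨𝓕⁻ G, fun x => ?_⟩
  have hGg : 𝓕 ((𝓕⁻ G : 𝓢(Plane, ℂ)) : Plane → ℂ) = G := by
    rw [← SchwartzMap.fourier_coe, FourierTransform.fourier_fourierInv_eq]
  have h2 : P x = 𝓕⁻ ((𝓕 P : 𝓢(Plane, ℂ)) : Plane → ℂ) x := by
    rw [← SchwartzMap.fourierInv_coe, FourierTransform.fourierInv_fourier_eq]
  rw [hφ.integral_smul_eq_fourierInv, hGg, h2]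
  exact (norm_fourierInv_sub_le (𝓕 P).integrable (hφ.integrable_fourier_mul G.integrable) x).trans
    hG2

end Wiener

/-! ### Sums of rescaled functions vanishing at infinity -/

section VanishingSums

variable {φ : Plane → ℝ}

lemma exists_contDiff_hasCompactSupport_approx {P : Plane → ℝ} (hP : Continuous P)
    (hP0 : Tendsto P (cocompact Plane) (𝓝 0)) {δ : ℝ} (hδ : 0 < δ) :
    ∃ Q : Plane → ℝ, ContDiff ℝ (⊤ : ℕ∞) Q ∧ HasCompactSupport Q ∧ ∀ x, |P x - Q x| ≤ δ := by
  have h2 : 0 < δ / 2 := half_pos hδ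
  -- Subtracting the truncation of `P` to `[-δ/2, δ/2]` changes `P` by at most `δ/2` and leaves a
  -- compactly supported function.
  set P' : Plane → ℝ := fun x => P x - max (-(δ / 2)) (min (P x) (δ / 2)) with hP'
  have hP'c : Continuous P' := hP.sub (continuous_const.max (hP.min continuous_const))
  have hP's : HasCompactSupport P' := by
    have h1 : ∀ᶠ x in cocompact Plane, |P x| < δ / 2 := by
      simpa [abs_lt, and_comm] using hP0.eventually (Metric.ball_mem_nhds 0 h2)
    obtain ⟨A, hA, hAs⟩ := mem_cocompact.1 h1
    refine HasCompactSupport.intro hA fun x hx => ?_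
    have h3 := abs_lt.1 (show |P x| < δ / 2 from hAs hx)
    simp only [hP']
    rw [min_eq_left h3.2.le, max_eq_right h3.1.le, sub_self]
  obtain ⟨Q, hQ1, hQ2, hQ3⟩ := hP'c.exists_contDiff_approx ⊤ (ε := fun _ => δ / 2) (by fun_prop)
    (fun _ => h2)
  refine ⟨Q, hQ1, hP's.mono hQ3, fun x => ?_⟩
  have h4 := hQ2 x
  rw [dist_comm, Real.dist_eq] at h4
  have h5 : |P x - P' x| ≤ δ / 2 := by
    simp only [hP', sub_sub_cancel]
    exact abs_le.2 ⟨le_max_left _ _, max_le (by linarith) (min_le_right _ _)⟩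
  have := abs_sub_le (P x) (P' x) (Q x)
  linarith

lemma IsBlob.exists_abs_sub_convolution_le (hφ : IsBlob φ) {P : Plane → ℝ} (hP : Continuous P)
    (hP0 : Tendsto P (cocompact Plane) (𝓝 0)) {δ : ℝ} (hδ : 0 < δ) :
    ∃ g : Plane → ℝ, Continuous g ∧ Tendsto g (cocompact Plane) (𝓝 0) ∧
      ∀ x, |P x - ∫ y, φ y * g (x - y)| ≤ δ := by
  obtain ⟨Q, hQ, hQs, hPQ⟩ := exists_contDiff_hasCompactSupport_approx hP hP0 (half_pos hδ)
  have hQC : HasCompactSupport fun x => (Q x : ℂ) :=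
    hQs.comp_left (g := Complex.ofReal) Complex.ofReal_zero
  obtain ⟨g, hg⟩ := hφ.exists_norm_sub_convolution_le
    (hQC.toSchwartzMap (Complex.ofRealCLM.contDiff.comp hQ)) (half_pos hδ)
  refine ⟨fun x => (g x).re, Complex.continuous_re.comp g.continuous, ?_, fun x => ?_⟩
  · have := (Complex.continuous_re.tendsto 0).comp (zero_at_infty (g.toZeroAtInfty))
    rw [Complex.zero_re] at this
    exact this
  · have h1 : ∫ y, φ y * (g (x - y)).re = (∫ y, φ y • g (x - y)).re := by
      have hi : Integrable fun y => φ y • g (x - y) := by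
        refine Continuous.integrable_of_hasCompactSupport ?_ hφ.hasCompactSupport.smul_right
        exact hφ.continuous.smul (g.continuous.comp (continuous_const.sub continuous_id))
      rw [← RCLike.re_eq_complex_re, ← integral_re hi]
      simp
    have h2 := (Complex.abs_re_le_norm _).trans (hg x)
    rw [Complex.sub_re, ← h1] at h2
    have h3 : ((hQC.toSchwartzMap (Complex.ofRealCLM.contDiff.comp hQ)) x).re = Q x := rfl
    rw [h3] at h2
    have := abs_sub_le (P x) (Q x) (∫ y, φ y * (g (x - y)).re)
    have := hPQ x
    linarith

/-- A point sum of the rescaled `φ * g` is an integral of `g` against the blob vorticity. This is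
the passage from point vortices, whose concentration is not controlled, to the density that obeys
the decay hypothesis. -/
lemma IsBlob.sum_convolution_eq (hφ : IsBlob φ) {g : Plane → ℝ} (hg : Continuous g) {ε : ℝ}
    (hε : 0 < ε) {N : ℕ} (ξ : Fin N → ℝ) (X : Fin N → Plane) (x : Plane) :
    ∑ j, ξ j * ∫ y, φ y * g (ε⁻¹ • (x - X j) - y)
      = ∫ z, blobVorticity φ ε ξ X z * g (ε⁻¹ • (x - z)) := by
  have hgc : Continuous fun z => g (ε⁻¹ • (x - z)) := by fun_prop
  have h := hφ.integral_blobVorticity_smul (ξ := ξ) (X := X) hε hgc.locallyIntegrable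
  simp only [smul_eq_mul] at h
  rw [h]
  refine Finset.sum_congr rfl fun j _ => ?_
  congr 1
  have h1 := Measure.integral_comp_smul (volume : Measure Plane)
    (fun y => φ y * g (ε⁻¹ • (x - X j) - y)) ε⁻¹
  rw [finrank_plane, inv_pow, inv_inv, abs_of_pos (by positivity), smul_eq_mul] at h1
  have h2 := integral_sub_right_eq_self (μ := (volume : Measure Plane))
    (fun y => φ (ε⁻¹ • y) * g (ε⁻¹ • (x - X j) - ε⁻¹ • y)) (X j)
  rw [← h2] at h1
  have h3 : ∀ z, scaledBlob φ ε (z - X j) * g (ε⁻¹ • (x - z))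
      = (ε ^ 2)⁻¹ * (φ (ε⁻¹ • (z - X j)) * g (ε⁻¹ • (x - X j) - ε⁻¹ • (z - X j))) := fun z => by
    rw [scaledBlob, mul_assoc, ← smul_sub]
    congr 4
    abel
  simp only [h3]
  rw [integral_const_mul, h1, ← mul_assoc, inv_mul_cancel₀ (by positivity), one_mul]

lemma HasDecay.setIntegral_abs_le {ω : Plane → ℝ} {C α : ℝ} (h : HasDecay ω C α)
    (hω : Integrable ω) (hC : 0 ≤ C) (x : Plane) {r : ℝ} (hr : 0 < r) :
    ∫ z in Metric.closedBall x r, |ω z| ≤ C * r ^ α := by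
  have h1 := h x r hr
  have h2 := integral_norm_eq_lintegral_enorm
    (hω.integrableOn (s := Metric.closedBall x r)).aestronglyMeasurable
  simp only [Real.norm_eq_abs] at h2
  rw [h2]
  exact ENNReal.toReal_le_of_le_ofReal (by positivity) h1

/-- Within distance `ερ` of `x` the function is bounded by `B` and the mass by `C(ερ)^α`; farther
away the function is at most `δ` and the mass at most `M`. -/
lemma abs_integral_mul_comp_smul_le {ω g : Plane → ℝ} {C α M B δ ρ ε : ℝ} (hd : HasDecay ω C α)
    (hω : Integrable ω) (hC : 0 ≤ C) (hM : ∫ z, |ω z| ≤ M) (hB0 : 0 ≤ B) (hB : ∀ z, |g z| ≤ B)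
    (hδ : 0 ≤ δ) (hρ : 0 < ρ) (hρg : ∀ z, ρ < ‖z‖ → |g z| ≤ δ) (hε : 0 < ε) (x : Plane) :
    |∫ z, ω z * g (ε⁻¹ • (x - z))| ≤ B * (C * (ε * ρ) ^ α) + δ * M := by
  have hr : 0 < ε * ρ := by positivity
  have hI1 : Integrable fun z => B * (Metric.closedBall x (ε * ρ)).indicator (fun z => |ω z|) z :=
    (hω.abs.indicator Metric.isClosed_closedBall.measurableSet).const_mul B
  have hI2 : Integrable fun z => δ * |ω z| := hω.abs.const_mul δ
  have h1 : ∀ z, ‖ω z * g (ε⁻¹ • (x - z))‖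
      ≤ B * (Metric.closedBall x (ε * ρ)).indicator (fun z => |ω z|) z + δ * |ω z| := by
    intro z
    rw [norm_mul, Real.norm_eq_abs, Real.norm_eq_abs]
    by_cases hz : z ∈ Metric.closedBall x (ε * ρ)
    · rw [indicator_of_mem hz, mul_comm]
      have := mul_le_mul_of_nonneg_right (hB (ε⁻¹ • (x - z))) (abs_nonneg (ω z))
      have := mul_nonneg hδ (abs_nonneg (ω z))
      linarith
    · rw [indicator_of_notMem hz, mul_zero, zero_add, mul_comm]
      refine mul_le_mul_of_nonneg_right (hρg _ ?_) (abs_nonneg _)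
      rw [Metric.mem_closedBall, dist_comm, dist_eq_norm, not_le] at hz
      rw [norm_smul, norm_inv, Real.norm_of_nonneg hε.le, ← div_eq_inv_mul, lt_div_iff₀ hε,
        mul_comm]
      exact hz
  have h2 := norm_integral_le_of_norm_le (hI1.add hI2) (Eventually.of_forall h1)
  simp only [Pi.add_apply] at h2
  rw [Real.norm_eq_abs, integral_add hI1 hI2, integral_const_mul, integral_const_mul,
    integral_indicator Metric.isClosed_closedBall.measurableSet] at h2
  refine h2.trans ?_
  gcongr
  exact hd.setIntegral_abs_le hω hC x hr

/-- If the blob vorticities decay uniformly, sums of a rescaled function that vanishes at infinity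
become uniformly small. -/
lemma IsBlob.eventually_abs_sum_le (hφ : IsBlob φ) {P : Plane → ℝ} (hP : Continuous P)
    (hP0 : Tendsto P (cocompact Plane) (𝓝 0)) {C α M : ℝ} (hC : 0 ≤ C) (hα : 0 < α) (hM : 0 ≤ M)
    {δ : ℝ} (hδ : 0 < δ) :
    ∀ᶠ ε in 𝓝[>] (0 : ℝ), ∀ (N : ℕ) (ξ : Fin N → ℝ) (X : Fin N → Plane),
      ∑ j, |ξ j| ≤ M → HasDecay (blobVorticity φ ε ξ X) C α →
      ∀ x, |∑ j, ξ j * P (ε⁻¹ • (x - X j))| ≤ δ := by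
  -- Thirds of `δ`: one for replacing `P` by `φ * g`, one for the tail of `g`, one for the shrinking
  -- disc. The added `1` covers `M = 0`.
  set d := δ / (3 * (M + 1)) with hd
  have hd0 : 0 < d := by positivity
  have hdM : d * M ≤ δ / 3 := by
    rw [hd, div_mul_eq_mul_div, div_le_div_iff₀ (by positivity) (by norm_num)]
    nlinarith
  obtain ⟨g, hgc, hg0, hPg⟩ := hφ.exists_abs_sub_convolution_le hP hP0 hd0
  have hev : ∀ᶠ z in cocompact Plane, |g z| < d := by
    simpa [abs_lt, and_comm] using hg0.eventually (Metric.ball_mem_nhds 0 hd0)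
  obtain ⟨A, hA, hAs⟩ := mem_cocompact.1 hev
  obtain ⟨ρ, hρ, hρA⟩ := hA.isBounded.subset_closedBall_lt 0 0
  have hρg : ∀ z, ρ < ‖z‖ → |g z| ≤ d := fun z hz => by
    refine le_of_lt (hAs fun hzA => ?_)
    have := hρA hzA
    rw [mem_closedBall_zero_iff] at this
    linarith
  obtain ⟨B', hB'⟩ := (isCompact_closedBall (0:Plane) ρ).exists_bound_of_continuousOn
    hgc.continuousOn
  have hB : ∀ z, |g z| ≤ max B' d := fun z => by
    rcases le_or_gt ‖z‖ ρ with h | h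
    · exact (hB' z (by simpa using h)).trans (le_max_left _ _)
    · exact (hρg z h).trans (le_max_right _ _)
  set B := max B' d with hBdef
  have hB0 : 0 ≤ B := hd0.le.trans (le_max_right _ _)
  have hlim : Tendsto (fun ε : ℝ => B * (C * (ε * ρ) ^ α)) (𝓝[>] 0) (𝓝 0) := by
    have h1 : Continuous fun ε : ℝ => B * (C * (ε * ρ) ^ α) :=
      continuous_const.mul (continuous_const.mul
        ((continuous_id.mul continuous_const).rpow_const fun _ => Or.inr hα.le))
    have h2 := h1.tendsto 0
    rw [zero_mul, Real.zero_rpow hα.ne', mul_zero, mul_zero] at h2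
    exact h2.mono_left nhdsWithin_le_nhds
  filter_upwards [hlim.eventually (gt_mem_nhds (show 0 < δ / 3 by positivity)),
    self_mem_nhdsWithin] with ε hε1 hε N ξ X hξ hdec x
  have hε : 0 < ε := hε
  have hωi : Integrable (blobVorticity φ ε ξ X) := by
    unfold blobVorticity
    exact integrable_finsetSum _ fun j _ => (hφ.integrable_sub hε (X j)).const_mul _
  have h1 : ∑ j, ξ j * P (ε⁻¹ • (x - X j))
      = ∑ j, ξ j * (P (ε⁻¹ • (x - X j)) - ∫ y, φ y * g (ε⁻¹ • (x - X j) - y))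
        + ∫ z, blobVorticity φ ε ξ X z * g (ε⁻¹ • (x - z)) := by
    rw [← hφ.sum_convolution_eq hgc hε, ← Finset.sum_add_distrib]
    exact Finset.sum_congr rfl fun j _ => by ring
  have h2 : |∑ j, ξ j * (P (ε⁻¹ • (x - X j)) - ∫ y, φ y * g (ε⁻¹ • (x - X j) - y))| ≤ d * M := by
    refine (Finset.abs_sum_le_sum_abs _ _).trans ?_
    calc _ ≤ ∑ j, |ξ j| * d := Finset.sum_le_sum fun j _ => by
          rw [abs_mul]
          exact mul_le_mul_of_nonneg_left (hPg _) (abs_nonneg _)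
      _ ≤ d * M := by
          rw [← Finset.sum_mul, mul_comm]
          gcongr
  have h3 := abs_integral_mul_comp_smul_le hdec hωi hC
    ((hφ.integral_abs_blobVorticity_le hε).trans hξ) hB0 hB hd0.le hρ hρg hε x
  rw [h1]
  refine (abs_add_le _ _).trans ?_
  linarith

end VanishingSums

/-! ### Consistency of the vortex-blob dynamics -/

section Defect

variable {φ : Plane → ℝ} {ε : ℝ}

lemma hasFDerivAt_logKernel {x : Plane} (hx : x ≠ 0) :
    HasFDerivAt logKernel (innerSL ℝ (perp (bsKernel x))) x := by
  have h0 : ‖x‖ ^ 2 ≠ 0 := by simpa using hx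
  have h1 := (((hasStrictFDerivAt_norm_sq x).hasFDerivAt.log h0).const_mul (-(4 * Real.pi)⁻¹))
  have h2 : logKernel = fun y => -(4 * Real.pi)⁻¹ * Real.log (‖y‖ ^ 2) := by
    funext y
    rw [logKernel, Real.log_pow]
    have := Real.pi_ne_zero
    push_cast
    field_simp
    ring
  rw [h2]
  refine h1.congr_fderiv (ContinuousLinearMap.ext fun v => ?_)
  rw [perp_bsKernel]
  simp only [innerSL_apply_apply, inner_smul_left, smul_apply, smul_eq_mul, nsmul_eq_mul]
  have := Real.pi_ne_zero
  simp
  field_simp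
  ring

/-- Newton's theorem: near `x` the stream function of `η` is exactly the logarithmic kernel, so the
gradients agree; undoing the rotation gives the velocities. -/
lemma velocity_eq_bsKernel {η : Plane → ℝ} {r : ℝ} (hη : IsRadialDensity η r)
    (h1 : ContDiff ℝ 1 η) (hr : 0 ≤ r) {x : Plane} (hx : r < ‖x‖) :
    velocity η x = bsKernel x := by
  have hx0 : x ≠ 0 := norm_pos_iff.1 (hr.trans_lt hx)
  have he : stream η =ᶠ[𝓝 x] logKernel := by
    filter_upwards [continuous_norm.continuousAt.eventually (lt_mem_nhds hx)] with z hz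
    have hz0 : z ≠ 0 := norm_pos_iff.1 (hr.trans_lt hz)
    have h2 := hη.logKernel_sub hz0
    have h3 : Real.posLog (r * ‖z‖⁻¹) = 0 := by
      rw [Real.posLog_eq_zero_iff, abs_of_nonneg (by positivity), ← div_eq_mul_inv]
      exact div_le_one_of_le₀ hz.le (norm_nonneg z)
    rw [h3, mul_zero] at h2
    rw [stream_apply]
    linarith [h2.1, h2.2]
  have h4 := (hasFDerivAt_stream h1 hη.hasCompactSupport x).congr_of_eventuallyEq he.symm
  have h5 := h4.unique (hasFDerivAt_logKernel hx0)
  have h6 : perp (velocity η x) = perp (bsKernel x) := by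
    refine ext_inner_right ℝ fun v => ?_
    simpa using congrArg (fun A => A v) h5
  have h7 := congrArg perp h6
  rwa [perp_perp, perp_perp, neg_inj] at h7

/-- The difference between the kernel `K₁ = φ * K` and its mollification `φ * K₁`. -/
def kernelDefect (φ : Plane → ℝ) (z : Plane) : Plane :=
  velocity φ z - ∫ y, φ y • velocity φ (z - y)

lemma IsBlob.isRadialDensity_one (hφ : IsBlob φ) : IsRadialDensity φ 1 := by
  simpa [scaledBlob_one] using hφ.isRadialDensity one_pos

lemma IsBlob.contDiff_one (hφ : IsBlob φ) : ContDiff ℝ 1 φ := hφ.contDiff.of_le (by norm_num)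

lemma IsBlob.continuous_velocity (hφ : IsBlob φ) : Continuous (velocity φ) :=
  VortexBlob.continuous_velocity hφ.continuous hφ.hasCompactSupport

lemma IsBlob.continuous_kernelDefect (hφ : IsBlob φ) : Continuous (kernelDefect φ) := by
  refine hφ.continuous_velocity.sub ?_
  exact HasCompactSupport.continuous_convolution_left (𝕜 := ℝ) (ContinuousLinearMap.lsmul ℝ ℝ)
    hφ.hasCompactSupport hφ.continuous hφ.continuous_velocity.locallyIntegrable

lemma IsBlob.kernelDefect_neg (hφ : IsBlob φ) (z : Plane) :
    kernelDefect φ (-z) = -kernelDefect φ z := by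
  have h := hφ.isRadialDensity_one
  rw [kernelDefect, kernelDefect, h.velocity_neg, neg_sub', ← integral_neg_eq_self]
  congr 1
  rw [← integral_neg]
  refine integral_congr_ae (Eventually.of_forall fun y => ?_)
  simp only
  rw [h.neg, show -z - -y = -(z - y) by abel, h.velocity_neg, smul_neg]

/-- For `‖y‖ < 1` the point `z - y` stays outside the unit disc, where `K₁ = K`; averaging `K₁`
therefore reproduces `φ * K = K₁`. Compact support makes the moments of the defect vanish at
infinity. -/
lemma IsBlob.kernelDefect_eq_zero (hφ : IsBlob φ) {z : Plane} (hz : 2 ≤ ‖z‖) :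
    kernelDefect φ z = 0 := by
  have h : ∫ y, φ y • velocity φ (z - y) = velocity φ z := by
    rw [velocity_apply φ z]
    refine integral_congr_ae (Eventually.of_forall fun y => ?_)
    simp only
    rcases lt_or_ge ‖y‖ 1 with hy | hy
    · rw [velocity_eq_bsKernel hφ.isRadialDensity_one hφ.contDiff_one zero_le_one]
      have := norm_sub_norm_le z y
      linarith
    · rw [hφ.eq_zero hy, zero_smul, zero_smul]
  rw [kernelDefect, h, sub_self]

lemma IsBlob.integral_scaledBlob_smul_regKernel (hφ : IsBlob φ) (hε : 0 < ε) (p q : Plane) :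
    ∫ x, scaledBlob φ ε (x - p) • regKernel φ ε (x - q)
      = regKernel φ ε (p - q) - ε⁻¹ • kernelDefect φ (ε⁻¹ • (p - q)) := by
  have hη := hφ.isRadialDensity hε
  have h1 : ∫ x, scaledBlob φ ε (x - p) • regKernel φ ε (x - q)
      = ∫ y, scaledBlob φ ε y • regKernel φ ε (p - q - y) := by
    rw [← integral_sub_left_eq_self (fun y => scaledBlob φ ε y • regKernel φ ε (p - q - y))
      volume p]
    refine integral_congr_ae (Eventually.of_forall fun x => ?_)
    simp only
    rw [← hη.neg, neg_sub, show p - q - (p - x) = x - q by abel]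
  have h2 := Measure.integral_comp_smul (volume : Measure Plane)
    (fun y => φ y • velocity φ (ε⁻¹ • (p - q) - y)) ε⁻¹
  rw [finrank_plane, inv_pow, inv_inv, abs_of_pos (by positivity)] at h2
  have h3 : ∀ y, scaledBlob φ ε y • regKernel φ ε (p - q - y) = ((ε ^ 2)⁻¹ * ε⁻¹) •
      (φ (ε⁻¹ • y) • velocity φ (ε⁻¹ • (p - q) - ε⁻¹ • y)) := fun y => by
    rw [scaledBlob, regKernel_scaling φ hε, smul_sub ε⁻¹ (p - q) y, mul_smul, mul_smul,
      smul_comm ε⁻¹]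
  rw [h1]
  simp only [h3]
  rw [integral_smul, h2, smul_smul, regKernel_scaling φ hε, kernelDefect, ← smul_sub, sub_sub_cancel]
  congr 1
  field_simp

end Defect

/-! ### Smallness of the consistency error. -/

section Consistency

variable {φ : Plane → ℝ} {C α M : ℝ}

lemma abs_sum_smul_apply_le {N : ℕ} (ξ : Fin N → ℝ) (P : Plane → Plane) (Y : Fin N → Plane)
    (i : Fin 2) : (∑ j, ξ j • P (Y j)) i = ∑ j, ξ j * P (Y j) i := by
  simp

lemma norm_le_add_abs (v : Plane) : ‖v‖ ≤ |v 0| + |v 1| := by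
  conv_lhs => rw [plane_eq_sum v]
  refine (norm_add_le _ _).trans (le_of_eq ?_)
  simp [norm_smul]

lemma tendsto_velocity_cocompact {ω : Plane → ℝ} (hω : Continuous ω) (hs : HasCompactSupport ω) :
    Tendsto (velocity ω) (cocompact Plane) (𝓝 0) := by
  obtain ⟨c, hc0, hc⟩ := exists_velocity_bound_inv hω hs
  have h1 : Tendsto (fun x : Plane => c * ‖x‖⁻¹) (cocompact Plane) (𝓝 (c * 0)) :=
    (tendsto_inv_atTop_zero.comp (tendsto_norm_cocompact_atTop (E := Plane))).const_mul c
  rw [mul_zero] at h1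
  refine squeeze_zero_norm' ?_ h1
  filter_upwards [(tendsto_norm_cocompact_atTop (E := Plane)).eventually_gt_atTop 0] with x hx
  rw [← div_eq_mul_inv, le_div_iff₀ hx]
  exact (hc x).2

lemma tendsto_apply_cocompact {P : Plane → Plane} (hP : Tendsto P (cocompact Plane) (𝓝 0))
    (i : Fin 2) : Tendsto (fun x => P x i) (cocompact Plane) (𝓝 0) := by
  have := ((EuclideanSpace.proj (𝕜 := ℝ) i).continuous.tendsto (0 : Plane)).comp hP
  simpa using! this

/-- The velocity is `o(ε⁻¹)`, uniformly. -/
lemma IsBlob.eventually_mul_norm_blobVelocity_le (hφ : IsBlob φ) (hC : 0 ≤ C) (hα : 0 < α)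
    (hM : 0 ≤ M) {δ : ℝ} (hδ : 0 < δ) :
    ∀ᶠ ε in 𝓝[>] (0 : ℝ), ∀ (N : ℕ) (ξ : Fin N → ℝ) (X : Fin N → Plane),
      ∑ j, |ξ j| ≤ M → HasDecay (blobVorticity φ ε ξ X) C α →
      ∀ x, ε * ‖blobVelocity φ ε ξ X x‖ ≤ δ := by
  have hcont : ∀ i : Fin 2, Continuous fun x => velocity φ x i := fun i =>
    (EuclideanSpace.proj (𝕜 := ℝ) i).continuous.comp hφ.continuous_velocity
  filter_upwards [self_mem_nhdsWithin,
    hφ.eventually_abs_sum_le (hcont 0) (tendsto_apply_cocompact (tendsto_velocity_cocompact hφ.continuous hφ.hasCompactSupport) 0)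
      hC hα hM (half_pos hδ),
    hφ.eventually_abs_sum_le (hcont 1) (tendsto_apply_cocompact (tendsto_velocity_cocompact hφ.continuous hφ.hasCompactSupport) 1)
      hC hα hM (half_pos hδ)] with ε hε h0 h1 N ξ X hξ hd x
  have hε : 0 < ε := hε
  have h2 : ε • blobVelocity φ ε ξ X x = ∑ j, ξ j • velocity φ (ε⁻¹ • (x - X j)) := by
    simp only [blobVelocity, regKernel_scaling φ hε, Finset.smul_sum]
    refine Finset.sum_congr rfl fun j _ => ?_
    rw [smul_comm (ξ j), smul_inv_smul₀ hε.ne']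
  have h3 : ε * ‖blobVelocity φ ε ξ X x‖ = ‖ε • blobVelocity φ ε ξ X x‖ := by
    rw [norm_smul, Real.norm_of_nonneg hε.le]
  rw [h3, h2]
  refine (norm_le_add_abs _).trans ?_
  rw [abs_sum_smul_apply_le ξ (velocity φ) (fun j => ε⁻¹ • (x - X j)),
    abs_sum_smul_apply_le ξ (velocity φ) (fun j => ε⁻¹ • (x - X j))]
  linarith [h0 N ξ X hξ hd x, h1 N ξ X hξ hd x]

/-- The quadratic moments of the kernel defect are negligible. -/
lemma IsBlob.eventually_abs_defect_moment_le (hφ : IsBlob φ) (hC : 0 ≤ C) (hα : 0 < α)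
    (hM : 0 ≤ M) {δ : ℝ} (hδ : 0 < δ) :
    ∀ᶠ ε in 𝓝[>] (0 : ℝ), ∀ (N : ℕ) (ξ : Fin N → ℝ) (X : Fin N → Plane),
      ∑ j, |ξ j| ≤ M → HasDecay (blobVorticity φ ε ξ X) C α →
      ∀ (a b : Fin 2) (x : Plane), |∑ j, ξ j * ((ε⁻¹ • (x - X j)) b *
        kernelDefect φ (ε⁻¹ • (x - X j)) a)| ≤ δ := by
  have hcont : ∀ a b : Fin 2, Continuous fun z : Plane => z b * kernelDefect φ z a := fun a b =>
    (EuclideanSpace.proj (𝕜 := ℝ) b).continuous.mul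
      ((EuclideanSpace.proj (𝕜 := ℝ) a).continuous.comp hφ.continuous_kernelDefect)
  have h0 : ∀ a b : Fin 2, Tendsto (fun z : Plane => z b * kernelDefect φ z a)
      (cocompact Plane) (𝓝 0) := fun a b => by
    refine HasCompactSupport.is_zero_at_infty ?_
    refine HasCompactSupport.intro (isCompact_closedBall (0 : Plane) 2) fun x hx => ?_
    rw [hφ.kernelDefect_eq_zero (le_of_lt (by simpa using hx))]
    simp
  have h := fun a b => hφ.eventually_abs_sum_le (hcont a b) (h0 a b) hC hα hM hδ
  filter_upwards [eventually_all.2 fun a => eventually_all.2 (h a)] with ε hε N ξ X hξ hd a b x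
  exact hε a b N ξ X hξ hd x

lemma IsBlob.norm_integral_smul_le (hφ : IsBlob φ) {ε : ℝ} (hε : 0 < ε) {E : Type*}
    [NormedAddCommGroup E] [NormedSpace ℝ E] {h : Plane → E} {p : Plane} {B : ℝ}
    (hB : ∀ x, ‖x - p‖ ≤ ε → ‖h x‖ ≤ B) : ‖∫ x, scaledBlob φ ε (x - p) • h x‖ ≤ B := by
  have hη := hφ.isRadialDensity hε
  have h1 : ∫ x, scaledBlob φ ε (x - p) * B = B := by
    rw [integral_mul_const, integral_sub_right_eq_self (scaledBlob φ ε), hη.integral_eq_one,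
      one_mul]
  rw [← h1]
  refine norm_integral_le_of_norm_le ((hφ.integrable_sub hε p).mul_const B)
    (Eventually.of_forall fun x => ?_)
  rw [norm_smul, Real.norm_of_nonneg (hη.nonneg _)]
  rcases le_or_gt ‖x - p‖ ε with hx | hx
  · exact mul_le_mul_of_nonneg_left (hB x hx) (hη.nonneg _)
  · rw [hη.eq_zero _ hx, zero_mul, zero_mul]

lemma IsBlob.integral_scaledBlob_sub (hφ : IsBlob φ) {ε : ℝ} (hε : 0 < ε) (p : Plane) :
    ∫ x, scaledBlob φ ε (x - p) = 1 := by
  rw [integral_sub_right_eq_self (scaledBlob φ ε), (hφ.isRadialDensity hε).integral_eq_one]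

lemma IsBlob.integrable_scaledBlob_smul (hφ : IsBlob φ) {ε : ℝ} (hε : 0 < ε) {E : Type*}
    [NormedAddCommGroup E] [NormedSpace ℝ E] {g : Plane → E} (hg : Continuous g) (p : Plane) :
    Integrable fun x => scaledBlob φ ε (x - p) • g x :=
  hg.locallyIntegrable.integrable_smul_left_of_hasCompactSupport
    (hφ.contDiff_sub ε p).continuous (hφ.hasCompactSupport_sub hε p)

lemma IsBlob.norm_integral_smul_sub_le (hφ : IsBlob φ) {ε : ℝ} (hε : 0 < ε) {E : Type*}
    [NormedAddCommGroup E] [NormedSpace ℝ E] [CompleteSpace E] {g : Plane → E} (hg : Continuous g)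
    {p : Plane} {B : ℝ} (hB : ∀ x, ‖x - p‖ ≤ ε → ‖g x - g p‖ ≤ B) :
    ‖(∫ x, scaledBlob φ ε (x - p) • g x) - g p‖ ≤ B := by
  have h1 : (∫ x, scaledBlob φ ε (x - p) • g x) - g p
      = ∫ x, scaledBlob φ ε (x - p) • (g x - g p) := by
    simp only [smul_sub]
    rw [integral_sub (hφ.integrable_scaledBlob_smul hε hg p)
      ((hφ.integrable_sub hε p).smul_const _), integral_smul_const,
      hφ.integral_scaledBlob_sub hε, one_smul]
  rw [h1]
  exact hφ.norm_integral_smul_le hε hB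

lemma IsBlob.continuous_blobVelocity (hφ : IsBlob φ) {ε : ℝ} (hε : 0 < ε) {N : ℕ}
    (ξ : Fin N → ℝ) (X : Fin N → Plane) : Continuous (blobVelocity φ ε ξ X) := by
  unfold blobVelocity
  refine continuous_finsetSum _ fun j _ => Continuous.const_smul ?_ (ξ j)
  exact (VortexBlob.continuous_velocity (hφ.contDiff_scaledBlob ε).continuous
    (hφ.hasCompactSupport_scaledBlob hε)).comp (continuous_id.sub continuous_const)

/-- The mean velocity over a blob and the velocity at its centre differ by a sum of rescaled kernel
defects; the centre velocity is the one that moves the blob. -/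
lemma IsBlob.integral_scaledBlob_smul_blobVelocity (hφ : IsBlob φ) {ε : ℝ} (hε : 0 < ε) {N : ℕ}
    (ξ : Fin N → ℝ) (X : Fin N → Plane) (p : Plane) :
    ∫ x, scaledBlob φ ε (x - p) • blobVelocity φ ε ξ X x
      = blobVelocity φ ε ξ X p - ∑ k, ξ k • ε⁻¹ • kernelDefect φ (ε⁻¹ • (p - X k)) := by
  have hc : ∀ k, Continuous fun x => regKernel φ ε (x - X k) := fun k =>
    (VortexBlob.continuous_velocity (hφ.contDiff_scaledBlob ε).continuous
      (hφ.hasCompactSupport_scaledBlob hε)).comp (continuous_id.sub continuous_const)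
  simp only [blobVelocity, Finset.smul_sum]
  have hi : ∀ k, Integrable fun x => scaledBlob φ ε (x - p) • ξ k • regKernel φ ε (x - X k) :=
    fun k => hφ.integrable_scaledBlob_smul hε ((hc k).const_smul (ξ k)) p
  rw [integral_finsetSum _ fun k _ => hi k, ← Finset.sum_sub_distrib]
  refine Finset.sum_congr rfl fun k _ => ?_
  simp only [smul_comm _ (ξ k)]
  rw [integral_smul, hφ.integral_scaledBlob_smul_regKernel hε, smul_sub]

lemma inner_clm_plane (A : Plane →L[ℝ] Plane) (z w : Plane) :
    inner ℝ (A z) w = A (EuclideanSpace.single 0 1) 0 * (z 0 * w 0)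
      + A (EuclideanSpace.single 1 1) 0 * (z 1 * w 0)
      + A (EuclideanSpace.single 0 1) 1 * (z 0 * w 1)
      + A (EuclideanSpace.single 1 1) 1 * (z 1 * w 1) := by
  rw [clm_plane_apply A z, inner_plane]
  simp
  ring

lemma abs_clm_single_le (A : Plane →L[ℝ] Plane) (a b : Fin 2) :
    |A (EuclideanSpace.single b 1) a| ≤ ‖A‖ := by
  refine (PiLp.norm_apply_le (A (EuclideanSpace.single b 1)) a).trans ?_
  simpa using A.le_opNorm (EuclideanSpace.single b 1)

lemma abs_sum_inner_clm_le {N : ℕ} {ξ : Fin N → ℝ} {z w : Fin N → Plane} {d L : ℝ}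
    {A : Plane →L[ℝ] Plane} (hA : ‖A‖ ≤ L)
    (h : ∀ a b : Fin 2, |∑ j, ξ j * (z j b * w j a)| ≤ d) :
    |∑ j, ξ j * inner ℝ (A (z j)) (w j)| ≤ 4 * (L * d) := by
  have h1 : ∑ j, ξ j * inner ℝ (A (z j)) (w j)
      = A (EuclideanSpace.single 0 1) 0 * (∑ j, ξ j * (z j 0 * w j 0))
      + A (EuclideanSpace.single 1 1) 0 * (∑ j, ξ j * (z j 1 * w j 0))
      + A (EuclideanSpace.single 0 1) 1 * (∑ j, ξ j * (z j 0 * w j 1))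
      + A (EuclideanSpace.single 1 1) 1 * (∑ j, ξ j * (z j 1 * w j 1)) := by
    simp only [Finset.mul_sum, ← Finset.sum_add_distrib]
    refine Finset.sum_congr rfl fun j _ => ?_
    rw [inner_clm_plane]
    ring
  have h2 : ∀ a b : Fin 2, |A (EuclideanSpace.single b 1) a * ∑ j, ξ j * (z j b * w j a)|
      ≤ L * d := fun a b => by
    rw [abs_mul]
    exact mul_le_mul ((abs_clm_single_le A a b).trans hA) (h a b) (abs_nonneg _)
      ((norm_nonneg A).trans hA)
  rw [h1]
  have a1 := abs_le.1 (h2 0 0)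
  have a2 := abs_le.1 (h2 0 1)
  have a3 := abs_le.1 (h2 1 0)
  have a4 := abs_le.1 (h2 1 1)
  rw [abs_le]
  constructor <;> linarith [a1.1, a1.2, a2.1, a2.2, a3.1, a3.2, a4.1, a4.2]

/-- Second-order Taylor estimate for a map with Lipschitz derivative. -/
lemma norm_sub_sub_fderiv_le {f : Plane → Plane} {f' : Plane → Plane →L[ℝ] Plane}
    (hf : ∀ x, HasFDerivAt f (f' x) x) {L : ℝ} (hL : 0 ≤ L)
    (hL' : ∀ x y, ‖f' x - f' y‖ ≤ L * ‖x - y‖) (x y : Plane) :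
    ‖f x - f y - f' x (x - y)‖ ≤ L * ‖x - y‖ ^ 2 := by
  have h := (convex_segment x y).norm_image_sub_le_of_norm_hasFDerivWithin_le' (f := f) (f' := f')
    (φ := f' x) (C := L * ‖x - y‖) (fun z _ => (hf z).hasFDerivWithinAt) (fun z hz => ?_)
    (right_mem_segment ℝ x y) (left_mem_segment ℝ x y)
  · rw [sq, ← mul_assoc]
    exact h
  · refine (hL' z x).trans ?_
    gcongr
    rw [← dist_eq_norm, ← dist_eq_norm]
    have := dist_add_dist_of_mem_segment hz
    rw [dist_comm z x]
    linarith [dist_nonneg (x := z) (y := y)]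

/-- The factor `ε⁻¹` must be compensated. The defect is odd, so symmetrization produces `f(Xⱼ) -
f(Xₖ)`. Its linear part absorbs `ε⁻¹` and leaves the quadratic moments of the defect, which tend to
zero; the Taylor remainder is quadratic in `Xⱼ - Xₖ` and contributes `O(ε)`, since the defect lives
at distances at most `2ε`. -/
lemma IsBlob.eventually_abs_sum_inner_defect_le (hφ : IsBlob φ) (hC : 0 ≤ C) (hα : 0 < α)
    (hM : 0 ≤ M) {L L₂ : ℝ} (hL : 0 ≤ L) (hL₂ : 0 ≤ L₂) {δ : ℝ} (hδ : 0 < δ) :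
    ∀ᶠ ε in 𝓝[>] (0 : ℝ), ∀ (N : ℕ) (ξ : Fin N → ℝ) (X : Fin N → Plane),
      ∑ j, |ξ j| ≤ M → HasDecay (blobVorticity φ ε ξ X) C α →
      ∀ (f : Plane → Plane) (f' : Plane → Plane →L[ℝ] Plane), (∀ x, HasFDerivAt f (f' x) x) →
      (∀ x, ‖f' x‖ ≤ L) → (∀ x y, ‖f' x - f' y‖ ≤ L₂ * ‖x - y‖) →
      |∑ j, ξ j * inner ℝ (f (X j)) (∑ k, ξ k • ε⁻¹ • kernelDefect φ (ε⁻¹ • (X j - X k)))|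
        ≤ δ := by
  obtain ⟨B, hB⟩ := (isCompact_closedBall (0 : Plane) 2).exists_bound_of_continuousOn
    hφ.continuous_kernelDefect.continuousOn
  have hB0 : 0 ≤ B := (norm_nonneg _).trans (hB 0 (by simp))
  have hBz : ∀ z, ‖z‖ ^ 2 * ‖kernelDefect φ z‖ ≤ 4 * B := fun z => by
    rcases le_or_gt ‖z‖ 2 with hz | hz
    · have h1 := hB z (by simpa using hz)
      have h2 : ‖z‖ ^ 2 ≤ 2 ^ 2 := by gcongr
      calc _ ≤ 2 ^ 2 * B := by gcongr
        _ = _ := by norm_num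
    · rw [hφ.kernelDefect_eq_zero hz.le, norm_zero, mul_zero]
      positivity
  -- Four matrix entries, each bounded by `L`, summed against mass `M`; the added `1` keeps the
  -- denominator positive.
  set d := δ / (4 * (M * L + 1)) with hd
  have hML : 0 ≤ M * L := by positivity
  have hd0 : 0 < d := by positivity
  have hd1 : M * (4 * (L * d)) ≤ δ := by
    have : d * (4 * (M * L + 1)) = δ := div_mul_cancel₀ _ (by positivity)
    nlinarith
  have hlim : ∀ᶠ ε in 𝓝[>] (0 : ℝ), M ^ 2 * (L₂ * (4 * B)) * ε < δ := by
    have h1 : Continuous fun ε : ℝ => M ^ 2 * (L₂ * (4 * B)) * ε := by fun_prop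
    have h2 := h1.tendsto 0
    rw [mul_zero] at h2
    exact (h2.mono_left nhdsWithin_le_nhds).eventually (gt_mem_nhds hδ)
  filter_upwards [self_mem_nhdsWithin, hlim,
    hφ.eventually_abs_defect_moment_le hC hα hM hd0] with ε hε hε1 hmom N ξ X hξ hdec f f' hf hf1 hf2
  have hε : 0 < ε := hε
  have hS0 : 0 ≤ ∑ j, |ξ j| := Finset.sum_nonneg fun j _ => abs_nonneg _
  set κ : Plane → Plane := fun z => ε⁻¹ • kernelDefect φ (ε⁻¹ • z) with hκ
  have hodd : ∀ z, κ (-z) = -κ z := fun z => by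
    simp only [hκ, smul_neg, hφ.kernelDefect_neg]
  have h1 : ∑ j, ξ j * inner ℝ (f (X j)) (∑ k, ξ k • ε⁻¹ • kernelDefect φ (ε⁻¹ • (X j - X k)))
      = ∑ j, ∑ k, ξ j * ξ k * inner ℝ (f (X j)) (κ (X j - X k)) := by
    simp only [inner_sum, inner_smul_right, Finset.mul_sum, mul_assoc, hκ]
  have h2 : ∀ j k, ξ j * ξ k * inner ℝ (f (X j) - f (X k)) (κ (X j - X k))
      = ξ j * (ξ k * inner ℝ (f' (X j) (ε⁻¹ • (X j - X k))) (kernelDefect φ (ε⁻¹ • (X j - X k))))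
        + ξ j * ξ k * inner ℝ (f (X j) - f (X k) - f' (X j) (X j - X k)) (κ (X j - X k)) := by
    intro j k
    rw [inner_sub_left (f (X j) - f (X k))]
    simp only [hκ, inner_smul_right, map_smul, inner_smul_left]
    simp
    ring
  have h3 : |∑ j, ξ j * ∑ k, ξ k * inner ℝ (f' (X j) (ε⁻¹ • (X j - X k)))
      (kernelDefect φ (ε⁻¹ • (X j - X k)))| ≤ M * (4 * (L * d)) := by
    refine (Finset.abs_sum_le_sum_abs _ _).trans ?_
    calc _ ≤ ∑ j, |ξ j| * (4 * (L * d)) := Finset.sum_le_sum fun j _ => by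
          rw [abs_mul]
          exact mul_le_mul_of_nonneg_left (abs_sum_inner_clm_le (hf1 (X j))
            fun a b => hmom N ξ X hξ hdec a b (X j)) (abs_nonneg _)
      _ ≤ M * (4 * (L * d)) := by
          rw [← Finset.sum_mul]
          gcongr
  have h4 := sum_sum_abs_le (ξ := ξ)
    (fun j k => inner ℝ (f (X j) - f (X k) - f' (X j) (X j - X k)) (κ (X j - X k)))
    (B := L₂ * (4 * B) * ε) fun j k => by
      refine (abs_real_inner_le_norm _ _).trans ?_
      have h5 := norm_sub_sub_fderiv_le hf hL₂ hf2 (X j) (X k)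
      have h6 := hBz (ε⁻¹ • (X j - X k))
      rw [norm_smul, norm_inv, Real.norm_of_nonneg hε.le] at h6
      have h7 : ‖κ (X j - X k)‖ = ε⁻¹ * ‖kernelDefect φ (ε⁻¹ • (X j - X k))‖ := by
        simp only [hκ, norm_smul, norm_inv, Real.norm_of_nonneg hε.le]
      rw [h7]
      calc _ ≤ L₂ * ‖X j - X k‖ ^ 2 * (ε⁻¹ * ‖kernelDefect φ (ε⁻¹ • (X j - X k))‖) := by gcongr
        _ = L₂ * ((ε⁻¹ * ‖X j - X k‖) ^ 2 * ‖kernelDefect φ (ε⁻¹ • (X j - X k))‖) * ε := by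
          field_simp
        _ ≤ L₂ * (4 * B) * ε := by gcongr
  have h8 : (∑ j, |ξ j|) ^ 2 * (L₂ * (4 * B) * ε) ≤ δ := by
    calc _ ≤ M ^ 2 * (L₂ * (4 * B) * ε) := by gcongr
      _ ≤ δ := by linarith
  rw [h1, sum_inner_odd_symm hodd]
  simp only [h2, Finset.sum_add_distrib, ← Finset.mul_sum]
  rw [abs_mul, abs_of_pos (by norm_num)]
  have h9 := abs_add_le (∑ j, ξ j * ∑ k, ξ k * inner ℝ (f' (X j) (ε⁻¹ • (X j - X k)))
      (kernelDefect φ (ε⁻¹ • (X j - X k)))) (∑ j, ∑ k, ξ j * ξ k *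
        inner ℝ (f (X j) - f (X k) - f' (X j) (X j - X k)) (κ (X j - X k)))
  linarith

/-- The vortex-blob dynamics is consistent with the vorticity formulation of the Euler
equations. -/
lemma IsBlob.eventually_abs_consistency_le (hφ : IsBlob φ) (hC : 0 ≤ C) (hα : 0 < α)
    (hM : 0 ≤ M) {L L₂ : ℝ} (hL : 0 ≤ L) (hL₂ : 0 ≤ L₂) {δ : ℝ} (hδ : 0 < δ) :
    ∀ᶠ ε in 𝓝[>] (0 : ℝ), ∀ (N : ℕ) (ξ : Fin N → ℝ) (X : Fin N → Plane),
      ∑ j, |ξ j| ≤ M → HasDecay (blobVorticity φ ε ξ X) C α →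
      ∀ (f : Plane → Plane) (f' : Plane → Plane →L[ℝ] Plane), (∀ x, HasFDerivAt f (f' x) x) →
      (∀ x, ‖f' x‖ ≤ L) → (∀ x y, ‖f' x - f' y‖ ≤ L₂ * ‖x - y‖) →
      |(∑ j, ξ j * inner ℝ (∫ y, scaledBlob φ ε (y - X j) • f y) (blobVelocity φ ε ξ X (X j)))
        - ∫ x, blobVorticity φ ε ξ X x * inner ℝ (f x) (blobVelocity φ ε ξ X x)| ≤ δ := by
  set d := δ / (4 * (M * L + 1)) with hd
  have hML : 0 ≤ M * L := by positivity
  have hd0 : 0 < d := by positivity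
  have hd1 : M * (2 * (L * d)) ≤ δ / 2 := by
    have : d * (4 * (M * L + 1)) = δ := div_mul_cancel₀ _ (by positivity)
    nlinarith
  filter_upwards [self_mem_nhdsWithin, hφ.eventually_mul_norm_blobVelocity_le hC hα hM hd0,
    hφ.eventually_abs_sum_inner_defect_le hC hα hM hL hL₂ (half_pos hδ)]
    with ε hε hvel hdef N ξ X hξ hdec f f' hf hf1 hf2
  have hε : 0 < ε := hε
  set u := blobVelocity φ ε ξ X with hu
  have huc : Continuous u := hφ.continuous_blobVelocity hε ξ X
  have hfc : Continuous f := continuous_iff_continuousAt.2 fun x => (hf x).continuousAt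
  have hfL : ∀ x y, ‖f x - f y‖ ≤ L * ‖x - y‖ := fun x y =>
    convex_univ.norm_image_sub_le_of_norm_hasFDerivWithin_le (𝕜 := ℝ) (fun z _ => (hf z).hasFDerivWithinAt)
      (fun z _ => hf1 z) (mem_univ y) (mem_univ x)
  have hvel' : ∀ x, ε * ‖u x‖ ≤ d := hvel N ξ X hξ hdec
  have hint := hφ.integral_blobVorticity_smul (ξ := ξ) (X := X) hε
    (hfc.inner huc : Continuous fun x => inner ℝ (f x) (u x)).locallyIntegrable
  simp only [smul_eq_mul] at hint
  -- Three errors: replacing the blob mean of `f` by its value at the centre, the variation of `f`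
  -- over the blob against `u`, and the difference between `u(Xⱼ)` and the blob mean of `u`. The
  -- first two are at most `L ε |u|`, small because `u = o(ε⁻¹)`; the third is the kernel defect.
  have hdecomp : ∀ j, inner ℝ (∫ y, scaledBlob φ ε (y - X j) • f y) (u (X j))
        - ∫ x, scaledBlob φ ε (x - X j) * inner ℝ (f x) (u x)
      = inner ℝ ((∫ y, scaledBlob φ ε (y - X j) • f y) - f (X j)) (u (X j))
        - (∫ x, scaledBlob φ ε (x - X j) • inner ℝ (f x - f (X j)) (u x))
        + inner ℝ (f (X j)) (∑ k, ξ k • ε⁻¹ • kernelDefect φ (ε⁻¹ • (X j - X k))) := by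
    intro j
    have h1 := hφ.integral_scaledBlob_smul_blobVelocity hε ξ X (X j)
    rw [← hu] at h1
    have h2 : ∫ x, scaledBlob φ ε (x - X j) • inner ℝ (f x - f (X j)) (u x)
        = (∫ x, scaledBlob φ ε (x - X j) * inner ℝ (f x) (u x))
          - inner ℝ (f (X j)) (∫ x, scaledBlob φ ε (x - X j) • u x) := by
      rw [← integral_inner (hφ.integrable_scaledBlob_smul hε huc (X j)), ← integral_sub]
      · refine integral_congr_ae (Eventually.of_forall fun x => ?_)
        simp only [inner_sub_left, inner_smul_right, smul_eq_mul]
        ring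
      · exact hφ.integrable_scaledBlob_smul hε (hfc.inner huc) (X j)
      · exact (hφ.integrable_scaledBlob_smul hε huc (X j)).const_inner _
    rw [h2, h1, inner_sub_left, inner_sub_right]
    ring
  have hbound : ∀ j, |inner ℝ ((∫ y, scaledBlob φ ε (y - X j) • f y) - f (X j)) (u (X j))
        - ∫ x, scaledBlob φ ε (x - X j) • inner ℝ (f x - f (X j)) (u x)| ≤ 2 * (L * d) := by
    intro j
    have h1 : ‖(∫ y, scaledBlob φ ε (y - X j) • f y) - f (X j)‖ ≤ L * ε :=
      hφ.norm_integral_smul_sub_le hε hfc fun x hx => (hfL x _).trans (by gcongr)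
    have h2 : |inner ℝ ((∫ y, scaledBlob φ ε (y - X j) • f y) - f (X j)) (u (X j))| ≤ L * d := by
      refine (abs_real_inner_le_norm _ _).trans ?_
      calc _ ≤ (L * ε) * ‖u (X j)‖ := by gcongr
        _ = L * (ε * ‖u (X j)‖) := by ring
        _ ≤ L * d := by gcongr; exact hvel' _
    have h3 : |∫ x, scaledBlob φ ε (x - X j) • inner ℝ (f x - f (X j)) (u x)| ≤ L * d := by
      refine hφ.norm_integral_smul_le (E := ℝ) hε fun x hx => ?_
      refine (abs_real_inner_le_norm _ _).trans ?_
      calc _ ≤ (L * ε) * ‖u x‖ := by gcongr; exact (hfL x _).trans (by gcongr)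
        _ = L * (ε * ‖u x‖) := by ring
        _ ≤ L * d := by gcongr; exact hvel' _
    have := abs_sub (inner ℝ ((∫ y, scaledBlob φ ε (y - X j) • f y) - f (X j)) (u (X j)))
      (∫ x, scaledBlob φ ε (x - X j) • inner ℝ (f x - f (X j)) (u x))
    linarith
  rw [hint, ← Finset.sum_sub_distrib]
  simp only [← mul_sub, hdecomp]
  simp only [mul_add, Finset.sum_add_distrib]
  refine (abs_add_le _ _).trans ?_
  have h5 : |∑ j, ξ j * (inner ℝ ((∫ y, scaledBlob φ ε (y - X j) • f y) - f (X j)) (u (X j))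
        - ∫ x, scaledBlob φ ε (x - X j) • inner ℝ (f x - f (X j)) (u x))|
      ≤ M * (2 * (L * d)) := by
    refine (Finset.abs_sum_le_sum_abs _ _).trans ?_
    calc _ ≤ ∑ j, |ξ j| * (2 * (L * d)) := Finset.sum_le_sum fun j _ => by
          rw [abs_mul]
          exact mul_le_mul_of_nonneg_left (hbound j) (abs_nonneg _)
      _ ≤ M * (2 * (L * d)) := by
          rw [← Finset.sum_mul]
          gcongr
  have h6 := hdef N ξ X hξ hdec f f' hf hf1 hf2
  linarith

end Consistency

/-! ### Integration by parts -/

section IBP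

/-- In the plane the antisymmetric part of a matrix is a multiple of the rotation; for a velocity
gradient the coefficient is the vorticity. -/
lemma inner_clm_plane_swap (A : Plane →L[ℝ] Plane) (v a : Plane) :
    inner ℝ (A v) a = inner ℝ v (A a)
      + (A (EuclideanSpace.single 0 1) 1 - A (EuclideanSpace.single 1 1) 0) * inner ℝ (perp v) a := by
  rw [inner_clm_plane, real_inner_comm, inner_clm_plane, inner_plane, perp_apply_zero,
    perp_apply_one]
  ring

lemma integrable_mul_of_hasCompactSupport {a b : Plane → ℝ} (ha : Continuous a)
    (hb : Continuous b) (h : HasCompactSupport a ∨ HasCompactSupport b) :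
    Integrable fun x => a x * b x := by
  refine (ha.mul hb).integrable_of_hasCompactSupport ?_
  rcases h with h | h
  · exact h.mul_right
  · exact h.mul_left

lemma integral_fderiv_apply_eq {g : Plane → ℝ} {V : Plane → Plane} (hg : ContDiff ℝ 1 g)
    (hV : ContDiff ℝ 1 V) (h : HasCompactSupport g ∨ HasCompactSupport V) :
    ∫ x, fderiv ℝ g x (V x) = -∫ x, g x * divergence V x := by
  have hVi : ∀ i : Fin 2, ContDiff ℝ 1 fun x => V x i := fun i =>
    (EuclideanSpace.proj (𝕜 := ℝ) i).contDiff.comp hV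
  have hVs : ∀ i : Fin 2, HasCompactSupport V → HasCompactSupport fun x => V x i := fun i hs =>
    hs.comp_left (g := fun z : Plane => z i) rfl
  have hfd : ∀ (i : Fin 2) x v, fderiv ℝ (fun x => V x i) x v = fderiv ℝ V x v i := by
    intro i x v
    have h1 := (EuclideanSpace.proj (𝕜 := ℝ) i).hasFDerivAt.comp x
      (hV.differentiable one_ne_zero x).hasFDerivAt
    have h2 := h1.fderiv
    exact congrArg (fun A => A v) h2
  have h1 : ∀ (i : Fin 2) v, Integrable fun x => V x i * fderiv ℝ g x v := fun i v =>
    integrable_mul_of_hasCompactSupport (hVi i).continuous (continuous_fderiv_apply hg v)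
      (h.symm.imp (hVs i) fun h => hasCompactSupport_fderiv_apply h v)
  have h2 : ∀ (i : Fin 2) v, Integrable fun x => g x * fderiv ℝ (fun x => V x i) x v := fun i v =>
    integrable_mul_of_hasCompactSupport hg.continuous (continuous_fderiv_apply (hVi i) v)
      (h.imp_right fun h => hasCompactSupport_fderiv_apply (hVs i h) v)
  have h3 : ∀ i : Fin 2, Integrable fun x => V x i * g x := fun i =>
    integrable_mul_of_hasCompactSupport (hVi i).continuous hg.continuous (h.symm.imp_left (hVs i))
  have h4 : ∀ (i : Fin 2) v, ∫ x, V x i * fderiv ℝ g x v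
      = -∫ x, g x * fderiv ℝ (fun x => V x i) x v := fun i v => by
    rw [integral_mul_fderiv_eq_neg_fderiv_mul_of_integrable
      (by simpa only [mul_comm] using h2 i v) (h1 i v) (h3 i)
      (fun x _ => (hVi i).differentiable one_ne_zero x)
      (fun x _ => hg.differentiable one_ne_zero x)]
    simp only [mul_comm]
  have h5 : ∀ x, fderiv ℝ g x (V x) = V x 0 * fderiv ℝ g x (EuclideanSpace.single 0 1)
      + V x 1 * fderiv ℝ g x (EuclideanSpace.single 1 1) := fun x => by
    rw [clm_plane_apply]; rfl
  simp only [h5, divergence_eq, ← hfd, mul_add]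
  rw [integral_add (h1 0 _) (h1 1 _), integral_add (h2 0 _) (h2 1 _), h4, h4]
  ring

/-- Velocity fields are divergence free in the sense of distributions. -/
lemma integral_fderiv_velocity_eq_zero {ω g : Plane → ℝ} (hω : ContDiff ℝ 1 ω)
    (hc : HasCompactSupport ω) (hg : ContDiff ℝ 1 g) (hgc : HasCompactSupport g) :
    ∫ x, fderiv ℝ g x (velocity ω x) = 0 := by
  rw [integral_fderiv_apply_eq hg (contDiff_velocity (n := 1) hω hc) (Or.inl hgc)]
  simp [divergence_velocity hω hc]

/-- For constant `v`, the derivative of `w` along `v` is `∇(v·w)` plus a vorticity term. The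
gradient integrates to zero against a divergence-free field. Taken with the blob velocity as `v`,
this computes the effect of moving a single blob. -/
lemma integral_inner_fderiv_velocity {ω : Plane → ℝ} {V : Plane → Plane} (hω : ContDiff ℝ 1 ω)
    (hc : HasCompactSupport ω) (hV : ContDiff ℝ 1 V) (hVc : HasCompactSupport V)
    (hdiv : ∀ x, divergence V x = 0) (v : Plane) :
    ∫ x, inner ℝ (fderiv ℝ (velocity ω) x v) (V x) = -inner ℝ (∫ x, ω x • perp (V x)) v := by
  set w := velocity ω with hw
  have hwc : ContDiff ℝ 1 w := contDiff_velocity (n := 1) hω hc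
  have hg : ContDiff ℝ 1 fun x => inner ℝ v (w x) := contDiff_const.inner ℝ hwc
  have hi : Integrable fun x => ω x • perp (V x) := by
    refine Continuous.integrable_of_hasCompactSupport ?_ hc.smul_right
    exact hω.continuous.smul (continuous_perp.comp hV.continuous)
  have h1 : ∀ x, inner ℝ (fderiv ℝ w x v) (V x)
      = fderiv ℝ (fun x => inner ℝ v (w x)) x (V x) - inner ℝ v (ω x • perp (V x)) := fun x => by
    have h2 : HasFDerivAt (fun x => inner ℝ v (w x)) ((innerSL ℝ v).comp (fderiv ℝ w x)) x :=
      (innerSL ℝ v).hasFDerivAt.comp x (hwc.differentiable one_ne_zero x).hasFDerivAt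
    rw [h2.fderiv, inner_clm_plane_swap, hw, curl_velocity hω hc, inner_perp_left,
      inner_smul_right]
    simp
    ring
  simp only [h1]
  rw [integral_sub, integral_fderiv_apply_eq hg hV (Or.inr hVc), integral_inner hi,
    real_inner_comm]
  · simp [hdiv]
  · refine Continuous.integrable_of_hasCompactSupport ?_ ?_
    · exact (hg.continuous_fderiv one_ne_zero).clm_apply hV.continuous
    · exact hVc.mono fun x hx hx' => hx (by simp only [hx', map_zero])
  · exact hi.const_inner v

/-- Weak form of `(u·∇)u = ∇(|u|²/2) + ω u^⊥`: two gradient-type integrals vanish, because `u` and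
`V` are both divergence free, and the vorticity term remains. -/
lemma integral_inner_fderiv_self {ω : Plane → ℝ} {V : Plane → Plane} (hω : ContDiff ℝ 1 ω)
    (hc : HasCompactSupport ω) (hV : ContDiff ℝ 1 V) (hVc : HasCompactSupport V)
    (hdiv : ∀ x, divergence V x = 0) :
    ∫ x, inner ℝ (velocity ω x) (fderiv ℝ V x (velocity ω x))
      = ∫ x, ω x * inner ℝ (perp (V x)) (velocity ω x) := by
  set u := velocity ω with hu
  have huc : ContDiff ℝ 1 u := contDiff_velocity (n := 1) hω hc
  have hg : ContDiff ℝ 1 fun x => inner ℝ (u x) (V x) := huc.inner ℝ hV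
  have hgc : HasCompactSupport fun x => inner ℝ (u x) (V x) :=
    hVc.mono fun x hx hx' => hx (by simp only [hx', inner_zero_right])
  have hq : ContDiff ℝ 1 fun x => inner ℝ (u x) (u x) := huc.inner ℝ huc
  have h1 := integral_fderiv_velocity_eq_zero hω hc hg hgc
  have h2 := integral_fderiv_apply_eq hq hV (Or.inr hVc)
  simp only [hdiv, mul_zero, integral_zero, neg_zero] at h2
  have hd : ∀ x, HasFDerivAt u (fderiv ℝ u x) x := fun x =>
    (huc.differentiable one_ne_zero x).hasFDerivAt
  have hdV : ∀ x, HasFDerivAt V (fderiv ℝ V x) x := fun x =>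
    (hV.differentiable one_ne_zero x).hasFDerivAt
  have h3 : ∀ x, inner ℝ (u x) (fderiv ℝ V x (u x)) - ω x * inner ℝ (perp (V x)) (u x)
      = fderiv ℝ (fun x => inner ℝ (u x) (V x)) x (u x)
        - 2⁻¹ * fderiv ℝ (fun x => inner ℝ (u x) (u x)) x (V x) := fun x => by
    rw [((hd x).inner ℝ (hdV x)).fderiv, ((hd x).inner ℝ (hd x)).fderiv]
    simp only [ContinuousLinearMap.comp_apply, ContinuousLinearMap.prod_apply, fderivInnerCLM_apply]
    have e1 : inner ℝ (perp (V x)) (u x) = inner ℝ (u x) (perp (V x)) := real_inner_comm _ _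
    have e2 : inner ℝ (fderiv ℝ u x (V x)) (u x) = inner ℝ (u x) (fderiv ℝ u x (V x)) :=
      real_inner_comm _ _
    rw [inner_clm_plane_swap (fderiv ℝ u x) (u x) (V x), curl_velocity hω hc,
      inner_perp_left (u x), e1, e2]
    ring
  have hi1 : Integrable fun x => inner ℝ (u x) (fderiv ℝ V x (u x)) := by
    refine Continuous.integrable_of_hasCompactSupport ?_ ?_
    · exact huc.continuous.inner ((hV.continuous_fderiv one_ne_zero).clm_apply huc.continuous)
    · exact (hVc.fderiv ℝ).mono fun x hx hx' => hx (by simp only [hx']; simp)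
  have hi2 : Integrable fun x => ω x * inner ℝ (perp (V x)) (u x) := by
    refine Continuous.integrable_of_hasCompactSupport ?_ hc.mul_right
    exact hω.continuous.mul ((continuous_perp.comp hV.continuous).inner huc.continuous)
  have hi3 : Integrable fun x => fderiv ℝ (fun x => inner ℝ (u x) (V x)) x (u x) := by
    refine Continuous.integrable_of_hasCompactSupport ?_ ?_
    · exact (hg.continuous_fderiv one_ne_zero).clm_apply huc.continuous
    · exact (hgc.fderiv ℝ).mono fun x hx hx' => hx (by simp only [hx']; simp)
  have hi4 : Integrable fun x => fderiv ℝ (fun x => inner ℝ (u x) (u x)) x (V x) := by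
    refine Continuous.integrable_of_hasCompactSupport ?_ ?_
    · exact (hq.continuous_fderiv one_ne_zero).clm_apply hV.continuous
    · exact hVc.mono fun x hx hx' => hx (by simp only [hx', map_zero])
  rw [← sub_eq_zero, ← integral_sub hi1 hi2]
  simp only [h3]
  rw [integral_sub hi3 (hi4.const_mul _), integral_const_mul, h1, h2]
  simp

end IBP

/-! ### Test fields -/

section TestField

variable {T : ℝ} {Φ : ℝ → Plane → Plane}

lemma IsTestField.contDiff_slice (h : IsTestField T Φ) (t : ℝ) :
    ContDiff ℝ (⊤ : ℕ∞) (Φ t) :=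
  h.contDiff.comp (contDiff_const.prodMk contDiff_id)

lemma IsTestField.exists_radius (h : IsTestField T Φ) :
    ∃ ρ, 0 < ρ ∧ ∀ t x, ρ < ‖x‖ → Φ t x = 0 := by
  obtain ⟨ρ, hρ, hs⟩ := h.compactSupport.isCompact.isBounded.subset_closedBall_lt 0 0
  refine ⟨ρ, hρ, fun t x hx => ?_⟩
  by_contra hne
  have h1 : ((t, x) : ℝ × Plane) ∈ Metric.closedBall 0 ρ := hs (subset_tsupport _ hne)
  rw [mem_closedBall_zero_iff, Prod.norm_def] at h1
  exact absurd ((le_max_right _ _).trans h1) (not_le.2 hx)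

lemma IsTestField.hasCompactSupport_slice (h : IsTestField T Φ) (t : ℝ) :
    HasCompactSupport (Φ t) := by
  obtain ⟨ρ, hρ, hs⟩ := h.exists_radius
  exact HasCompactSupport.intro (isCompact_closedBall (0 : Plane) ρ) fun x hx =>
    hs t x (by simpa using hx)

lemma IsTestField.eq_zero (h : IsTestField T Φ) {t : ℝ} (ht : T ≤ t) (x : Plane) : Φ t x = 0 := by
  by_contra hne
  have h1 := h.support_subset (subset_tsupport (Function.uncurry Φ) (show (t, x) ∈ _ from hne))
  exact absurd h1.1 (not_lt.2 ht)

lemma IsTestField.hasFDerivAt (h : IsTestField T Φ) (p : ℝ × Plane) :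
    HasFDerivAt (Function.uncurry Φ) (fderiv ℝ (Function.uncurry Φ) p) p :=
  (h.contDiff.differentiable (by simp) p).hasFDerivAt

lemma IsTestField.hasFDerivAt_slice (h : IsTestField T Φ) (t : ℝ) (x : Plane) :
    HasFDerivAt (Φ t) ((fderiv ℝ (Function.uncurry Φ) (t, x)).comp
      (ContinuousLinearMap.inr ℝ ℝ Plane)) x :=
  (h.hasFDerivAt (t, x)).comp x (hasFDerivAt_prodMk_right t x)

lemma IsTestField.hasDerivAt_time (h : IsTestField T Φ) (t : ℝ) (x : Plane) :
    HasDerivAt (fun s => Φ s x) (fderiv ℝ (Function.uncurry Φ) (t, x) (1, 0)) t := by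
  have h1 := ((h.hasFDerivAt (t, x)).comp t (hasFDerivAt_prodMk_left t x)).hasDerivAt
  simpa using! h1

lemma IsTestField.continuous_fderiv (h : IsTestField T Φ) :
    Continuous (fderiv ℝ (Function.uncurry Φ)) := h.contDiff.continuous_fderiv (by simp)

lemma IsTestField.continuous_deriv (h : IsTestField T Φ) :
    Continuous fun p : ℝ × Plane => deriv (fun s => Φ s p.2) p.1 := by
  have h1 : (fun p : ℝ × Plane => deriv (fun s => Φ s p.2) p.1)
      = fun p => fderiv ℝ (Function.uncurry Φ) p (1, 0) := by
    funext p
    exact (h.hasDerivAt_time p.1 p.2).deriv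
  rw [h1]
  exact h.continuous_fderiv.clm_apply continuous_const

lemma IsTestField.continuous_fderiv_slice (h : IsTestField T Φ) :
    Continuous fun p : ℝ × Plane => fderiv ℝ (Φ p.1) p.2 := by
  have h1 : (fun p : ℝ × Plane => fderiv ℝ (Φ p.1) p.2)
      = fun p => (fderiv ℝ (Function.uncurry Φ) p).comp (ContinuousLinearMap.inr ℝ ℝ Plane) := by
    funext p
    exact (h.hasFDerivAt_slice p.1 p.2).fderiv
  rw [h1]
  exact h.continuous_fderiv.clm_comp continuous_const

lemma IsTestField.deriv_eq_zero (_h : IsTestField T Φ) {ρ : ℝ} (hρ : ∀ t x, ρ < ‖x‖ → Φ t x = 0)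
    (t : ℝ) {x : Plane} (hx : ρ < ‖x‖) : deriv (fun s => Φ s x) t = 0 := by
  have h1 : (fun s => Φ s x) = fun _ => 0 := funext fun s => hρ s x hx
  rw [h1, deriv_const]

lemma IsTestField.fderiv_eq_zero (_h : IsTestField T Φ) {ρ : ℝ} (hρ : ∀ t x, ρ < ‖x‖ → Φ t x = 0)
    (t : ℝ) {x : Plane} (hx : ρ < ‖x‖) : fderiv ℝ (Φ t) x = 0 := by
  have h1 : Φ t =ᶠ[𝓝 x] fun _ => 0 := by
    filter_upwards [continuous_norm.continuousAt.eventually (lt_mem_nhds hx)] with y hy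
    exact hρ t y hy
  rw [h1.fderiv_eq, fderiv_const_apply]

lemma norm_perpL_comp_le (A : Plane →L[ℝ] Plane) : ‖perpL.comp A‖ ≤ ‖A‖ :=
  ContinuousLinearMap.opNorm_le_bound _ (norm_nonneg _) fun v => by
    simpa using A.le_opNorm v

/-- The bounds are uniform in `t`, so the consistency estimate can be applied at all times with the
same threshold on `ε`. -/
lemma IsTestField.exists_fderiv_bounds (h : IsTestField T Φ) :
    ∃ L L₂ : ℝ, 0 ≤ L ∧ 0 ≤ L₂ ∧ ∀ t, (∀ x, ‖fderiv ℝ (Φ t) x‖ ≤ L) ∧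
      ∀ x y, ‖fderiv ℝ (Φ t) x - fderiv ℝ (Φ t) y‖ ≤ L₂ * ‖x - y‖ := by
  have hc : HasCompactSupport (fderiv ℝ (Function.uncurry Φ)) := h.compactSupport.fderiv ℝ
  obtain ⟨L, hL⟩ := hc.exists_bound_of_continuous h.continuous_fderiv
  obtain ⟨L₂, hL₂⟩ := ContDiff.lipschitzWith_of_hasCompactSupport (𝕂 := ℝ) (n := (⊤ : ℕ∞)) hc
    (h.contDiff.fderiv_right (m := (⊤ : ℕ∞)) (by simp)) (by simp)
  have hinr : ‖ContinuousLinearMap.inr ℝ ℝ Plane‖ ≤ 1 :=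
    ContinuousLinearMap.opNorm_le_bound _ zero_le_one fun v => by simp [Prod.norm_def]
  have hL0 : 0 ≤ L := (norm_nonneg _).trans (hL 0)
  refine ⟨L, L₂, hL0, L₂.2, fun t => ⟨fun x => ?_, fun x y => ?_⟩⟩
  · rw [(h.hasFDerivAt_slice t x).fderiv]
    calc _ ≤ _ := ContinuousLinearMap.opNorm_comp_le _ _
      _ ≤ L * 1 := by gcongr; exact hL _
      _ = L := mul_one L
  · rw [(h.hasFDerivAt_slice t x).fderiv, (h.hasFDerivAt_slice t y).fderiv,
      ← ContinuousLinearMap.sub_comp]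
    have h1 := hL₂.dist_le_mul (t, x) (t, y)
    rw [dist_eq_norm, dist_eq_norm] at h1
    have h2 : ‖((t, x) : ℝ × Plane) - (t, y)‖ = ‖x - y‖ := by simp [Prod.norm_def]
    rw [h2] at h1
    calc _ ≤ _ := ContinuousLinearMap.opNorm_comp_le _ _
      _ ≤ (L₂ * ‖x - y‖) * 1 := by gcongr
      _ = _ := mul_one _

end TestField

/-! ### The approximate weak formulation. -/

section TimeDerivative

variable {φ : Plane → ℝ} {ε T : ℝ} {N : ℕ} {ξ : Fin N → ℝ}

/-- Continuity is asked only over `[0,T]`, because the vortex positions are controlled only there.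
-/
lemma integrable_spaceTime_of_continuousOn {E : Type*} [NormedAddCommGroup E]
    {D : ℝ × Plane → E} (hD : ContinuousOn D (Icc 0 T ×ˢ univ)) {ρ : ℝ}
    (h0 : ∀ t ∈ Icc 0 T, ∀ x, ρ < ‖x‖ → D (t, x) = 0) : Integrable D (spaceTime T) := by
  have h1 : spaceTime T = volume.restrict (Icc 0 T ×ˢ univ) := by
    rw [spaceTime, Measure.volume_eq_prod, ← Measure.prod_restrict, Measure.restrict_univ]
  rw [h1]
  have h2 : IntegrableOn D (Icc 0 T ×ˢ Metric.closedBall 0 ρ) :=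
    (hD.mono (prod_mono_right (subset_univ _))).integrableOn_compact
      (isCompact_Icc.prod (isCompact_closedBall _ _))
  refine h2.of_forall_sdiff_eq_zero (measurableSet_Icc.prod MeasurableSet.univ) fun p hp => ?_
  refine h0 p.1 hp.1.1 p.2 ?_
  by_contra hle
  exact hp.2 ⟨hp.1.1, by simpa using hle⟩

/-- The time derivative of the velocity field of moving vortex blobs, at a fixed point. -/
def blobVelocityDeriv (φ : Plane → ℝ) (ε : ℝ) {N : ℕ} (ξ : Fin N → ℝ) (Y : Fin N → Plane)
    (x : Plane) : Plane :=
  ∑ j, ξ j • fderiv ℝ (regKernel φ ε) (x - Y j) (-blobVelocity φ ε ξ Y (Y j))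

lemma IsBlob.contDiff_regKernel (hφ : IsBlob φ) (hε : 0 < ε) : ContDiff ℝ 1 (regKernel φ ε) :=
  contDiff_velocity (n := 1) ((hφ.contDiff_scaledBlob ε).of_le (by norm_num))
    (hφ.hasCompactSupport_scaledBlob hε)

section Continuity

variable {A : Type*} [TopologicalSpace A] {s : Set A} {Y : A → Fin N → Plane} {z : A → Plane}

lemma IsBlob.continuousOn_blobVelocity (hφ : IsBlob φ) (hε : 0 < ε) (hY : ContinuousOn Y s)
    (hz : ContinuousOn z s) : ContinuousOn (fun a => blobVelocity φ ε ξ (Y a) (z a)) s := by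
  unfold blobVelocity
  refine continuousOn_finsetSum _ fun j _ => ContinuousOn.const_smul ?_ (ξ j)
  exact (hφ.contDiff_regKernel hε).continuous.comp_continuousOn (hz.sub (continuousOn_pi.1 hY j))

lemma IsBlob.continuousOn_blobVelocityDeriv (hφ : IsBlob φ) (hε : 0 < ε) (hY : ContinuousOn Y s)
    (hz : ContinuousOn z s) : ContinuousOn (fun a => blobVelocityDeriv φ ε ξ (Y a) (z a)) s := by
  unfold blobVelocityDeriv
  refine continuousOn_finsetSum _ fun j _ => ContinuousOn.const_smul ?_ (ξ j)
  refine ContinuousOn.clm_apply ?_ ?_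
  · exact ((hφ.contDiff_regKernel hε).continuous_fderiv one_ne_zero).comp_continuousOn
      (hz.sub (continuousOn_pi.1 hY j))
  · exact (hφ.continuousOn_blobVelocity hε hY (continuousOn_pi.1 hY j)).neg

lemma IsBlob.continuous_blobVelocityDeriv (hφ : IsBlob φ) (hε : 0 < ε) (Y : Fin N → Plane) :
    Continuous (blobVelocityDeriv φ ε ξ Y) :=
  continuousOn_univ.1 (hφ.continuousOn_blobVelocityDeriv (z := id) hε continuousOn_const
    continuousOn_id)

end Continuity

lemma SolvesVortexBlob.continuousOn {X : ℝ → Fin N → Plane} (hX : SolvesVortexBlob φ ε T ξ X) :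
    ContinuousOn X (Icc 0 T) :=
  continuousOn_pi.2 fun j t ht => (hX t ht j).continuousWithinAt

lemma SolvesVortexBlob.continuousOn_prod {X : ℝ → Fin N → Plane}
    (hX : SolvesVortexBlob φ ε T ξ X) :
    ContinuousOn (fun p : ℝ × Plane => X p.1) (Icc 0 T ×ˢ univ) :=
  hX.continuousOn.comp continuousOn_fst fun _ hp => hp.1

lemma IsBlob.hasDerivWithinAt_blobVelocity (hφ : IsBlob φ) (hε : 0 < ε) {X : ℝ → Fin N → Plane}
    (hX : SolvesVortexBlob φ ε T ξ X) {t : ℝ} (ht : t ∈ Icc 0 T) (x : Plane) :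
    HasDerivWithinAt (fun s => blobVelocity φ ε ξ (X s) x) (blobVelocityDeriv φ ε ξ (X t) x)
      (Icc 0 T) t := by
  unfold blobVelocity blobVelocityDeriv
  refine HasDerivWithinAt.fun_sum fun j _ => HasDerivWithinAt.const_smul (ξ j) ?_
  exact (((hφ.contDiff_regKernel hε).differentiable one_ne_zero _).hasFDerivAt).comp_hasDerivWithinAt
    t ((hX t ht j).const_sub x)

lemma velocity_scaledBlob_sub (p : Plane) :
    velocity (fun x => scaledBlob φ ε (x - p)) = fun x => regKernel φ ε (x - p) := by
  funext x
  rw [regKernel_eq_velocity, sub_eq_add_neg x p, ← velocity_translate]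
  simp only [sub_eq_add_neg]

/-- Each blob is a density translated with the velocity at its centre, so
`integral_inner_fderiv_velocity` applies term by term. The result is the nonlinear term of the
vortex-blob dynamics, to be compared with the Euler term `∫ ω V^⊥ · u`. -/
lemma IsBlob.integral_inner_blobVelocityDeriv (hφ : IsBlob φ) (hε : 0 < ε) {V : Plane → Plane}
    (hV : ContDiff ℝ 1 V) (hVc : HasCompactSupport V) (hdiv : ∀ x, divergence V x = 0)
    (Y : Fin N → Plane) :
    ∫ x, inner ℝ (blobVelocityDeriv φ ε ξ Y x) (V x)
      = ∑ j, ξ j * inner ℝ (∫ y, scaledBlob φ ε (y - Y j) • perp (V y))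
          (blobVelocity φ ε ξ Y (Y j)) := by
  have hK := hφ.contDiff_regKernel hε
  have hfd : ∀ p x v, fderiv ℝ (regKernel φ ε) (x - p) v
      = fderiv ℝ (velocity fun x => scaledBlob φ ε (x - p)) x v := fun p x v => by
    rw [velocity_scaledBlob_sub p, fderiv_comp_sub]
  have hi : ∀ j, Integrable fun x => ξ j * inner ℝ (fderiv ℝ (regKernel φ ε) (x - Y j)
      (-blobVelocity φ ε ξ Y (Y j))) (V x) := fun j => by
    refine Integrable.const_mul (Continuous.integrable_of_hasCompactSupport ?_ ?_) _
    · refine Continuous.inner (Continuous.clm_apply ?_ continuous_const) hV.continuous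
      exact (hK.continuous_fderiv one_ne_zero).comp (by fun_prop)
    · exact hVc.mono fun x hx hx' => hx (by simp only [hx', inner_zero_right])
  simp only [blobVelocityDeriv, sum_inner, inner_smul_left, RCLike.conj_to_real]
  rw [integral_finsetSum _ fun j _ => hi j]
  refine Finset.sum_congr rfl fun j _ => ?_
  rw [integral_const_mul]
  congr 1
  simp only [hfd]
  rw [integral_inner_fderiv_velocity ((hφ.contDiff_sub ε (Y j)).of_le (by norm_num))
    (hφ.hasCompactSupport_sub hε (Y j)) hV hVc hdiv, inner_neg_right, neg_neg]

lemma IsBlob.integral_time_deriv (hφ : IsBlob φ) (hε : 0 < ε) (hT : 0 ≤ T)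
    {X : ℝ → Fin N → Plane} (hX : SolvesVortexBlob φ ε T ξ X) {Φ : ℝ → Plane → Plane}
    (hΦ : IsTestField T Φ) (x : Plane) :
    ∫ t in Icc 0 T, (inner ℝ (blobVelocity φ ε ξ (X t) x) (deriv (fun s => Φ s x) t)
      + inner ℝ (blobVelocityDeriv φ ε ξ (X t) x) (Φ t x))
      = -inner ℝ (blobVelocity φ ε ξ (X 0) x) (Φ 0 x) := by
  have hu : ContinuousOn (fun t => blobVelocity φ ε ξ (X t) x) (Icc 0 T) := fun t ht =>
    (hφ.hasDerivWithinAt_blobVelocity hε hX ht x).continuousWithinAt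
  have hu' : ContinuousOn (fun t => blobVelocityDeriv φ ε ξ (X t) x) (Icc 0 T) :=
    hφ.continuousOn_blobVelocityDeriv (z := fun _ => x) hε hX.continuousOn continuousOn_const
  have hΦc : Continuous fun t => Φ t x := hΦ.contDiff.continuous.comp
    (f := fun t : ℝ => (t, x)) (by fun_prop)
  have hΦd : Continuous fun t => deriv (fun s => Φ s x) t := hΦ.continuous_deriv.comp
    (f := fun t : ℝ => (t, x)) (by fun_prop)
  have hint : ContinuousOn (fun t => inner ℝ (blobVelocity φ ε ξ (X t) x)
      (deriv (fun s => Φ s x) t) + inner ℝ (blobVelocityDeriv φ ε ξ (X t) x) (Φ t x)) (Icc 0 T) :=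
    (hu.inner hΦd.continuousOn).add (hu'.inner hΦc.continuousOn)
  rw [integral_Icc_eq_integral_Ioc, ← intervalIntegral.integral_of_le hT,
    intervalIntegral.integral_eq_sub_of_hasDerivAt_of_le hT (hu.inner hΦc.continuousOn)
    (fun t ht => ?_) (hint.intervalIntegrable_of_Icc hT)]
  -- Only the initial boundary term survives, since the test field vanishes at time `T`.
  · rw [hΦ.eq_zero le_rfl, inner_zero_right, zero_sub]
  · have h1 := (hφ.hasDerivWithinAt_blobVelocity hε hX (Ioo_subset_Icc_self ht) x).hasDerivAt
      (Icc_mem_nhds ht.1 ht.2)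
    have h2 := (hΦ.hasDerivAt_time t x)
    rw [← (hΦ.hasDerivAt_time t x).deriv] at h2
    exact h1.inner ℝ h2

lemma IsBlob.integrable_momentum (hφ : IsBlob φ) (hε : 0 < ε)
    {X : ℝ → Fin N → Plane} (hX : SolvesVortexBlob φ ε T ξ X) {Φ : ℝ → Plane → Plane}
    (hΦ : IsTestField T Φ) :
    Integrable (fun p : ℝ × Plane => inner ℝ (blobVelocity φ ε ξ (X p.1) p.2)
        (deriv (fun s => Φ s p.2) p.1)
      + inner ℝ (blobVelocity φ ε ξ (X p.1) p.2)
        (fderiv ℝ (Φ p.1) p.2 (blobVelocity φ ε ξ (X p.1) p.2))) (spaceTime T) := by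
  obtain ⟨ρ, -, hρ⟩ := hΦ.exists_radius
  have hu : ContinuousOn (fun p : ℝ × Plane => blobVelocity φ ε ξ (X p.1) p.2)
      (Icc 0 T ×ˢ univ) :=
    hφ.continuousOn_blobVelocity hε hX.continuousOn_prod continuousOn_snd
  refine integrable_spaceTime_of_continuousOn (ρ := ρ) ?_ fun t _ x hx => ?_
  · exact (hu.inner hΦ.continuous_deriv.continuousOn).add
      (hu.inner (hΦ.continuous_fderiv_slice.continuousOn.clm_apply hu))
  · simp [hΦ.deriv_eq_zero hρ t hx, hΦ.fderiv_eq_zero hρ t hx]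

lemma IsBlob.hasCompactSupport_blobVorticity (hφ : IsBlob φ) (hε : 0 < ε) {Y : Fin N → Plane} :
    HasCompactSupport (blobVorticity φ ε ξ Y) := by
  have h : ∀ F : Finset (Fin N), HasCompactSupport fun x =>
      ∑ j ∈ F, ξ j * scaledBlob φ ε (x - Y j) := fun F => by
    induction F using Finset.cons_induction with
    | empty => simpa using! HasCompactSupport.zero (α := Plane) (β := ℝ)
    | cons j F hj ih =>
      simp only [Finset.sum_cons]
      exact ((hφ.hasCompactSupport_sub hε (Y j)).mul_left).add ih
  exact h Finset.univ

/-- The vortex-blob velocity is a weak solution up to the consistency error. -/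
lemma IsBlob.abs_weak_form_le (hφ : IsBlob φ) (hε : 0 < ε) (hT : 0 ≤ T)
    {X : ℝ → Fin N → Plane} (hX : SolvesVortexBlob φ ε T ξ X) {Φ : ℝ → Plane → Plane}
    (hΦ : IsTestField T Φ) {δ : ℝ}
    (hδ : ∀ t ∈ Ico 0 T,
      |(∑ j, ξ j * inner ℝ (∫ y, scaledBlob φ ε (y - X t j) • perp (Φ t y))
          (blobVelocity φ ε ξ (X t) (X t j)))
        - ∫ x, blobVorticity φ ε ξ (X t) x * inner ℝ (perp (Φ t x)) (blobVelocity φ ε ξ (X t) x)|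
        ≤ δ) :
    |(∫ t in Icc 0 T, ∫ x, (inner ℝ (blobVelocity φ ε ξ (X t) x) (deriv (fun s => Φ s x) t)
        + inner ℝ (blobVelocity φ ε ξ (X t) x)
          (fderiv ℝ (Φ t) x (blobVelocity φ ε ξ (X t) x))))
      + ∫ x, inner ℝ (blobVelocity φ ε ξ (X 0) x) (Φ 0 x)| ≤ δ * T := by
  obtain ⟨ρ, -, hρ⟩ := hΦ.exists_radius
  have hu : ContinuousOn (fun p : ℝ × Plane => blobVelocity φ ε ξ (X p.1) p.2)
      (Icc 0 T ×ˢ univ) :=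
    hφ.continuousOn_blobVelocity hε hX.continuousOn_prod continuousOn_snd
  have hu' : ContinuousOn (fun p : ℝ × Plane => blobVelocityDeriv φ ε ξ (X p.1) p.2)
      (Icc 0 T ×ˢ univ) :=
    hφ.continuousOn_blobVelocityDeriv hε hX.continuousOn_prod continuousOn_snd
  have hI := hφ.integrable_momentum hε hX hΦ
  have hD : Integrable (fun p : ℝ × Plane => inner ℝ (blobVelocity φ ε ξ (X p.1) p.2)
        (deriv (fun s => Φ s p.2) p.1)
      + inner ℝ (blobVelocityDeriv φ ε ξ (X p.1) p.2) (Φ p.1 p.2)) (spaceTime T) := by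
    refine integrable_spaceTime_of_continuousOn (ρ := ρ) ?_ fun t _ x hx => ?_
    · exact (hu.inner hΦ.continuous_deriv.continuousOn).add
        (hu'.inner hΦ.contDiff.continuous.continuousOn)
    · simp [hΦ.deriv_eq_zero hρ t hx, hρ t x hx]
  have h1 : ∫ x, inner ℝ (blobVelocity φ ε ξ (X 0) x) (Φ 0 x)
      = -∫ t in Icc 0 T, ∫ x, (inner ℝ (blobVelocity φ ε ξ (X t) x) (deriv (fun s => Φ s x) t)
        + inner ℝ (blobVelocityDeriv φ ε ξ (X t) x) (Φ t x)) := by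
    rw [integral_integral_swap hD]
    simp only [hφ.integral_time_deriv hε hT hX hΦ]
    rw [integral_neg, neg_neg]
  -- The terms with `∂ₜΦ` will cancel at each time, leaving the Euler nonlinearity minus the one of
  -- the vortex-blob dynamics. The endpoint `T` is dropped because the divergence of `Φ` vanishes
  -- only for `t < T`.
  rw [h1, ← sub_eq_add_neg, ← integral_sub hI.integral_prod_left hD.integral_prod_left,
    integral_Icc_eq_integral_Ico]
  have hlen : volume.real (Ico 0 T) = T := by simp [hT]
  conv_rhs => rw [← hlen]
  rw [← Real.norm_eq_abs]
  refine norm_setIntegral_le_of_norm_le_const measure_Ico_lt_top fun t ht => ?_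
  rw [Real.norm_eq_abs, abs_sub_comm]
  have htI := Ico_subset_Icc_self ht
  have hV : ContDiff ℝ 1 (Φ t) := (hΦ.contDiff_slice t).of_le (by exact_mod_cast le_top)
  have hVc := hΦ.hasCompactSupport_slice t
  have hdiv := hΦ.div_eq_zero t ht
  have hωc : ContDiff ℝ 1 (blobVorticity φ ε ξ (X t)) :=
    hφ.contDiff_blobVorticity.of_le (by norm_num)
  have hωs : HasCompactSupport (blobVorticity φ ε ξ (X t)) :=
    hφ.hasCompactSupport_blobVorticity hε
  have hut : Continuous (blobVelocity φ ε ξ (X t)) := hφ.continuous_blobVelocity hε ξ (X t)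
  have hut' : Continuous (blobVelocityDeriv φ ε ξ (X t)) :=
    hφ.continuous_blobVelocityDeriv hε (X t)
  have hΦd : Continuous fun x => deriv (fun s => Φ s x) t := hΦ.continuous_deriv.comp
    (f := fun x : Plane => (t, x)) (by fun_prop)
  have hci : ∀ {a b : Plane → Plane}, Continuous a → Continuous b → (∀ x, ρ < ‖x‖ → b x = 0) →
      Integrable fun x => inner ℝ (a x) (b x) := fun ha hb h0 => by
    refine (ha.inner hb).integrable_of_hasCompactSupport ?_
    refine HasCompactSupport.intro (isCompact_closedBall (0 : Plane) ρ) fun x hx => ?_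
    rw [h0 x (by simpa using hx), inner_zero_right]
  have hi0 := hci hut hΦd fun x hx => hΦ.deriv_eq_zero hρ t hx
  have hi1 := hci hut' hV.continuous fun x hx => hρ t x hx
  have hi2 := hci hut ((hV.continuous_fderiv one_ne_zero).clm_apply hut) fun x hx => by
    rw [hΦ.fderiv_eq_zero hρ t hx]; simp
  rw [integral_add hi0 hi1, integral_add hi0 hi2, add_sub_add_left_eq_sub]
  have h2 := integral_inner_fderiv_self hωc hωs hV hVc hdiv
  rw [hφ.velocity_blobVorticity hε] at h2
  rw [h2, hφ.integral_inner_blobVelocityDeriv hε hV hVc hdiv]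
  exact hδ t ht

end TimeDerivative

/-! ### The initial data -/

/-! ### Integration against signed measures. -/

section SignedMeasureIntegral

variable {E : Type*} [NormedAddCommGroup E] [NormedSpace ℝ E]

lemma integral_signedMeasure_flip (ν : SignedMeasure Plane) {f : Plane → E}
    (hp : Integrable f ν.toJordanDecomposition.posPart)
    (hn : Integrable f ν.toJordanDecomposition.negPart) :
    ∫ᵛ x, f x ∂<•ν = (∫ x, f x ∂ν.toJordanDecomposition.posPart)
      - ∫ x, f x ∂ν.toJordanDecomposition.negPart := by
  conv_lhs => rw [← ν.toSignedMeasure_toJordanDecomposition, JordanDecomposition.toSignedMeasure]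
  rw [VectorMeasure.integral_sub_vectorMeasure, VectorMeasure.integral_toSignedMeasure,
    VectorMeasure.integral_toSignedMeasure]
  · rw [VectorMeasure.Integrable, Measure.variation_toSignedMeasure]; exact hp
  · rw [VectorMeasure.Integrable, Measure.variation_toSignedMeasure]; exact hn

lemma integral_signedMeasure (ν : SignedMeasure Plane) {f : Plane → ℝ}
    (hp : Integrable f ν.toJordanDecomposition.posPart)
    (hn : Integrable f ν.toJordanDecomposition.negPart) :
    ∫ᵛ x, f x ∂•ν = (∫ x, f x ∂ν.toJordanDecomposition.posPart)
      - ∫ x, f x ∂ν.toJordanDecomposition.negPart := by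
  have h : (ContinuousLinearMap.lsmul ℝ ℝ : ℝ →L[ℝ] ℝ →L[ℝ] ℝ)
      = (ContinuousLinearMap.lsmul ℝ ℝ).flip := by
    ext; simp
  rw [h]
  exact integral_signedMeasure_flip ν hp hn

lemma integral_pointVorticity {N : ℕ} (ξ : Fin N → ℝ) (X : Fin N → Plane) (f : Plane → ℝ) :
    ∫ᵛ x, f x ∂•(pointVorticity ξ X) = ∑ j, ξ j * f (X j) := by
  rw [pointVorticity, VectorMeasure.integral_finsetSum_vectorMeasure]
  · refine Finset.sum_congr rfl fun j _ => ?_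
    rw [VectorMeasure.integral_dirac]
    simp [mul_comm]
  · intro j _
    rw [VectorMeasure.Integrable, VectorMeasure.variation_dirac]
    exact (integrable_dirac (by simp)).smul_measure (by simp)

lemma CompactlySupported.exists_compact {ν : SignedMeasure Plane} (h : CompactlySupported ν) :
    ∃ A : Set Plane, IsCompact A ∧ (∀ᵐ x ∂ν.toJordanDecomposition.posPart, x ∈ A) ∧
      ∀ᵐ x ∂ν.toJordanDecomposition.negPart, x ∈ A := by
  obtain ⟨A, hA, h0⟩ := h
  rw [SignedMeasure.totalVariation, Measure.add_apply, add_eq_zero] at h0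
  exact ⟨A, hA, h0.1, h0.2⟩

lemma integrable_of_ae_mem_compact {G : Type*} [NormedAddCommGroup G] {μ : Measure Plane} [IsFiniteMeasure μ] {A : Set Plane}
    (hA : IsCompact A) (hμ : ∀ᵐ x ∂μ, x ∈ A) {f : Plane → G} (hf : Continuous f) :
    Integrable f μ := by
  obtain ⟨c, hc⟩ := hA.exists_bound_of_continuousOn hf.continuousOn
  exact Integrable.of_bound hf.aestronglyMeasurable c (hμ.mono hc)

end SignedMeasureIntegral

/-! ### Potentials dual to the Biot–Savart law. -/

section Potential

variable {F : Plane → Plane}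

/-- The potential `y ↦ ∫ F(x) · K(x - y) dx`. -/
def potential (F : Plane → Plane) (y : Plane) : ℝ :=
  -(velocity (fun x => F x 0) y 0 + velocity (fun x => F x 1) y 1)

lemma contDiff_plane_apply {n : WithTop ℕ∞} (hF : ContDiff ℝ n F) (i : Fin 2) :
    ContDiff ℝ n fun x => F x i := (EuclideanSpace.proj (𝕜 := ℝ) i).contDiff.comp hF

lemma continuous_plane_apply (hF : Continuous F) (i : Fin 2) :
    Continuous fun x => F x i := (EuclideanSpace.proj (𝕜 := ℝ) i).continuous.comp hF

lemma hasCompactSupport_plane_apply (hF : HasCompactSupport F) (i : Fin 2) :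
    HasCompactSupport fun x => F x i := hF.comp_left (g := fun z : Plane => z i) rfl

lemma integral_inner_bsKernel (hF : Continuous F) (hc : HasCompactSupport F) (y : Plane) :
    ∫ x, inner ℝ (F x) (bsKernel (x - y)) = potential F y := by
  have hi : ∀ i, Integrable fun x => F x i • bsKernel (y - x) := fun i =>
    integrable_smul_bsKernel (continuous_plane_apply hF i) (hasCompactSupport_plane_apply hc i) y
  have hi' : ∀ i, Integrable fun x => (F x i • bsKernel (y - x)) i := fun i =>
    (EuclideanSpace.proj (𝕜 := ℝ) i).integrable_comp (hi i)
  rw [potential, velocity_apply, velocity_apply, integral_plane_apply (hi 0),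
    integral_plane_apply (hi 1), ← integral_add (hi' 0) (hi' 1), ← integral_neg]
  refine integral_congr_ae (Eventually.of_forall fun x => ?_)
  simp only
  rw [← neg_sub y x, bsKernel_neg, inner_plane]
  simp
  ring

lemma continuous_potential (hF : Continuous F) (hc : HasCompactSupport F) :
    Continuous (potential F) :=
  ((continuous_plane_apply (continuous_velocity (continuous_plane_apply hF 0)
    (hasCompactSupport_plane_apply hc 0)) 0).add
  (continuous_plane_apply (continuous_velocity (continuous_plane_apply hF 1)
    (hasCompactSupport_plane_apply hc 1)) 1)).neg

lemma tendsto_potential_cocompact (hF : Continuous F) (hc : HasCompactSupport F) :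
    Tendsto (potential F) (cocompact Plane) (𝓝 0) := by
  have h := fun i : Fin 2 => tendsto_apply_cocompact (tendsto_velocity_cocompact
    (continuous_plane_apply hF i) (hasCompactSupport_plane_apply hc i)) i
  have h2 := ((h 0).add (h 1)).neg
  rw [add_zero, neg_zero] at h2
  exact h2

lemma exists_lipschitz_potential (hF : ContDiff ℝ 1 F) (hc : HasCompactSupport F) :
    ∃ L, 0 ≤ L ∧ ∀ x y, |potential F x - potential F y| ≤ L * ‖x - y‖ := by
  have h := fun i : Fin 2 => exists_lipschitz_velocity (contDiff_plane_apply hF i)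
    (hasCompactSupport_plane_apply hc i)
  obtain ⟨L0, h00, h0⟩ := h 0
  obtain ⟨L1, h10, h1⟩ := h 1
  refine ⟨L0 + L1, by positivity, fun x y => ?_⟩
  have e0 := (PiLp.norm_apply_le (velocity (fun x => F x 0) x - velocity (fun x => F x 0) y)
    0).trans (h0 x y)
  have e1 := (PiLp.norm_apply_le (velocity (fun x => F x 1) x - velocity (fun x => F x 1) y)
    1).trans (h1 x y)
  rw [PiLp.sub_apply, Real.norm_eq_abs, abs_le] at e0 e1
  rw [potential, potential, abs_le]
  constructor <;> linarith [e0.1, e0.2, e1.1, e1.2]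

lemma exists_weight_bound (hF : Continuous F) (hc : HasCompactSupport F) :
    ∃ c, ∀ x, ‖F x‖ ≤ c * ((1 + ‖x‖) ^ 2)⁻¹ := by
  have h1 : Continuous fun x => (1 + ‖x‖) ^ 2 • F x := by fun_prop
  obtain ⟨c, hcb⟩ := (hc.smul_left (f := fun x : Plane => (1 + ‖x‖) ^ 2)).exists_bound_of_continuous h1
  refine ⟨c, fun x => ?_⟩
  have h2 := hcb x
  have h3 : 0 < (1 + ‖x‖) ^ 2 := by positivity
  simp only [Pi.smul_apply', norm_smul, Real.norm_of_nonneg h3.le] at h2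
  rw [← div_eq_mul_inv, le_div_iff₀ h3, mul_comm]
  exact h2

lemma integral_inner_velocity_eq {ω : Plane → ℝ} (hω : Continuous ω) (hωc : HasCompactSupport ω)
    (hF : Continuous F) (hc : HasCompactSupport F) :
    ∫ x, inner ℝ (F x) (velocity ω x) = ∫ y, ω y * potential F y := by
  obtain ⟨c, hcb⟩ := exists_weight_bound hF hc
  have hi : Integrable fun y : Plane => (1 + ‖y‖) ^ 2 * ω y :=
    Continuous.integrable_of_hasCompactSupport (by fun_prop) hωc.mul_left
  have h := (integral_inner_bsKernel_swap (μ := volume) hω.aestronglyMeasurable hi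
    hF.aestronglyMeasurable hcb).2.2
  simp only [integral_inner_bsKernel hF hc] at h
  exact h

lemma integrable_one_add_norm_sq {μ : Measure Plane} [IsFiniteMeasure μ] {A : Set Plane}
    (hA : IsCompact A) (hμ : ∀ᵐ x ∂μ, x ∈ A) :
    Integrable (fun y : Plane => (1 + ‖y‖) ^ 2 * (1 : ℝ)) μ :=
  integrable_of_ae_mem_compact hA hμ (by fun_prop)

/-- Fubini shows that `K(x - ·)` is integrable against both Jordan parts for almost every `x`;
elsewhere the decomposition need not hold. In the auxiliary exchange lemma the trivial field `u = 0`
suffices, as only its first conclusion is used. -/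
lemma biotSavart_ae_eq {ν : SignedMeasure Plane} (hν : CompactlySupported ν) :
    biotSavart ν =ᵐ[volume] fun x =>
      (∫ y, (1 : ℝ) • bsKernel (x - y) ∂ν.toJordanDecomposition.posPart)
      - ∫ y, (1 : ℝ) • bsKernel (x - y) ∂ν.toJordanDecomposition.negPart := by
  obtain ⟨A, hA, hp, hn⟩ := hν.exists_compact
  have h := fun (μ : Measure Plane) [IsFiniteMeasure μ] (hμ : ∀ᵐ x ∂μ, x ∈ A) =>
    (integral_inner_bsKernel_swap (μ := μ) (u := 0) (c := 0) aestronglyMeasurable_const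
      (integrable_one_add_norm_sq hA hμ) aestronglyMeasurable_zero (by simp)).1
  filter_upwards [h _ hp, h _ hn] with x h1 h2
  simp only [one_smul] at h1 h2 ⊢
  exact integral_signedMeasure_flip ν h1 h2

lemma integral_inner_biotSavart {ν : SignedMeasure Plane} (hν : CompactlySupported ν)
    (hF : Continuous F) (hc : HasCompactSupport F) :
    ∫ x, inner ℝ (F x) (biotSavart ν x) = ∫ᵛ y, potential F y ∂•ν := by
  obtain ⟨A, hA, hp, hn⟩ := hν.exists_compact
  obtain ⟨c, hcb⟩ := exists_weight_bound hF hc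
  have h := fun (μ : Measure Plane) [IsFiniteMeasure μ] (hμ : ∀ᵐ x ∂μ, x ∈ A) =>
    (integral_inner_bsKernel_swap (μ := μ) aestronglyMeasurable_const
      (integrable_one_add_norm_sq hA hμ) hF.aestronglyMeasurable hcb).2
  have hΨ := continuous_potential hF hc
  rw [integral_signedMeasure ν (integrable_of_ae_mem_compact hA hp hΨ)
    (integrable_of_ae_mem_compact hA hn hΨ)]
  have hpp := h _ hp
  have hnn := h _ hn
  simp only [integral_inner_bsKernel hF hc, one_mul] at hpp hnn
  rw [← hpp.2, ← hnn.2, ← integral_sub hpp.1 hnn.1]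
  refine integral_congr_ae ?_
  filter_upwards [biotSavart_ae_eq hν] with x hx
  rw [hx, inner_sub_right]

lemma locallyIntegrable_biotSavart {ν : SignedMeasure Plane} (hν : CompactlySupported ν) :
    LocallyIntegrable (biotSavart ν) := by
  obtain ⟨A, hA, hp, hn⟩ := hν.exists_compact
  have h : ∀ (μ : Measure Plane) [IsFiniteMeasure μ], (∀ᵐ x ∂μ, x ∈ A) →
      LocallyIntegrable fun x => ∫ y, (1 : ℝ) • bsKernel (x - y) ∂μ := by
    intro μ _ hμ
    have h1 := integrable_prod_bsKernel (μ := μ) aestronglyMeasurable_const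
      (integrable_one_add_norm_sq hA hμ)
    have h2 : Integrable (fun p : Plane × Plane =>
        ((1 + ‖p.1‖) ^ 2)⁻¹ • (1 : ℝ) • bsKernel (p.1 - p.2)) (volume.prod μ) := by
      refine h1.mono ?_ (Eventually.of_forall fun p => ?_)
      · refine Measurable.aestronglyMeasurable ?_
        simp only [one_smul]
        exact (by fun_prop : Measurable fun p : Plane × Plane => ((1 + ‖p.1‖) ^ 2)⁻¹).smul
          (measurable_bsKernel.comp (measurable_fst.sub measurable_snd))
      · simp [norm_smul, mul_comm]
    have h3 := h2.integral_prod_left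
    simp only [MeasureTheory.integral_smul] at h3
    refine (locallyIntegrable_iff.2 fun k hk => ?_)
    have h4 : ContinuousOn (fun x : Plane => (1 + ‖x‖) ^ 2) k := by fun_prop
    refine (h3.integrableOn.continuousOn_smul h4 hk).congr_fun (fun x _ => ?_) hk.measurableSet
    have : (1 + ‖x‖) ^ 2 ≠ 0 := by positivity
    simp only [smul_inv_smul₀ this, one_smul]
  exact ((h _ hp).sub (h _ hn)).congr (biotSavart_ae_eq hν).symm

end Potential

/-! ### Weak convergence of the initial velocities. -/

section InitialData

variable {φ : Plane → ℝ}

/-- By duality the pairing with `F` is the potential of `F` integrated against the vorticity. The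
potential is in `C₀`, so weak-∗ convergence applies to the point vortices; it is also Lipschitz, so
passing from points to blobs costs only `O(ε)`. -/
lemma IsBlob.tendsto_integral_inner_initial (hφ : IsBlob φ) {ω₀ : SignedMeasure Plane}
    (hω₀ : CompactlySupported ω₀) {ε : ℕ → ℝ} {N : ℕ → ℕ} {ξ : ∀ n, Fin (N n) → ℝ}
    {Y : ∀ n, Fin (N n) → Plane} {M : ℝ} (hε : ∀ n, 0 < ε n) (hε0 : Tendsto ε atTop (𝓝 0))
    (hM : ∀ n, ∑ j, |ξ n j| ≤ M)
    (hw : WeakStarTendsto (fun n => pointVorticity (ξ n) (Y n)) ω₀) {F : Plane → Plane}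
    (hF : ContDiff ℝ 1 F) (hc : HasCompactSupport F) :
    Tendsto (fun n => ∫ x, inner ℝ (F x) (blobVelocity φ (ε n) (ξ n) (Y n) x)) atTop
      (𝓝 (∫ x, inner ℝ (F x) (biotSavart ω₀ x))) := by
  have hΨ := continuous_potential hF.continuous hc
  obtain ⟨L, hL0, hL⟩ := exists_lipschitz_potential hF hc
  have h1 := hw ⟨⟨potential F, hΨ⟩, tendsto_potential_cocompact hF.continuous hc⟩
  have h2 : Tendsto (fun n => ∑ j, ξ n j * potential F (Y n j)) atTop
      (𝓝 (∫ x, inner ℝ (F x) (biotSavart ω₀ x))) := by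
    rw [integral_inner_biotSavart hω₀ hF.continuous hc]
    simpa only [integral_pointVorticity] using! h1
  have h3 : Tendsto (fun n => M * (L * ε n)) atTop (𝓝 0) := by
    simpa using (hε0.const_mul L).const_mul M
  refine tendsto_of_tendsto_of_dist h2 (squeeze_zero (fun n => dist_nonneg) (fun n => ?_) h3)
  rw [dist_comm, Real.dist_eq, ← hφ.velocity_blobVorticity (hε n),
    integral_inner_velocity_eq hφ.contDiff_blobVorticity.continuous
      (hφ.hasCompactSupport_blobVorticity (hε n)) hF.continuous hc]
  have h4 := hφ.integral_blobVorticity_smul (ξ := ξ n) (X := Y n) (hε n) hΨ.locallyIntegrable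
  simp only [smul_eq_mul] at h4
  rw [h4, ← Finset.sum_sub_distrib]
  refine (Finset.abs_sum_le_sum_abs _ _).trans ?_
  calc _ ≤ ∑ j, |ξ n j| * (L * ε n) := Finset.sum_le_sum fun j _ => by
        rw [← mul_sub, abs_mul]
        refine mul_le_mul_of_nonneg_left ?_ (abs_nonneg _)
        exact hφ.norm_integral_smul_sub_le (hε n) hΨ fun x hx =>
          (hL x _).trans (mul_le_mul_of_nonneg_left hx hL0)
    _ ≤ M * (L * ε n) := by
        rw [← Finset.sum_mul]
        exact mul_le_mul_of_nonneg_right (hM n) (mul_nonneg hL0 (hε n).le)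

end InitialData

/-! ### Compactness -/

section Extraction

/-- Diagonal form of the Arzelà--Ascoli theorem for countably many equi-Lipschitz families. -/
lemma exists_subseq_uniformCauchy {K : Type*} [MetricSpace K] [CompactSpace K]
    (f : ℕ → ℕ → K → ℝ) (hB : ∀ m, ∃ B, ∀ n x, |f m n x| ≤ B)
    (hL : ∀ m, ∃ L, 0 ≤ L ∧ ∀ n x y, |f m n x - f m n y| ≤ L * dist x y) :
    ∃ k : ℕ → ℕ, StrictMono k ∧ ∀ m, ∀ δ > 0, ∃ n₀, ∀ i ≥ n₀, ∀ j ≥ n₀, ∀ x,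
      |f m (k i) x - f m (k j) x| ≤ δ := by
  choose B hB using hB
  choose L hL0 hL using hL
  have hlip : ∀ m n, LipschitzWith (L m).toNNReal (f m n) := fun m n =>
    LipschitzWith.of_dist_le_mul fun x y => by
      rw [Real.dist_eq, Real.coe_toNNReal _ (hL0 m)]
      exact hL m n x y
  let g : ℕ → ℕ → BoundedContinuousFunction K ℝ := fun n m =>
    BoundedContinuousFunction.mkOfCompact ⟨f m n, (hlip m n).continuous⟩
  have hcomp : ∀ m, IsCompact (closure (range fun n => g n m)) := fun m => by
    refine BoundedContinuousFunction.arzela_ascoli (Icc (-(B m)) (B m)) isCompact_Icc _ ?_ ?_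
    · rintro _ x ⟨n, rfl⟩
      exact abs_le.1 (hB m n x)
    · refine (LipschitzWith.uniformEquicontinuous _ (L m).toNNReal ?_).equicontinuous
      rintro ⟨_, n, rfl⟩
      exact hlip m n
  -- A countable product of compact sets is sequentially compact, which gives one subsequence for
  -- all `m` at once and replaces the diagonal extraction.
  obtain ⟨a, -, k, hk, hlim⟩ := (isCompact_univ_pi hcomp).tendsto_subseq
    (x := g) fun n m _ => subset_closure ⟨n, rfl⟩
  refine ⟨k, hk, fun m δ hδ => ?_⟩
  have h1 := (tendsto_pi_nhds.1 hlim m).cauchySeq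
  obtain ⟨n₀, hn₀⟩ := Metric.cauchySeq_iff.1 h1 δ hδ
  refine ⟨n₀, fun i hi j hj x => ?_⟩
  have h2 := (BoundedContinuousFunction.dist_coe_le_dist x).trans (hn₀ i hi j hj).le
  rwa [Real.dist_eq] at h2

end Extraction

/-- A sequence of vortex-blob solutions with uniform mass, support and vorticity decay bounds. -/
structure IsBlobSequence (φ : Plane → ℝ) (T C α R M : ℝ) (ε : ℕ → ℝ) (N : ℕ → ℕ)
    (ξ : ∀ n, Fin (N n) → ℝ) (X : ∀ n, ℝ → Fin (N n) → Plane) : Prop where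
  eps_pos : ∀ n, 0 < ε n
  eps_tendsto : Tendsto ε atTop (𝓝 0)
  solves : ∀ n, SolvesVortexBlob φ (ε n) T (ξ n) (X n)
  mass_le : ∀ n, ∑ j, |ξ n j| ≤ M
  density : ∀ n, ∀ t ∈ Icc 0 T,
    IsVortexDensity (blobVorticity φ (ε n) (ξ n) (X n t)) C α R M

/-! ### Uniform-in-time Cauchy subsequences of velocities. -/

section Compactness

variable {φ : Plane → ℝ} {T C α R M : ℝ} {ε : ℕ → ℝ} {N : ℕ → ℕ}
  {ξ : ∀ n, Fin (N n) → ℝ} {X : ∀ n, ℝ → Fin (N n) → Plane}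

lemma exists_lipschitz_stream {ω : Plane → ℝ} (hω : ContDiff ℝ 1 ω) (hc : HasCompactSupport ω) :
    ∃ L, 0 ≤ L ∧ ∀ x y, |stream ω x - stream ω y| ≤ L * ‖x - y‖ := by
  obtain ⟨c, hc0, hcb⟩ := exists_velocity_bound_inv hω.continuous hc
  refine ⟨c, hc0, fun x y => ?_⟩
  refine convex_univ.norm_image_sub_le_of_norm_hasFDerivWithin_le (𝕜 := ℝ)
    (fun z _ => (hasFDerivAt_stream hω hc z).hasFDerivWithinAt) (fun z _ => ?_)
    (mem_univ y) (mem_univ x)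
  rw [innerSL_apply_norm, norm_perp]
  exact (hcb z).1

lemma IsBlob.contDiff_scaledBlob_one (hφ : IsBlob φ) (δ : ℝ) : ContDiff ℝ 1 (scaledBlob φ δ) :=
  (hφ.contDiff_scaledBlob δ).of_le (by norm_num)

/-- The stream function of the point vortices, mollified at a fixed scale `δ`. -/
def mollifiedStream (φ : Plane → ℝ) (δ : ℝ) {N : ℕ} (ξ : Fin N → ℝ) (Y : Fin N → Plane)
    (x : Plane) : ℝ := ∑ j, ξ j * stream (scaledBlob φ δ) (x - Y j)

lemma abs_mollifiedStream_sub_le {δ L : ℝ} {N : ℕ} {ξ : Fin N → ℝ} {Y : Fin N → Plane}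
    (hL0 : 0 ≤ L) (hL : ∀ x y, |stream (scaledBlob φ δ) x - stream (scaledBlob φ δ) y| ≤ L * ‖x - y‖)
    (hM : ∑ j, |ξ j| ≤ M) (x y : Plane) :
    |mollifiedStream φ δ ξ Y x - mollifiedStream φ δ ξ Y y| ≤ M * (L * ‖x - y‖) := by
  rw [mollifiedStream, mollifiedStream, ← Finset.sum_sub_distrib]
  refine (Finset.abs_sum_le_sum_abs _ _).trans ?_
  calc _ ≤ ∑ j, |ξ j| * (L * ‖x - y‖) := Finset.sum_le_sum fun j _ => by
        rw [← mul_sub, abs_mul]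
        refine mul_le_mul_of_nonneg_left ((hL _ _).trans (le_of_eq ?_)) (abs_nonneg _)
        rw [sub_sub_sub_cancel_right]
    _ ≤ M * (L * ‖x - y‖) := by
        rw [← Finset.sum_mul]
        gcongr

/-- Replacing each point by a blob of size `ε` moves a Lipschitz function by `O(ε)`, so at fixed `δ`
the point and blob versions have the same limits. -/
lemma IsBlob.abs_integral_sub_mollifiedStream_le (hφ : IsBlob φ) {ε δ L : ℝ} (hε : 0 < ε)
    (hδ : 0 < δ) {N : ℕ} {ξ : Fin N → ℝ} {Y : Fin N → Plane} (hL0 : 0 ≤ L)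
    (hL : ∀ x y, |stream (scaledBlob φ δ) x - stream (scaledBlob φ δ) y| ≤ L * ‖x - y‖)
    (hM : ∑ j, |ξ j| ≤ M) (x : Plane) :
    |(∫ y, blobVorticity φ ε ξ Y y * stream (scaledBlob φ δ) (x - y))
      - mollifiedStream φ δ ξ Y x| ≤ M * (L * ε) := by
  have hS : Continuous fun y => stream (scaledBlob φ δ) (x - y) :=
    (continuous_stream (hφ.contDiff_scaledBlob δ).continuous
      (hφ.hasCompactSupport_scaledBlob hδ)).comp (continuous_const.sub continuous_id)
  have h4 := hφ.integral_blobVorticity_smul (ξ := ξ) (X := Y) hε hS.locallyIntegrable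
  simp only [smul_eq_mul] at h4
  rw [h4, mollifiedStream, ← Finset.sum_sub_distrib]
  refine (Finset.abs_sum_le_sum_abs _ _).trans ?_
  calc _ ≤ ∑ j, |ξ j| * (L * ε) := Finset.sum_le_sum fun j _ => by
        rw [← mul_sub, abs_mul]
        refine mul_le_mul_of_nonneg_left ?_ (abs_nonneg _)
        refine hφ.norm_integral_smul_sub_le hε hS fun y hy => (hL _ _).trans ?_
        rw [sub_sub_sub_cancel_left, norm_sub_rev]
        gcongr
    _ ≤ M * (L * ε) := by
        rw [← Finset.sum_mul]
        gcongr

/-- The time derivative is `∑ ξⱼ q(Xⱼ) · u(Xⱼ)` with the Lipschitz field `q = ∇G_δ` up to sign, so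
the symmetrized estimate bounds it independently of `ε`. -/
lemma IsBlob.exists_lipschitz_mollifiedStream (hφ : IsBlob φ) {δ : ℝ} (hδ : 0 < δ) :
    ∃ A, 0 ≤ A ∧ ∀ (ε : ℝ) (N : ℕ) (ξ : Fin N → ℝ) (X : ℝ → Fin N → Plane), 0 < ε →
      SolvesVortexBlob φ ε T ξ X → ∑ j, |ξ j| ≤ M → ∀ s ∈ Icc 0 T, ∀ t ∈ Icc 0 T, ∀ x,
        |mollifiedStream φ δ ξ (X t) x - mollifiedStream φ δ ξ (X s) x| ≤ A * |t - s| := by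
  obtain ⟨c, hc0, hc⟩ := hφ.exists_regKernel_bound
  have hη := hφ.contDiff_scaledBlob_one δ
  have hηs := hφ.hasCompactSupport_scaledBlob hδ
  obtain ⟨L, hL0, hL⟩ := exists_lipschitz_velocity hη hηs
  refine ⟨M ^ 2 * (L * c), by positivity, fun ε N ξ X hε hX hξ s hs t ht x => ?_⟩
  refine (convex_Icc (0:ℝ) T).norm_image_sub_le_of_norm_hasDerivWithin_le
    (f := fun t => mollifiedStream φ δ ξ (X t) x)
    (f' := fun t => ∑ j, ξ j * inner ℝ (-perp (velocity (scaledBlob φ δ) (x - X t j)))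
      (blobVelocity φ ε ξ (X t) (X t j))) (fun t ht => ?_) (fun t ht => ?_) hs ht
  · unfold mollifiedStream
    refine HasDerivWithinAt.fun_sum fun j _ => HasDerivWithinAt.const_mul _ ?_
    have h1 := (hasFDerivAt_stream hη hηs (x - X t j)).comp_hasDerivWithinAt t
      ((hX t ht j).const_sub x)
    simpa [inner_neg_left, inner_neg_right, blobVelocity] using! h1
  · have hS0 : 0 ≤ ∑ j, |ξ j| := Finset.sum_nonneg fun j _ => abs_nonneg _
    refine (abs_sum_inner_blobVelocity_le hφ hε hL0 (hc ε hε)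
      (q := fun y => -perp (velocity (scaledBlob φ δ) (x - y))) fun y z => ?_).trans ?_
    · rw [neg_sub_neg, ← perp_sub, norm_perp]
      refine (hL _ _).trans (le_of_eq ?_)
      rw [sub_sub_sub_cancel_left]
    · gcongr

lemma IsBlobSequence.mass_nonneg (h : IsBlobSequence φ T C α R M ε N ξ X) : 0 ≤ M :=
  (Finset.sum_nonneg fun _ _ => abs_nonneg _).trans (h.mass_le 0)

/-- Cancellation may hide vortices outside the disc from the support hypothesis, so the bound is
taken for the blob vorticity, which is supported in the disc, and then transferred to the points. -/
lemma IsBlobSequence.exists_bound_mollifiedStream (h : IsBlobSequence φ T C α R M ε N ξ X)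
    (hφ : IsBlob φ) {δ : ℝ} (hδ : 0 < δ) :
    ∃ B, ∀ n, ∀ t ∈ Icc 0 T, ∀ x, ‖x‖ ≤ R → |mollifiedStream φ δ (ξ n) (X n t) x| ≤ B := by
  have hη := hφ.contDiff_scaledBlob_one δ
  have hηs := hφ.hasCompactSupport_scaledBlob hδ
  obtain ⟨L, hL0, hL⟩ := exists_lipschitz_stream hη hηs
  obtain ⟨B, hB⟩ := (isCompact_closedBall (0 : Plane) (2 * R)).exists_bound_of_continuousOn
    (continuous_stream hη.continuous hηs).continuousOn
  obtain ⟨E, hE⟩ := h.eps_tendsto.bddAbove_range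
  have hM := h.mass_nonneg
  refine ⟨M * (L * E) + M * B, fun n t ht x hx => ?_⟩
  have hd := h.density n t ht
  have h1 := hφ.abs_integral_sub_mollifiedStream_le (Y := X n t) (h.eps_pos n) hδ hL0 hL
    (h.mass_le n) x
  have h2 : |∫ y, blobVorticity φ (ε n) (ξ n) (X n t) y * stream (scaledBlob φ δ) (x - y)|
      ≤ M * B := by
    have hR0 : 0 ≤ R := (norm_nonneg x).trans hx
    have hB0 : 0 ≤ B := (norm_nonneg _).trans (hB 0 (by simpa using hR0))
    refine (norm_integral_le_of_norm_le (G := ℝ) (hd.integrable.abs.mul_const B)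
      (Eventually.of_forall fun y => ?_)).trans ?_
    · rw [norm_mul, Real.norm_eq_abs]
      rcases le_or_gt R ‖y‖ with hy | hy
      · rw [hd.eq_zero y hy]; simp
      · refine mul_le_mul_of_nonneg_left (hB _ ?_) (abs_nonneg _)
        rw [mem_closedBall_zero_iff]
        have := norm_sub_le x y
        linarith
    · rw [integral_mul_const]
      exact mul_le_mul_of_nonneg_right hd.mass hB0
  have h3 : M * (L * ε n) ≤ M * (L * E) := by
    have := hE (mem_range_self n)
    gcongr
  have h4 := abs_sub_abs_le_abs_sub (mollifiedStream φ δ (ξ n) (X n t) x)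
    (∫ y, blobVorticity φ (ε n) (ξ n) (X n t) y * stream (scaledBlob φ δ) (x - y))
  rw [abs_sub_comm] at h4
  linarith

/-- A subsequence along which the mollified stream functions converge uniformly at all scales
`1/(m+1)`. -/
lemma IsBlobSequence.exists_subseq_mollifiedStream (h : IsBlobSequence φ T C α R M ε N ξ X)
    (hφ : IsBlob φ) :
    ∃ k : ℕ → ℕ, StrictMono k ∧ ∀ m : ℕ, ∀ d > 0, ∃ n₀, ∀ i ≥ n₀, ∀ j ≥ n₀,
      ∀ t ∈ Icc 0 T, ∀ x, ‖x‖ ≤ R →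
        |mollifiedStream φ (1 / ((m : ℝ) + 1)) (ξ (k i)) (X (k i) t) x
          - mollifiedStream φ (1 / ((m : ℝ) + 1)) (ξ (k j)) (X (k j) t) x| ≤ d := by
  have hM := h.mass_nonneg
  set S : Set (ℝ × Plane) := Icc 0 T ×ˢ Metric.closedBall 0 R with hS
  have : CompactSpace S :=
    isCompact_iff_compactSpace.1 (isCompact_Icc.prod (isCompact_closedBall _ _))
  let f : ℕ → ℕ → S → ℝ := fun m n p =>
    mollifiedStream φ (1 / ((m : ℝ) + 1)) (ξ n) (X n p.1.1) p.1.2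
  have hB : ∀ m, ∃ B, ∀ n x, |f m n x| ≤ B := fun m => by
    obtain ⟨B, hB⟩ := h.exists_bound_mollifiedStream hφ (δ := 1 / ((m : ℝ) + 1)) (by positivity)
    exact ⟨B, fun n p => hB n p.1.1 p.2.1 p.1.2 (by simpa using p.2.2)⟩
  have hL : ∀ m, ∃ L, 0 ≤ L ∧ ∀ n x y, |f m n x - f m n y| ≤ L * dist x y := fun m => by
    have hδ : (0 : ℝ) < 1 / ((m : ℝ) + 1) := by positivity
    obtain ⟨L, hL0, hL⟩ := exists_lipschitz_stream (hφ.contDiff_scaledBlob_one _)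
      (hφ.hasCompactSupport_scaledBlob hδ)
    obtain ⟨A, hA0, hA⟩ := hφ.exists_lipschitz_mollifiedStream (T := T) (M := M) hδ
    refine ⟨A + M * L, by positivity, fun n p q => ?_⟩
    have h1 := hA (ε n) (N n) (ξ n) (X n) (h.eps_pos n) (h.solves n) (h.mass_le n) q.1.1 q.2.1
      p.1.1 p.2.1 p.1.2
    have h2 := abs_mollifiedStream_sub_le (Y := X n q.1.1) hL0 hL (h.mass_le n) p.1.2 q.1.2
    have h3 : |p.1.1 - q.1.1| ≤ dist p q := by
      rw [Subtype.dist_eq, Prod.dist_eq, ← Real.dist_eq]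
      exact le_max_left _ _
    have h4 : ‖p.1.2 - q.1.2‖ ≤ dist p q := by
      rw [Subtype.dist_eq, Prod.dist_eq, ← dist_eq_norm]
      exact le_max_right _ _
    calc _ ≤ _ := abs_sub_le _ (mollifiedStream φ (1 / ((m : ℝ) + 1)) (ξ n) (X n q.1.1) p.1.2) _
      _ ≤ A * |p.1.1 - q.1.1| + M * (L * ‖p.1.2 - q.1.2‖) := add_le_add h1 h2
      _ ≤ A * dist p q + M * (L * dist p q) := by gcongr
      _ = _ := by ring
  obtain ⟨k, hk, hlim⟩ := exists_subseq_uniformCauchy f hB hL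
  refine ⟨k, hk, fun m d hd => ?_⟩
  obtain ⟨n₀, hn₀⟩ := hlim m d hd
  exact ⟨n₀, fun i hi j hj t ht x hx => hn₀ i hi j hj ⟨(t, x), ht, by simpa using hx⟩⟩

lemma IsBlobSequence.integral_norm_velocity_sub_sq (h : IsBlobSequence φ T C α R M ε N ξ X)
    (hφ : IsBlob φ) (hC : 0 ≤ C) {t : ℝ} (ht : t ∈ Icc 0 T) (i j : ℕ) :
    Integrable fun x => ‖blobVelocity φ (ε i) (ξ i) (X i t) x
      - blobVelocity φ (ε j) (ξ j) (X j t) x‖ ^ 2 := by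
  have hi := h.density i t ht
  have hj := h.density j t ht
  have hd := hi.sub hj hC
  have h1 := (integral_norm_velocity_sq hd.contDiff hd.compactSupport hd.mean).1
  have h2 : ∀ x, velocity (fun x => blobVorticity φ (ε i) (ξ i) (X i t) x
      - blobVorticity φ (ε j) (ξ j) (X j t) x) x = blobVelocity φ (ε i) (ξ i) (X i t) x
      - blobVelocity φ (ε j) (ξ j) (X j t) x := fun x => by
    rw [velocity_sub hi.continuous hi.compactSupport hj.continuous hj.compactSupport,
      hφ.velocity_blobVorticity (h.eps_pos i), hφ.velocity_blobVorticity (h.eps_pos j)]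
  simpa only [h2] using h1

/-- A subsequence of the velocities is Cauchy in `L²`, uniformly in time. -/
lemma IsBlobSequence.exists_subseq_cauchy (h : IsBlobSequence φ T C α R M ε N ξ X)
    (hφ : IsBlob φ) (hC : 0 ≤ C) (hα : 0 < α) :
    ∃ k : ℕ → ℕ, StrictMono k ∧ ∀ d > 0, ∃ n₀, ∀ i ≥ n₀, ∀ j ≥ n₀, ∀ t ∈ Icc 0 T,
      ∫ x, ‖blobVelocity φ (ε (k i)) (ξ (k i)) (X (k i) t) x
        - blobVelocity φ (ε (k j)) (ξ (k j)) (X (k j) t) x‖ ^ 2 ≤ d := by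
  obtain ⟨k, hk, hlim⟩ := h.exists_subseq_mollifiedStream hφ
  refine ⟨k, hk, fun d hd => ?_⟩
  have hM := h.mass_nonneg
  have hpi := Real.pi_pos
  -- The energy of a difference is bounded by its mass `2M` times four errors `e`: one for
  -- mollifying at scale `δ`, two for passing between blobs and points, one for the Cauchy property
  -- of the mollified streams.
  set e := d / (4 * (2 * M + 1)) with he
  have he0 : 0 < e := by positivity
  have hed : 2 * M * (4 * e) ≤ d := by
    have : e * (4 * (2 * M + 1)) = d := div_mul_cancel₀ _ (by positivity)
    nlinarith
  obtain ⟨m, hm⟩ : ∃ m : ℕ, (2 * Real.pi)⁻¹ * (2 * C * (1 / ((m : ℝ) + 1)) ^ α / α) < e := by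
    have h1 : Continuous fun s : ℝ => (2 * Real.pi)⁻¹ * (2 * C * s ^ α / α) :=
      continuous_const.mul ((continuous_const.mul
        (continuous_id.rpow_const fun _ => Or.inr hα.le)).div_const _)
    have h2 := (h1.tendsto 0).comp tendsto_one_div_add_atTop_nhds_zero_nat
    rw [Real.zero_rpow hα.ne', mul_zero, zero_div, mul_zero] at h2
    exact (h2.eventually (gt_mem_nhds he0)).exists
  set δ : ℝ := 1 / ((m : ℝ) + 1) with hδ
  have hδ0 : 0 < δ := by positivity
  obtain ⟨L, hL0, hL⟩ := exists_lipschitz_stream (hφ.contDiff_scaledBlob_one δ)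
    (hφ.hasCompactSupport_scaledBlob hδ0)
  obtain ⟨n₁, hn₁⟩ := hlim m e he0
  have h3 : Tendsto (fun i => M * (L * ε (k i))) atTop (𝓝 0) := by
    simpa using ((h.eps_tendsto.comp hk.tendsto_atTop).const_mul L).const_mul M
  obtain ⟨n₂, hn₂⟩ := eventually_atTop.1 (h3.eventually (gt_mem_nhds he0))
  refine ⟨max n₁ n₂, fun i hi j hj t ht => ?_⟩
  have hdi := h.density (k i) t ht
  have hdj := h.density (k j) t ht
  have hds := hdi.sub hdj hC
  have hη := hφ.isRadialDensity hδ0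
  have hSc : Continuous (stream (scaledBlob φ δ)) :=
    continuous_stream (hφ.contDiff_scaledBlob δ).continuous (hφ.hasCompactSupport_scaledBlob hδ0)
  have henergy := hds.energy_le hη (by positivity) hα hδ0 (S := 3 * e) (by positivity)
    fun x hx => by
      have hint : ∀ n, IsVortexDensity (blobVorticity φ (ε n) (ξ n) (X n t)) C α R M →
          Integrable fun y => blobVorticity φ (ε n) (ξ n) (X n t) y
            * stream (scaledBlob φ δ) (x - y) := fun n hn =>
        Continuous.integrable_of_hasCompactSupport
          (hn.continuous.mul (hSc.comp (continuous_const.sub continuous_id)))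
          hn.compactSupport.mul_right
      simp only [sub_mul]
      rw [integral_sub (hint _ hdi) (hint _ hdj)]
      have a1 := hφ.abs_integral_sub_mollifiedStream_le (Y := X (k i) t) (h.eps_pos (k i)) hδ0
        hL0 hL (h.mass_le (k i)) x
      have a2 := hφ.abs_integral_sub_mollifiedStream_le (Y := X (k j) t) (h.eps_pos (k j)) hδ0
        hL0 hL (h.mass_le (k j)) x
      have a3 := hn₁ i ((le_max_left _ _).trans hi) j ((le_max_left _ _).trans hj) t ht x hx
      have a4 := hn₂ i ((le_max_right _ _).trans hi)
      have a5 := hn₂ j ((le_max_right _ _).trans hj)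
      rw [abs_le] at a1 a2 a3 ⊢
      constructor <;> linarith [a1.1, a1.2, a2.1, a2.2, a3.1, a3.2]
  have h2 : ∀ x, velocity (fun x => blobVorticity φ (ε (k i)) (ξ (k i)) (X (k i) t) x
      - blobVorticity φ (ε (k j)) (ξ (k j)) (X (k j) t) x) x
      = blobVelocity φ (ε (k i)) (ξ (k i)) (X (k i) t) x
      - blobVelocity φ (ε (k j)) (ξ (k j)) (X (k j) t) x := fun x => by
    rw [velocity_sub hdi.continuous hdi.compactSupport hdj.continuous hdj.compactSupport,
      hφ.velocity_blobVorticity (h.eps_pos _), hφ.velocity_blobVorticity (h.eps_pos _)]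
  simp only [h2] at henergy
  refine henergy.trans (le_trans ?_ hed)
  gcongr
  linarith

end Compactness

/-! ### Limits in `L²` -/

section Limits

variable {A B E : Type*} [MeasurableSpace A] [MeasurableSpace B] [NormedAddCommGroup E]
  {μ : Measure A} {ν : Measure B}

lemma eLpNorm_two_sq (f : A → E) : eLpNorm f 2 μ ^ 2 = ∫⁻ x, ‖f x‖ₑ ^ 2 ∂μ := by
  have h := eLpNorm_nnreal_pow_eq_lintegral (f := f) (μ := μ) (p := 2) two_ne_zero
  simpa using h

lemma eLpNorm_two_prod_le [SFinite ν] {f : A × B → E}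
    (hf : AEStronglyMeasurable f (μ.prod ν)) {d : ℝ≥0∞}
    (h : ∀ᵐ t ∂μ, eLpNorm (fun x => f (t, x)) 2 ν ≤ d) :
    eLpNorm f 2 (μ.prod ν) ^ 2 ≤ d ^ 2 * μ univ := by
  rw [eLpNorm_two_sq, lintegral_prod _ (hf.enorm.pow_const 2)]
  refine (lintegral_mono_ae (h.mono fun t ht => ?_)).trans (lintegral_const _).le
  rw [← eLpNorm_two_sq]
  gcongr

lemma exists_limit_of_cauchy [CompleteSpace E] {f : ℕ → A → E} (hf : ∀ n, MemLp (f n) 2 μ)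
    (hc : ∀ e : ℝ≥0∞, 0 < e → ∃ n₀, ∀ i ≥ n₀, ∀ j ≥ n₀, eLpNorm (f i - f j) 2 μ < e) :
    ∃ w : A → E, MemLp w 2 μ ∧ Tendsto (fun n => eLpNorm (f n - w) 2 μ) atTop (𝓝 0) := by
  have hcau : CauchySeq fun n => (hf n).toLp := by
    refine EMetric.cauchySeq_iff.2 fun e he => ?_
    obtain ⟨n₀, hn₀⟩ := hc e he
    refine ⟨n₀, fun i hi j hj => ?_⟩
    rw [Lp.edist_toLp_toLp]
    exact hn₀ i hi j hj
  obtain ⟨w, hw⟩ := cauchySeq_tendsto_of_complete hcau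
  refine ⟨w, Lp.memLp w, ?_⟩
  rw [← Lp.tendsto_Lp_iff_tendsto_eLpNorm'' _ hf _ (Lp.memLp w), Lp.toLp_coeFn w]
  exact hw

/-- A sequence of space-time functions which is Cauchy in `L²`, uniformly in time, has a limit. -/
lemma exists_limit_of_uniform_cauchy [IsFiniteMeasure μ] [SFinite ν] [CompleteSpace E]
    {v : ℕ → A → B → E}
    (hv : ∀ n, MemLp (Function.uncurry (v n)) 2 (μ.prod ν))
    (hc : ∀ d : ℝ≥0∞, 0 < d → ∃ n₀, ∀ i ≥ n₀, ∀ j ≥ n₀, ∀ᵐ t ∂μ,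
      eLpNorm (v i t - v j t) 2 ν ≤ d) :
    ∃ u : A → B → E, MemLp (Function.uncurry u) 2 (μ.prod ν) ∧
      Tendsto (fun n => eLpNorm (Function.uncurry (v n) - Function.uncurry u) 2 (μ.prod ν))
        atTop (𝓝 0) ∧
      ∀ᵐ t ∂μ, MemLp (u t) 2 ν ∧ (∀ n, MemLp (v n t) 2 ν) ∧
        Tendsto (fun n => eLpNorm (v n t - u t) 2 ν) atTop (𝓝 0) := by
  obtain ⟨w, hw, hlim⟩ := exists_limit_of_cauchy hv fun e he => by
    have h1 : Tendsto (fun d : ℝ≥0∞ => d ^ 2 * μ univ) (𝓝[>] 0) (𝓝 0) := by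
      have := ENNReal.Tendsto.mul_const (b := μ univ)
        (((ENNReal.continuous_pow 2).tendsto 0).mono_left (nhdsWithin_le_nhds (s := Ioi 0)))
        (Or.inr (measure_ne_top μ univ))
      simpa using this
    obtain ⟨d, hd, hd0⟩ := ((h1.eventually (gt_mem_nhds (ENNReal.pow_pos he 2))).and
      self_mem_nhdsWithin).exists
    obtain ⟨n₀, hn₀⟩ := hc d hd0
    refine ⟨n₀, fun i hi j hj => ?_⟩
    refine lt_of_pow_lt_pow_left' 2 (lt_of_le_of_lt (eLpNorm_two_prod_le ?_ ?_) hd)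
    · exact (hv i).aestronglyMeasurable.sub (hv j).aestronglyMeasurable
    · exact hn₀ i hi j hj
  set u : A → B → E := fun t x => w (t, x) with hu
  have hum : MemLp (Function.uncurry u) 2 (μ.prod ν) := hw
  have hslice : ∀ {f : A → B → E}, MemLp (Function.uncurry f) 2 (μ.prod ν) →
      ∀ᵐ t ∂μ, MemLp (f t) 2 ν := fun {f} hf => by
    have h1 := hf.eLpNorm_lt_top
    have h2 : ∫⁻ t, ∫⁻ x, ‖f t x‖ₑ ^ 2 ∂ν ∂μ < ∞ := by
      have := lintegral_prod _ (hf.aestronglyMeasurable.enorm.pow_const 2)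
      rw [← eLpNorm_two_sq] at this
      simp only [Function.uncurry_apply_pair] at this
      rw [← this]
      exact ENNReal.pow_lt_top h1
    filter_upwards [hf.aestronglyMeasurable.prodMk_left, ae_lt_top' (AEMeasurable.lintegral_prod_right'
      (hf.aestronglyMeasurable.enorm.pow_const 2)) h2.ne] with t ht1 ht2
    refine ⟨ht1, ?_⟩
    rw [← eLpNorm_two_sq] at ht2
    by_contra h3
    simp [not_lt_top_iff.1 h3] at ht2
  obtain ⟨ns, hns, hae⟩ := (tendstoInMeasure_of_tendsto_eLpNorm two_ne_zero
    (fun n => (hv n).aestronglyMeasurable) hum.aestronglyMeasurable hlim).exists_seq_tendsto_ae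
  refine ⟨u, hum, hlim, ?_⟩
  -- Countably many tolerances `1/(m+1)` suffice, so a single null set of times can be discarded.
  choose n₀ hn₀ using fun m : ℕ => hc ((m : ℝ≥0∞) + 1)⁻¹ (by simp)
  have hc' : ∀ᵐ t ∂μ, ∀ m i j, n₀ m ≤ i → n₀ m ≤ j →
      eLpNorm (v i t - v j t) 2 ν ≤ ((m : ℝ≥0∞) + 1)⁻¹ := by
    simp only [ae_all_iff]
    exact fun m i j hi hj => hn₀ m i hi j hj
  filter_upwards [hslice hum, ae_all_iff.2 fun n => hslice (hv n), Measure.ae_ae_of_ae_prod hae, hc']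
    with t h1 h2 h3 h4
  refine ⟨h1, h2, ?_⟩
  refine ENNReal.tendsto_nhds_zero.2 fun d hd => ?_
  obtain ⟨m, hm⟩ := ENNReal.exists_inv_nat_lt hd.ne'
  filter_upwards [eventually_ge_atTop (n₀ m)] with i hi
  have hm' : ((m : ℝ≥0∞) + 1)⁻¹ ≤ d := (ENNReal.inv_le_inv.2 le_self_add).trans hm.le
  refine le_trans ?_ hm'
  -- Fatou's lemma along the subsequence that converges almost everywhere carries the Cauchy bound
  -- over to the limit.
  refine Lp.eLpNorm_le_of_ae_tendsto (u := atTop) (f := fun l => v i t - v (ns l) t) ?_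
    (fun l => (h2 i).aestronglyMeasurable.sub (h2 _).aestronglyMeasurable) ?_
  · filter_upwards [hns.tendsto_atTop.eventually_ge_atTop (n₀ m)] with l hl
    exact h4 m i _ hi hl
  · filter_upwards [h3] with x hx
    exact tendsto_const_nhds.sub hx

lemma tendsto_integral_inner {F : Type*} [NormedAddCommGroup F] [InnerProductSpace ℝ F]
    {f g : ℕ → A → F} {f' g' : A → F} (hf : ∀ n, MemLp (f n) 2 μ) (hf' : MemLp f' 2 μ)
    (hg : ∀ n, MemLp (g n) 2 μ) (hg' : MemLp g' 2 μ)
    (hfl : Tendsto (fun n => eLpNorm (f n - f') 2 μ) atTop (𝓝 0))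
    (hgl : Tendsto (fun n => eLpNorm (g n - g') 2 μ) atTop (𝓝 0)) :
    Tendsto (fun n => ∫ x, inner ℝ (f n x) (g n x) ∂μ) atTop (𝓝 (∫ x, inner ℝ (f' x) (g' x) ∂μ)) := by
  have key : ∀ {a b : A → F} (ha : MemLp a 2 μ) (hb : MemLp b 2 μ),
      ∫ x, inner ℝ (a x) (b x) ∂μ = inner ℝ ha.toLp hb.toLp := fun ha hb => by
    rw [L2.inner_def]
    refine integral_congr_ae ?_
    filter_upwards [ha.coeFn_toLp, hb.coeFn_toLp] with x h1 h2
    rw [h1, h2]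
  simp only [key (hf _) (hg _), key hf' hg']
  exact ((Lp.tendsto_Lp_iff_tendsto_eLpNorm'' _ hf _ hf').2 hfl).inner
    ((Lp.tendsto_Lp_iff_tendsto_eLpNorm'' _ hg _ hg').2 hgl)

lemma tendsto_eLpNorm_of_sub {f : ℕ → A → E} {f' : A → E} (hf : ∀ n, MemLp (f n) 2 μ)
    (hf' : MemLp f' 2 μ) (hfl : Tendsto (fun n => eLpNorm (f n - f') 2 μ) atTop (𝓝 0)) :
    Tendsto (fun n => eLpNorm (f n) 2 μ) atTop (𝓝 (eLpNorm f' 2 μ)) := by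
  have h := ((Lp.tendsto_Lp_iff_tendsto_eLpNorm'' _ hf _ hf').2 hfl).enorm
  simpa only [Lp.enorm_toLp] using h

lemma eLpNorm_apply_le_mul {F G : Type*} [NormedAddCommGroup F] [NormedSpace ℝ F]
    [NormedAddCommGroup G] [NormedSpace ℝ G] {D : A → F →L[ℝ] G} {L : ℝ≥0}
    (hD : ∀ x, ‖D x‖₊ ≤ L) (f : A → F) :
    eLpNorm (fun x => D x (f x)) 2 μ ≤ L * eLpNorm f 2 μ := by
  refine eLpNorm_le_nnreal_smul_eLpNorm_of_ae_le_mul (c := L) (Eventually.of_forall fun x => ?_) 2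
  exact ((D x).le_opNNNorm (f x)).trans (mul_le_mul_of_nonneg_right (hD x) (by positivity))

lemma memLp_apply {F G : Type*} [NormedAddCommGroup F] [NormedSpace ℝ F]
    [NormedAddCommGroup G] [NormedSpace ℝ G] {D : A → F →L[ℝ] G} {L : ℝ≥0}
    (hD : ∀ x, ‖D x‖₊ ≤ L) (hDm : AEStronglyMeasurable D μ) {f : A → F} (hf : MemLp f 2 μ) :
    MemLp (fun x => D x (f x)) 2 μ :=
  ⟨(ContinuousLinearMap.apply ℝ G).flip.aestronglyMeasurable_comp₂ hDm hf.aestronglyMeasurable,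
    (eLpNorm_apply_le_mul hD f).trans_lt (ENNReal.mul_lt_top ENNReal.coe_lt_top hf.eLpNorm_lt_top)⟩

lemma tendsto_eLpNorm_apply_sub {F G : Type*} [NormedAddCommGroup F] [NormedSpace ℝ F]
    [NormedAddCommGroup G] [NormedSpace ℝ G] {D : A → F →L[ℝ] G} {L : ℝ≥0}
    (hD : ∀ x, ‖D x‖₊ ≤ L) {f : ℕ → A → F} {f' : A → F}
    (hfl : Tendsto (fun n => eLpNorm (f n - f') 2 μ) atTop (𝓝 0)) :
    Tendsto (fun n => eLpNorm ((fun x => D x (f n x)) - fun x => D x (f' x)) 2 μ) atTop (𝓝 0) := by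
  have h1 : Tendsto (fun n => (L : ℝ≥0∞) * eLpNorm (f n - f') 2 μ) atTop (𝓝 0) := by
    simpa using ENNReal.Tendsto.const_mul hfl (Or.inr ENNReal.coe_ne_top)
  refine tendsto_of_tendsto_of_tendsto_of_le_of_le tendsto_const_nhds h1 (fun _ => zero_le)
    fun n => ?_
  have h2 : ((fun x => D x (f n x)) - fun x => D x (f' x)) = fun x => D x ((f n - f') x) := by
    ext x; simp
  rw [h2]
  exact eLpNorm_apply_le_mul hD _

end Limits

/-! ### The limit velocity -/

lemma eLpNorm_two_sq_eq {v : Plane → Plane} (hv : Integrable fun x => ‖v x‖ ^ 2) :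
    eLpNorm v 2 volume ^ 2 = ENNReal.ofReal (∫ x, ‖v x‖ ^ 2) := by
  rw [eLpNorm_two_sq, lintegral_enorm_sq_eq hv]

section Limit

variable {φ : Plane → ℝ} {T C α R M : ℝ} {ε : ℕ → ℝ} {N : ℕ → ℕ}
  {ξ : ∀ n, Fin (N n) → ℝ} {X : ∀ n, ℝ → Fin (N n) → Plane}

lemma IsBlobSequence.comp (h : IsBlobSequence φ T C α R M ε N ξ X) {k : ℕ → ℕ}
    (hk : StrictMono k) : IsBlobSequence φ T C α R M (fun n => ε (k n)) (fun n => N (k n))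
      (fun n => ξ (k n)) (fun n => X (k n)) where
  eps_pos _ := h.eps_pos _
  eps_tendsto := h.eps_tendsto.comp hk.tendsto_atTop
  solves _ := h.solves _
  mass_le _ := h.mass_le _
  density _ := h.density _

lemma IsBlobSequence.integrable_norm_sq (h : IsBlobSequence φ T C α R M ε N ξ X)
    (hφ : IsBlob φ) {t : ℝ} (ht : t ∈ Icc 0 T) (n : ℕ) :
    Integrable fun x => ‖blobVelocity φ (ε n) (ξ n) (X n t) x‖ ^ 2 := by
  have hd := h.density n t ht
  have h1 := (integral_norm_velocity_sq hd.contDiff hd.compactSupport hd.mean).1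
  rwa [hφ.velocity_blobVorticity (h.eps_pos n)] at h1

lemma IsBlobSequence.memLp (h : IsBlobSequence φ T C α R M ε N ξ X)
    (hφ : IsBlob φ) {t : ℝ} (ht : t ∈ Icc 0 T) (n : ℕ) :
    MemLp (blobVelocity φ (ε n) (ξ n) (X n t)) 2 volume :=
  (memLp_two_iff_integrable_sq_norm
    (hφ.continuous_blobVelocity (h.eps_pos n) _ _).aestronglyMeasurable).2
      (h.integrable_norm_sq hφ ht n)

/-- The Hamiltonian is exactly conserved and lies within `O(ε^α)` of the kinetic energy at both
times. -/
lemma IsBlobSequence.abs_energy_sub_le (h : IsBlobSequence φ T C α R M ε N ξ X)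
    (hφ : IsBlob φ) (hC : 0 ≤ C) (hα : 0 < α) (hT : 0 ≤ T) {t : ℝ} (ht : t ∈ Icc 0 T) (n : ℕ) :
    |(∫ x, ‖blobVelocity φ (ε n) (ξ n) (X n t) x‖ ^ 2)
      - ∫ x, ‖blobVelocity φ (ε n) (ξ n) (X n 0) x‖ ^ 2|
      ≤ 2 * (M * ((2 * Real.pi)⁻¹ * (C * ε n ^ α / α))) := by
  have hpi := Real.pi_pos
  have hε := h.eps_pos n
  have h0 : (0 : ℝ) ∈ Icc 0 T := ⟨le_rfl, hT⟩
  have h1 := hφ.abs_energy_sub_hamiltonian_le hε hC hα (h.density n t ht)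
  have h2 := hφ.abs_energy_sub_hamiltonian_le hε hC hα (h.density n 0 h0)
  rw [hφ.hamiltonian_eq hε (h.solves n) ht] at h1
  have h3 : (∑ j, |ξ n j|) * ((2 * Real.pi)⁻¹ * (C * ε n ^ α / α))
      ≤ M * ((2 * Real.pi)⁻¹ * (C * ε n ^ α / α)) := by
    have := h.mass_le n
    gcongr
  rw [abs_le] at h1 h2 ⊢
  constructor <;> linarith [h1.1, h1.2, h2.1, h2.2]

lemma IsBlobSequence.memLp_spaceTime (h : IsBlobSequence φ T C α R M ε N ξ X)
    (hφ : IsBlob φ) (hC : 0 ≤ C) (hα : 0 < α) (hT : 0 ≤ T) (n : ℕ) :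
    MemLp (fun p : ℝ × Plane => blobVelocity φ (ε n) (ξ n) (X n p.1) p.2) 2 (spaceTime T) := by
  have hu : ContinuousOn (fun p : ℝ × Plane => blobVelocity φ (ε n) (ξ n) (X n p.1) p.2)
      (Icc 0 T ×ˢ univ) :=
    hφ.continuousOn_blobVelocity (h.eps_pos n) (h.solves n).continuousOn_prod continuousOn_snd
  have hm : AEStronglyMeasurable (fun p : ℝ × Plane => blobVelocity φ (ε n) (ξ n) (X n p.1) p.2)
      (spaceTime T) := by
    have h1 := hu.aestronglyMeasurable (μ := volume) (measurableSet_Icc.prod MeasurableSet.univ)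
    rwa [Measure.volume_eq_prod, ← Measure.prod_restrict, Measure.restrict_univ] at h1
  refine ⟨hm, ?_⟩
  -- The bound on the norm at each time is the square root of the initial energy plus the largest
  -- possible drift.
  have h2 := eLpNorm_two_prod_le hm (d := (ENNReal.ofReal
    ((∫ x, ‖blobVelocity φ (ε n) (ξ n) (X n 0) x‖ ^ 2)
      + 2 * (M * ((2 * Real.pi)⁻¹ * (C * ε n ^ α / α))))) ^ (1 / 2 : ℝ)) ?_
  · have h3 : eLpNorm (fun p : ℝ × Plane => blobVelocity φ (ε n) (ξ n) (X n p.1) p.2) 2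
        (spaceTime T) ^ 2 < ∞ := by
      refine h2.trans_lt (ENNReal.mul_lt_top (ENNReal.pow_lt_top
        (ENNReal.rpow_lt_top_of_nonneg (by norm_num) ENNReal.ofReal_ne_top)) ?_)
      simp
    by_contra h4
    simp [not_lt_top_iff.1 h4] at h3
  · filter_upwards [ae_restrict_mem measurableSet_Icc] with t ht
    have h3 := eLpNorm_two_sq_eq (h.integrable_norm_sq hφ ht n)
    have h4 := (abs_le.1 (h.abs_energy_sub_le hφ hC hα hT ht n)).2
    rw [one_div, ENNReal.le_rpow_inv_iff (by norm_num), ENNReal.rpow_two]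
    refine h3.le.trans (ENNReal.ofReal_le_ofReal (by linarith))

/-- Strong compactness in `L²` of the velocities, with convergence at almost every time and at the
initial time. -/
lemma IsBlobSequence.exists_limit (h : IsBlobSequence φ T C α R M ε N ξ X)
    (hφ : IsBlob φ) (hC : 0 ≤ C) (hα : 0 < α) (hT : 0 ≤ T) :
    ∃ (u : ℝ → Plane → Plane) (u₀ : Plane → Plane) (k : ℕ → ℕ), StrictMono k ∧
      MemLp (Function.uncurry u) 2 (spaceTime T) ∧
      Tendsto (fun i => eLpNorm (fun p : ℝ × Plane =>
        blobVelocity φ (ε (k i)) (ξ (k i)) (X (k i) p.1) p.2 - u p.1 p.2) 2 (spaceTime T))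
        atTop (𝓝 0) ∧
      (∀ᵐ t ∂(volume.restrict (Icc 0 T)), MemLp (u t) 2 volume ∧
        Tendsto (fun i => eLpNorm (blobVelocity φ (ε (k i)) (ξ (k i)) (X (k i) t) - u t) 2 volume)
          atTop (𝓝 0)) ∧
      MemLp u₀ 2 volume ∧
      Tendsto (fun i => eLpNorm (blobVelocity φ (ε (k i)) (ξ (k i)) (X (k i) 0) - u₀) 2 volume)
        atTop (𝓝 0) := by
  obtain ⟨k, hk, hc⟩ := h.exists_subseq_cauchy hφ hC hα
  have hc' : ∀ d : ℝ≥0∞, 0 < d → ∃ n₀, ∀ i ≥ n₀, ∀ j ≥ n₀, ∀ t ∈ Icc 0 T,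
      eLpNorm (blobVelocity φ (ε (k i)) (ξ (k i)) (X (k i) t)
        - blobVelocity φ (ε (k j)) (ξ (k j)) (X (k j) t)) 2 volume ≤ d := fun d hd => by
    obtain ⟨r, hr0, hr⟩ : ∃ r : ℝ≥0, 0 < r ∧ (r : ℝ≥0∞) ≤ d := by
      obtain ⟨r, hr0, hr⟩ := ENNReal.lt_iff_exists_nnreal_btwn.1 hd
      exact ⟨r, by exact_mod_cast hr0, hr.le⟩
    obtain ⟨n₀, hn₀⟩ := hc ((r : ℝ) ^ 2) (by positivity)
    refine ⟨n₀, fun i hi j hj t ht => le_trans ?_ hr⟩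
    refine (ENNReal.pow_le_pow_left_iff two_ne_zero).1 ?_
    have h1 := eLpNorm_two_sq_eq (v := blobVelocity φ (ε (k i)) (ξ (k i)) (X (k i) t)
        - blobVelocity φ (ε (k j)) (ξ (k j)) (X (k j) t))
      (h.integral_norm_velocity_sub_sq hφ hC ht (k i) (k j))
    rw [h1]
    refine (ENNReal.ofReal_le_ofReal (hn₀ i hi j hj t ht)).trans (le_of_eq ?_)
    rw [ENNReal.ofReal_pow (by positivity), ENNReal.ofReal_coe_nnreal]
  obtain ⟨u, hu, hlim, hslice⟩ := exists_limit_of_uniform_cauchy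
    (μ := volume.restrict (Icc 0 T)) (ν := (volume : Measure Plane))
    (v := fun i t => blobVelocity φ (ε (k i)) (ξ (k i)) (X (k i) t))
    (fun i => h.memLp_spaceTime hφ hC hα hT (k i)) fun d hd => by
      obtain ⟨n₀, hn₀⟩ := hc' d hd
      refine ⟨n₀, fun i hi j hj => ?_⟩
      filter_upwards [ae_restrict_mem measurableSet_Icc] with t ht using hn₀ i hi j hj t ht
  have h0 : (0 : ℝ) ∈ Icc 0 T := ⟨le_rfl, hT⟩
  -- The slices of `u` are controlled only for almost every time, so the limit at time zero is
  -- constructed separately.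
  obtain ⟨u₀, hu₀, hlim₀⟩ := exists_limit_of_cauchy
    (f := fun i => blobVelocity φ (ε (k i)) (ξ (k i)) (X (k i) 0))
    (fun i => h.memLp hφ h0 (k i)) fun e he => by
      obtain ⟨d, hd0, hd⟩ := exists_between he
      obtain ⟨n₀, hn₀⟩ := hc' d hd0
      exact ⟨n₀, fun i hi j hj => (hn₀ i hi j hj 0 h0).trans_lt hd⟩
  exact ⟨u, u₀, k, hk, hu, hlim, hslice.mono fun t ht => ⟨ht.1, ht.2.2⟩, hu₀, hlim₀⟩

end Limit

/-! ### Properties of the limit velocity -/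

lemma memLp_inner_integrable {A : Type*} [MeasurableSpace A] {μ : Measure A} {f g : A → Plane}
    (hf : MemLp f 2 μ) (hg : MemLp g 2 μ) : Integrable (fun x => inner ℝ (f x) (g x)) μ := by
  refine (L2.integrable_inner (𝕜 := ℝ) hf.toLp hg.toLp).congr ?_
  filter_upwards [hf.coeFn_toLp, hg.coeFn_toLp] with x h1 h2
  rw [h1, h2]

lemma IsTestField.memLp_deriv {T : ℝ} {Φ : ℝ → Plane → Plane} (hΦ : IsTestField T Φ) :
    MemLp (fun p : ℝ × Plane => deriv (fun s => Φ s p.2) p.1) 2 (spaceTime T) := by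
  obtain ⟨ρ, -, hρ⟩ := hΦ.exists_radius
  refine (memLp_two_iff_integrable_sq_norm hΦ.continuous_deriv.aestronglyMeasurable).2 ?_
  refine integrable_spaceTime_of_continuousOn (ρ := ρ)
    (hΦ.continuous_deriv.norm.pow 2).continuousOn fun t _ x hx => ?_
  simp [hΦ.deriv_eq_zero hρ t hx]

lemma IsTestField.integral_momentum_eq {T : ℝ} {Φ : ℝ → Plane → Plane} (hΦ : IsTestField T Φ)
    {w : ℝ → Plane → Plane} (hw : MemLp (fun p : ℝ × Plane => w p.1 p.2) 2 (spaceTime T)) :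
    ∫ t in Icc 0 T, ∫ x, (inner ℝ (w t x) (deriv (fun s => Φ s x) t)
        + inner ℝ (w t x) (fderiv ℝ (Φ t) x (w t x)))
      = (∫ p, inner ℝ (w p.1 p.2) (deriv (fun s => Φ s p.2) p.1) ∂(spaceTime T))
        + ∫ p, inner ℝ (w p.1 p.2) (fderiv ℝ (Φ p.1) p.2 (w p.1 p.2)) ∂(spaceTime T) := by
  obtain ⟨L, _, hL0, -, hL⟩ := hΦ.exists_fderiv_bounds
  have hDn : ∀ p : ℝ × Plane, ‖fderiv ℝ (Φ p.1) p.2‖₊ ≤ (⟨L, hL0⟩ : ℝ≥0) := fun p => (hL p.1).1 p.2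
  have hD : MemLp (fun p : ℝ × Plane => fderiv ℝ (Φ p.1) p.2 (w p.1 p.2)) 2 (spaceTime T) :=
    memLp_apply hDn hΦ.continuous_fderiv_slice.aestronglyMeasurable hw
  have h1 := memLp_inner_integrable hw hΦ.memLp_deriv
  have h2 := memLp_inner_integrable hw hD
  have h3 : Integrable (fun p : ℝ × Plane => inner ℝ (w p.1 p.2) (deriv (fun s => Φ s p.2) p.1)
      + inner ℝ (w p.1 p.2) (fderiv ℝ (Φ p.1) p.2 (w p.1 p.2))) (spaceTime T) := h1.add h2
  rw [← integral_add h1 h2, spaceTime, integral_prod _ h3]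

section Limit

variable {φ : Plane → ℝ} {T C α R M : ℝ} {ε : ℕ → ℝ} {N : ℕ → ℕ}
  {ξ : ∀ n, Fin (N n) → ℝ} {X : ∀ n, ℝ → Fin (N n) → Plane} {v w : Plane → Plane}
  {u : ℝ → Plane → Plane}

/-- Strong convergence passes the energies at times `t` and `0` to the limit, and their difference
along the sequence is `O(ε^α)`. -/
lemma IsBlobSequence.eLpNorm_limit_eq (h : IsBlobSequence φ T C α R M ε N ξ X)
    (hφ : IsBlob φ) (hC : 0 ≤ C) (hα : 0 < α) (hT : 0 ≤ T) {t : ℝ} (ht : t ∈ Icc 0 T)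
    (hv : MemLp v 2 volume) (hw : MemLp w 2 volume)
    (hvl : Tendsto (fun i => eLpNorm (blobVelocity φ (ε i) (ξ i) (X i t) - v) 2 volume)
      atTop (𝓝 0))
    (hwl : Tendsto (fun i => eLpNorm (blobVelocity φ (ε i) (ξ i) (X i 0) - w) 2 volume)
      atTop (𝓝 0)) : eLpNorm v 2 volume = eLpNorm w 2 volume := by
  have key : ∀ {s : ℝ} {q : Plane → Plane}, s ∈ Icc 0 T → MemLp q 2 volume →
      Tendsto (fun i => eLpNorm (blobVelocity φ (ε i) (ξ i) (X i s) - q) 2 volume) atTop (𝓝 0) →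
      Tendsto (fun i => ∫ x, ‖blobVelocity φ (ε i) (ξ i) (X i s) x‖ ^ 2) atTop
        (𝓝 (eLpNorm q 2 volume ^ 2).toReal) := fun {s q} hs hq hl => by
    have h1 := tendsto_eLpNorm_of_sub (fun i => h.memLp hφ hs i) hq hl
    have h2 := (ENNReal.tendsto_toReal (ENNReal.pow_ne_top hq.eLpNorm_ne_top)).comp
      (((ENNReal.continuous_pow 2).tendsto _).comp h1)
    refine h2.congr fun i => ?_
    simp only [Function.comp_apply]
    rw [eLpNorm_two_sq_eq (h.integrable_norm_sq hφ hs i),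
      ENNReal.toReal_ofReal (integral_nonneg fun x => by positivity)]
  have h0 : (0 : ℝ) ∈ Icc 0 T := ⟨le_rfl, hT⟩
  have h1 := (key ht hv hvl).sub (key h0 hw hwl)
  have h2 : Tendsto (fun i => 2 * (M * ((2 * Real.pi)⁻¹ * (C * ε i ^ α / α)))) atTop (𝓝 0) := by
    have h3 := h.eps_tendsto.rpow_const (p := α) (Or.inr hα.le)
    rw [Real.zero_rpow hα.ne'] at h3
    simpa using ((((h3.const_mul C).div_const α).const_mul (2 * Real.pi)⁻¹).const_mul M).const_mul 2
  have h3 : Tendsto (fun i => (∫ x, ‖blobVelocity φ (ε i) (ξ i) (X i t) x‖ ^ 2)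
      - ∫ x, ‖blobVelocity φ (ε i) (ξ i) (X i 0) x‖ ^ 2) atTop (𝓝 0) :=
    squeeze_zero_norm (fun i => h.abs_energy_sub_le hφ hC hα hT ht i) h2
  have h4 := sub_eq_zero.1 (tendsto_nhds_unique h1 h3)
  rw [ENNReal.toReal_eq_toReal_iff' (ENNReal.pow_ne_top hv.eLpNorm_ne_top)
    (ENNReal.pow_ne_top hw.eLpNorm_ne_top)] at h4
  exact (ENNReal.pow_right_strictMono two_ne_zero).injective h4

lemma IsBlobSequence.integral_fderiv_limit_eq_zero (h : IsBlobSequence φ T C α R M ε N ξ X)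
    (hφ : IsBlob φ) {t : ℝ} (ht : t ∈ Icc 0 T) (hv : MemLp v 2 volume)
    (hvl : Tendsto (fun i => eLpNorm (blobVelocity φ (ε i) (ξ i) (X i t) - v) 2 volume)
      atTop (𝓝 0)) {ψ : Plane → ℝ} (hψ : ContDiff ℝ 1 ψ) (hψc : HasCompactSupport ψ) :
    ∫ x, fderiv ℝ ψ x (v x) = 0 := by
  -- Riesz representation of the derivative, so that the pairing becomes an `L²` inner product.
  set G : Plane → Plane := fun x => (InnerProductSpace.toDual ℝ Plane).symm (fderiv ℝ ψ x) with hG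
  have hGi : ∀ x z, inner ℝ (G x) z = fderiv ℝ ψ x z := fun x z =>
    InnerProductSpace.toDual_symm_apply
  have hGm : MemLp G 2 volume := by
    refine Continuous.memLp_of_hasCompactSupport
      ((InnerProductSpace.toDual ℝ Plane).symm.continuous.comp
        (hψ.continuous_fderiv one_ne_zero)) ?_
    exact (hψc.fderiv ℝ).comp_left (map_zero _)
  have h1 := tendsto_integral_inner (fun _ => hGm) hGm (fun i => h.memLp hφ ht i) hv
    (by simp) hvl
  simp only [hGi] at h1
  refine tendsto_nhds_unique h1 (tendsto_const_nhds.congr fun i => ?_)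
  have hd := h.density i t ht
  rw [← hφ.velocity_blobVorticity (h.eps_pos i),
    integral_fderiv_velocity_eq_zero hd.contDiff hd.compactSupport hψ hψc]

/-- The pairings of the initial velocities with a test field have two limits: one by strong `L²`
convergence, one by weak-∗ convergence of the vorticities. Their equality identifies two locally
integrable fields almost everywhere. -/
lemma IsBlobSequence.initial_ae_eq (h : IsBlobSequence φ T C α R M ε N ξ X)
    (hφ : IsBlob φ) (hT : 0 ≤ T) {ω₀ : SignedMeasure Plane} (hω₀ : CompactlySupported ω₀)
    (hws : WeakStarTendsto (fun n => pointVorticity (ξ n) (X n 0)) ω₀)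
    (hw : MemLp w 2 volume)
    (hwl : Tendsto (fun i => eLpNorm (blobVelocity φ (ε i) (ξ i) (X i 0) - w) 2 volume)
      atTop (𝓝 0)) : w =ᵐ[volume] biotSavart ω₀ := by
  have hwi : LocallyIntegrable w := hw.locallyIntegrable (by norm_num)
  have hbi := locallyIntegrable_biotSavart hω₀
  refine ae_eq_of_integral_contDiff_smul_eq hwi hbi fun g hg hgc => ?_
  refine ext_inner_left ℝ fun e => ?_
  rw [← integral_inner (hwi.integrable_smul_left_of_hasCompactSupport hg.continuous hgc),
    ← integral_inner (hbi.integrable_smul_left_of_hasCompactSupport hg.continuous hgc)]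
  have hF : ContDiff ℝ 1 fun x => g x • e := (hg.of_le (by simp)).smul contDiff_const
  have hFc : HasCompactSupport fun x => g x • e := hgc.smul_right
  have h1 := hφ.tendsto_integral_inner_initial hω₀ h.eps_pos h.eps_tendsto h.mass_le hws hF hFc
  have h2 := tendsto_integral_inner
    (fun _ => hF.continuous.memLp_of_hasCompactSupport (p := 2) (μ := volume) hFc)
    (hF.continuous.memLp_of_hasCompactSupport hFc)
    (fun i => h.memLp hφ ⟨le_rfl, hT⟩ i) hw (by simp) hwl
  have h3 := tendsto_nhds_unique h2 h1
  simpa only [real_inner_smul_left, real_inner_smul_right] using h3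

/-- Strong `L²` convergence passes to the limit in the quadratic term, where weak convergence would
not suffice, and the consistency error tends to zero. -/
lemma IsBlobSequence.momentum_limit (h : IsBlobSequence φ T C α R M ε N ξ X)
    (hφ : IsBlob φ) (hC : 0 ≤ C) (hα : 0 < α) (hT : 0 ≤ T)
    (hu : MemLp (fun p : ℝ × Plane => u p.1 p.2) 2 (spaceTime T))
    (hul : Tendsto (fun i => eLpNorm (fun p : ℝ × Plane =>
        blobVelocity φ (ε i) (ξ i) (X i p.1) p.2 - u p.1 p.2) 2 (spaceTime T)) atTop (𝓝 0))
    (hw : MemLp w 2 volume)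
    (hwl : Tendsto (fun i => eLpNorm (blobVelocity φ (ε i) (ξ i) (X i 0) - w) 2 volume)
      atTop (𝓝 0)) {Φ : ℝ → Plane → Plane} (hΦ : IsTestField T Φ) :
    ∫ t in Icc 0 T, ∫ x, (inner ℝ (u t x) (deriv (fun s => Φ s x) t)
        + inner ℝ (u t x) (fderiv ℝ (Φ t) x (u t x))) = -∫ x, inner ℝ (w x) (Φ 0 x) := by
  obtain ⟨L, L₂, hL0, hL₂0, hL⟩ := hΦ.exists_fderiv_bounds
  have hun : ∀ i, MemLp (fun p : ℝ × Plane => blobVelocity φ (ε i) (ξ i) (X i p.1) p.2) 2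
      (spaceTime T) := fun i => h.memLp_spaceTime hφ hC hα hT i
  have hΦ0 : MemLp (Φ 0) 2 volume := (hΦ.contDiff_slice 0).continuous.memLp_of_hasCompactSupport
    (hΦ.hasCompactSupport_slice 0)
  have hDn : ∀ p : ℝ × Plane, ‖fderiv ℝ (Φ p.1) p.2‖₊ ≤ (⟨L, hL0⟩ : ℝ≥0) := fun p => (hL p.1).1 p.2
  have hDm : AEStronglyMeasurable (fun p : ℝ × Plane => fderiv ℝ (Φ p.1) p.2) (spaceTime T) :=
    hΦ.continuous_fderiv_slice.aestronglyMeasurable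
  have h1 := tendsto_integral_inner hun hu (fun _ => hΦ.memLp_deriv) hΦ.memLp_deriv hul (by simp)
  have h2 := tendsto_integral_inner hun hu (fun i => memLp_apply hDn hDm (hun i))
    (memLp_apply hDn hDm hu) hul (tendsto_eLpNorm_apply_sub hDn hul)
  have h3 := tendsto_integral_inner (fun i => h.memLp hφ ⟨le_rfl, hT⟩ i) hw (fun _ => hΦ0) hΦ0
    hwl (by simp)
  have h4 := (h1.add h2).add h3
  have h5 : Tendsto (fun i =>
      (∫ t in Icc 0 T, ∫ x, (inner ℝ (blobVelocity φ (ε i) (ξ i) (X i t) x)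
          (deriv (fun s => Φ s x) t)
        + inner ℝ (blobVelocity φ (ε i) (ξ i) (X i t) x)
          (fderiv ℝ (Φ t) x (blobVelocity φ (ε i) (ξ i) (X i t) x))))
      + ∫ x, inner ℝ (blobVelocity φ (ε i) (ξ i) (X i 0) x) (Φ 0 x)) atTop (𝓝 0) := by
    rw [Metric.tendsto_nhds]
    intro d hd
    -- The error accumulated over `[0,T]` is at most `d T/(T+1) < d`.
    have hδ : 0 < d / (T + 1) := by positivity
    have hε : Tendsto ε atTop (𝓝[>] 0) :=
      tendsto_nhdsWithin_iff.2 ⟨h.eps_tendsto, Eventually.of_forall h.eps_pos⟩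
    filter_upwards [hε.eventually
      (hφ.eventually_abs_consistency_le hC hα h.mass_nonneg hL0 hL₂0 hδ)] with i hi
    rw [Real.dist_eq, sub_zero]
    refine (hφ.abs_weak_form_le (h.eps_pos i) hT (h.solves i) hΦ (δ := d / (T + 1))
      fun t ht => ?_).trans_lt ?_
    · refine hi _ _ _ (h.mass_le i) (h.density i t ⟨ht.1, ht.2.le⟩).decay (fun y => perp (Φ t y))
        (fun x => perpL.comp (fderiv ℝ (Φ t) x)) (fun x => ?_) (fun x => ?_) (fun x y => ?_)
      · exact perpL.hasFDerivAt.comp x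
          ((hΦ.contDiff_slice t).differentiable (by simp) x).hasFDerivAt
      · exact (norm_perpL_comp_le _).trans ((hL t).1 x)
      · rw [← ContinuousLinearMap.comp_sub]
        exact (norm_perpL_comp_le _).trans ((hL t).2 x y)
    · rw [div_mul_eq_mul_div, div_lt_iff₀ (by positivity)]
      nlinarith
  rw [hΦ.integral_momentum_eq hu]
  refine eq_neg_of_add_eq_zero_left (tendsto_nhds_unique h4 (h5.congr fun i => ?_))
  rw [hΦ.integral_momentum_eq (hun i)]

lemma IsBlobSequence.noEnergyConcentration (h : IsBlobSequence φ T C α R M ε N ξ X)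
    (hφ : IsBlob φ) (hC : 0 ≤ C) (hα : 0 < α) (hT : 0 ≤ T)
    (hu : MemLp (fun p : ℝ × Plane => u p.1 p.2) 2 (spaceTime T))
    (hul : Tendsto (fun i => eLpNorm (fun p : ℝ × Plane =>
        blobVelocity φ (ε i) (ξ i) (X i p.1) p.2 - u p.1 p.2) 2 (spaceTime T)) atTop (𝓝 0)) :
    NoEnergyConcentration T (fun i t => blobVelocity φ (ε i) (ξ i) (X i t)) u := by
  intro g hg hgc
  have hun : ∀ i, MemLp (fun p : ℝ × Plane => blobVelocity φ (ε i) (ξ i) (X i p.1) p.2) 2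
      (spaceTime T) := fun i => h.memLp_spaceTime hφ hC hα hT i
  obtain ⟨B, hB⟩ := hgc.exists_bound_of_continuous hg
  have hB0 : 0 ≤ B := (norm_nonneg _).trans (hB 0)
  -- Multiplication by `g` is viewed as a bounded field of linear maps, so the quadratic limit has
  -- the same form as the one with the gradient of the test field.
  set D : ℝ × Plane → Plane →L[ℝ] Plane := fun p => g p • ContinuousLinearMap.id ℝ Plane with hD
  have hDn : ∀ p, ‖D p‖₊ ≤ (⟨B, hB0⟩ : ℝ≥0) := fun p => by
    change ‖D p‖ ≤ B
    rw [hD, norm_smul]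
    refine (mul_le_of_le_one_right (norm_nonneg _) ContinuousLinearMap.norm_id_le).trans (hB p)
  have hDm : AEStronglyMeasurable D (spaceTime T) :=
    (hg.smul continuous_const).aestronglyMeasurable
  have key : ∀ {q : ℝ → Plane → Plane}, MemLp (fun p : ℝ × Plane => q p.1 p.2) 2 (spaceTime T) →
      ∫ p, inner ℝ (q p.1 p.2) (D p (q p.1 p.2)) ∂(spaceTime T)
        = ∫ t in Icc 0 T, ∫ x, g (t, x) * ‖q t x‖ ^ 2 := fun {q} hq => by
    have h1 := integral_prod _ (memLp_inner_integrable hq (memLp_apply hDn hDm hq))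
    rw [show spaceTime T = (volume.restrict (Icc 0 T)).prod volume from rfl, h1]
    simp [hD, real_inner_smul_right]
  have h2 := tendsto_integral_inner hun hu (fun i => memLp_apply hDn hDm (hun i))
    (memLp_apply hDn hDm hu) hul (tendsto_eLpNorm_apply_sub hDn hul)
  rw [key hu] at h2
  exact h2.congr fun i => key (hun i)

end Limit

end VortexBlob

end

/-! ### Assembly of the theorem. -/

theorem theorem3p1
    (φ : VortexBlob.Plane → ℝ) (hφ : VortexBlob.IsBlob φ)
    (T : ℝ) (hT : 0 < T)
    (ω₀ : SignedMeasure VortexBlob.Plane)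
    (hω₀_supp : VortexBlob.CompactlySupported ω₀)
    (hω₀_H : VortexBlob.MemHMinusOne ω₀)
    (hω₀_mean : ω₀ univ = 0)
    (ε : ℕ → ℝ) (N : ℕ → ℕ) (ξ : ∀ n, Fin (N n) → ℝ)
    (X : ∀ n, ℝ → Fin (N n) → VortexBlob.Plane)
    (hgood : VortexBlob.IsGoodApproximation φ T ω₀ ε N ξ X)
    (hmean : ∀ n, ∑ j, ξ n j = 0)
    (C α : ℝ) (hC : 0 < C) (hα : 0 < α)
    (hdecay : ∀ n, ∀ t ∈ Icc (0 : ℝ) T, ∀ r : ℝ, 0 < r →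
      VortexBlob.maximalFunction
          (volume.withDensityᵥ (VortexBlob.blobVorticity φ (ε n) (ξ n) (X n t))) r
        ≤ ENNReal.ofReal (C * r ^ α))
    (R : ℝ) (hR : 0 < R)
    (hsupp : ∀ n, ∀ t ∈ Icc (0 : ℝ) T,
      tsupport (VortexBlob.blobVorticity φ (ε n) (ξ n) (X n t)) ⊆ Metric.ball 0 R) :
    (∃ (u : ℝ → VortexBlob.Plane → VortexBlob.Plane) (k : ℕ → ℕ),
      StrictMono k ∧
      MemLp (Function.uncurry u) 2 (VortexBlob.spaceTime T) ∧
      Tendsto (fun i => eLpNorm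
          (fun p : ℝ × VortexBlob.Plane =>
            VortexBlob.blobVelocity φ (ε (k i)) (ξ (k i)) (X (k i) p.1) p.2 - u p.1 p.2)
          2 (VortexBlob.spaceTime T)) atTop (𝓝 0) ∧
      VortexBlob.IsWeakEulerSolution T (VortexBlob.biotSavart ω₀) u ∧
      VortexBlob.IsEnergyConservative T (VortexBlob.biotSavart ω₀) u ∧
      VortexBlob.NoEnergyConcentration T
        (fun i t => VortexBlob.blobVelocity φ (ε (k i)) (ξ (k i)) (X (k i) t)) u) ∧
    (∃ C' : ℝ, 0 < C' ∧ ∀ n, ∀ t ∈ Icc (0 : ℝ) T, ∀ r : ℝ, 0 ≤ r →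
      VortexBlob.structureFunction
          (VortexBlob.blobVelocity φ (ε n) (ξ n) (X n t)) r
        ≤ ENNReal.ofReal (C' * r ^ (α / 2))) := by
  have hseq : VortexBlob.IsBlobSequence φ T C α R (VortexBlob.totalMass ω₀) ε N ξ X :=
    { eps_pos := hgood.eps_pos
      eps_tendsto := hgood.eps_tendsto
      solves := hgood.solves
      mass_le := hgood.mass_le
      density := fun n t ht => hφ.isVortexDensity (hgood.eps_pos n) (hdecay n t ht)
        (hsupp n t ht) (hmean n) (hgood.mass_le n) }
  refine ⟨?_, ?_⟩
  · obtain ⟨u, u₀, k, hk, hu, hul, hslice, hu₀, hu₀l⟩ := hseq.exists_limit hφ hC.le hα hT.le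
    have hsub := hseq.comp hk
    have h0 := hsub.initial_ae_eq hφ hT.le hω₀_supp
      (fun f => (hgood.weakStar f).comp hk.tendsto_atTop) hu₀ hu₀l
    have henergy : VortexBlob.IsEnergyConservative T (VortexBlob.biotSavart ω₀) u := by
      filter_upwards [hslice, ae_restrict_mem measurableSet_Icc] with t ht htm
      rw [hsub.eLpNorm_limit_eq hφ hC.le hα hT.le htm ht.1 hu₀ ht.2 hu₀l, eLpNorm_congr_ae h0]
    have hinit := hu₀.ae_eq h0
    refine ⟨u, k, hk, hu, hul, ⟨hinit, hu.aestronglyMeasurable, ?_, ?_, ?_⟩, henergy,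
      hsub.noEnergyConcentration hφ hC.le hα hT.le hu hul⟩
    · refine ⟨(eLpNorm (VortexBlob.biotSavart ω₀) 2 volume).toNNReal, ?_⟩
      filter_upwards [henergy] with t ht
      rw [ht, ENNReal.coe_toNNReal hinit.eLpNorm_ne_top]
    · filter_upwards [hslice, ae_restrict_mem measurableSet_Icc] with t ht htm ψ hψ hψc
      exact hsub.integral_fderiv_limit_eq_zero hφ htm ht.1 ht.2 (hψ.of_le (by simp)) hψc
    · intro Φ hΦ
      rw [hsub.momentum_limit hφ hC.le hα hT.le hu hul hu₀ hu₀l hΦ]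
      congr 1
      refine integral_congr_ae ?_
      filter_upwards [h0] with x hx
      rw [hx]
  · set c := Real.sqrt (2 * VortexBlob.totalMass ω₀ * ((2 * Real.pi)⁻¹ * (C / α))) with hc
    have hc0 : 0 ≤ c := Real.sqrt_nonneg _
    -- The constant `c` vanishes when the mass does, so `1` is added for strict positivity.
    refine ⟨c + 1, by positivity, fun n t ht r hr => ?_⟩
    rcases hr.eq_or_lt with rfl | hr
    -- The ball of radius zero is empty and its average is zero, in accordance with the convention
    -- at `r = 0`.
    · simp [VortexBlob.structureFunction]
    · have h := (hseq.density n t ht).structureFunction_le hC.le hα hr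
      rw [hφ.velocity_blobVorticity (hgood.eps_pos n)] at h
      refine h.trans (ENNReal.ofReal_le_ofReal ?_)
      rw [← hc]
      gcongr
      linarith
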